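/- **Setting.** Let $d\ge 1$, $T\in(0,\infty)$, $p\in(1,\infty)$. All functions are complex valued, and $$\mathcal F^{-1}[h](x)=(2\pi)^{-d/2}\int_{\mathbb R^d}e^{ix\cdot\xi}h(\xi)\,d\xi,\qquad \mathcal F[g](\xi)=(2\pi)^{-d/2}\int_{\mathbb R^d} e^{-i\xi\cdot x}g(x)\,dx,$$ the latter extended to $g\in L_2(\mathbb R^d)$. * $C_p^\infty([0,T]\times\mathbb R^d)$ is the set of Borel functions $f$ on $[0,T]\times\mathbb R^d$ such that $f(t,\cdot)\in C^\infty(\mathbb R^d)$ for almost every $t\in[0,T]$ and $D_x^\alpha f\in L_\infty([0,T];L_2(\mathbb R^d)\cap L_p(\mathbb R^d))$ for every multi-index $\alpha$. * $C_p^{1,\infty}([0,T]\times\mathbb R^d)$ is the set of $u\in C_p^\infty([0,T]\times\mathbb R^d)$ such that $u(t,\cdot)\in C^\infty(\mathbb R^d)$ for every $t\in[0,T]$, every $D_x^\alpha u$ is bounded and continuous on $[0,T]\times\mathbb R^d$, and $\partial_tu\in C_p^\infty([0,T]\times\mathbb R^d)$, in the sense that $t\mapsto u(t,x)$ is absolutely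 continuous on $[0,T]$ for every $x$ and there is $g\in C_p^\infty([0,T]\times\mathbb R^d)$ such that, for almost every $t$, $\partial_tu(t,x)$ exists and equals $g(t,x)$ for all $x$. Let $\psi:\mathbb R\times\mathbb R^d\to\mathbb C$ be locally integrable, and let $\gamma>0$, $\kappa\in(0,1]$, $M>0$ be such that 1. (ellipticity) $\Re[-\psi(t,\xi)]\ge\kappa|\xi|^\gamma$ for all $(t,\xi)\in\mathbb R\times\mathbb R^d$; 2. ($(\lfloor d/2\rfloor+1)$-times regular upper bound) for every $t$, $\psi(t,\cdot)\in C^{\lfloor d/2\rfloor+1}(\mathbb R^d\setminus\{0\})$, and $|D_\xi^\alpha\psi(t,\xi)|\le M|\xi|^{\gamma-|\alpha|}$ for all $t\in\mathbb R$, $\xi\ne0$ and all multi-indices $\alpha$ with $|\alpha|\le\lfloor d/2\rfloor+1$. Write $\psi(t,-i\nabla)u(t,x)=\mathcal F^{-1}\big[\psi(t,\cdot)\,\mathcal F[u(t,\cdot)]\big](x)$. **Theorem.** For every $f\in C_p^\infty([0,T]\times\mathbb R^d)$ there is a unique $u\in C_p^{1,\infty}([0,T]\times\mathbb R^d)$ that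 solves the Cauchy problem $$\partial_tu(t,x)=\psi(t,-i\nabla)u(t,x)+f(t,x)\ \text{ for almost every }t\in(0,T)\text{ and all }x\in\mathbb R^d,\qquad u(0,x)=0\ \text{ for all } x\in\mathbb R^d .$$ Moreover, for all $(t,x)\in[0,T]\times\mathbb R^d$, $$u(t,x)=\mathcal Kf(t,x):=\int_{-\infty}^t\int_{\mathbb R^d}p(t,s,x-y)\,1_{0<s<T}\,f(s,y)\,dy\,ds,$$ $$p(t,s,x):=1_{0<s<t}\,\frac1{(2\pi)^{d}}\int_{\mathbb R^d}\exp\Big(\int_s^t\psi(r,\xi)\,dr\Big)e^{ix\cdot\xi}\,d\xi,$$ where all these integrals converge absolutely. -/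

import Mathlib

open MeasureTheory Set
open scoped ContDiff FourierTransform NNReal ENNReal

noncomputable section

namespace PseudoDiffCauchy

/-- The first order partial derivative `D_{x^i} g` of a function on `ℝ^d`. -/
def partialDeriv {d : ℕ} (i : Fin d) (g : EuclideanSpace ℝ (Fin d) → ℂ) :
    EuclideanSpace ℝ (Fin d) → ℂ :=
  fun x => lineDeriv ℝ g x (EuclideanSpace.single i 1)

/-- The derivative `D^α g = D_{x^1}^{α_1} ⋯ D_{x^d}^{α_d} g` for a multi-index `α`. -/
def multiDeriv {d : ℕ} (α : Fin d → ℕ) (g : EuclideanSpace ℝ (Fin d) → ℂ) :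
    EuclideanSpace ℝ (Fin d) → ℂ :=
  (List.finRange d).foldr (fun i h => (partialDeriv i)^[α i] h) g

/-- The class `C_p^∞([0,T] × ℝ^d)`: Borel functions on `[0,T] × ℝ^d`, smooth in `x` for almost
every `t`, all of whose space derivatives belong to `L_∞([0,T]; L_2 ∩ L_p)`. Only the values of
`f` on `[0,T] × ℝ^d` matter. -/
structure IsCpInf {d : ℕ} (T p : ℝ) (f : ℝ → EuclideanSpace ℝ (Fin d) → ℂ) : Prop where
  measurable : Measurable (fun z : Icc (0 : ℝ) T × EuclideanSpace ℝ (Fin d) => f z.1 z.2)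
  contDiff : ∀ᵐ t ∂(volume.restrict (Icc 0 T)), ContDiff ℝ ∞ (f t)
  bound : ∀ α : Fin d → ℕ, ∃ C : ℝ≥0, ∀ᵐ t ∂(volume.restrict (Icc 0 T)),
    eLpNorm (multiDeriv α (f t)) 2 volume ≤ C ∧
    eLpNorm (multiDeriv α (f t)) (ENNReal.ofReal p) volume ≤ C

/-- The class `C_p^{1,∞}([0,T] × ℝ^d)`: the functions `u` in `C_p^∞` all of whose space derivatives
are continuous and bounded on `[0,T] × ℝ^d`, and whose time derivative belongs to `C_p^∞`. The time
derivative is understood in the Lebesgue sense: `u(·,x)` is absolutely continuous on `[0,T]` for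
every `x`, and the derivative exists for almost every `t` and all `x`. -/
structure IsCpOneInf {d : ℕ} (T p : ℝ) (u : ℝ → EuclideanSpace ℝ (Fin d) → ℂ) : Prop where
  isCpInf : IsCpInf T p u
  contDiff : ∀ t ∈ Icc 0 T, ContDiff ℝ ∞ (u t)
  continuousOn : ∀ α : Fin d → ℕ,
    ContinuousOn (fun z : ℝ × EuclideanSpace ℝ (Fin d) => multiDeriv α (u z.1) z.2)
      (Icc 0 T ×ˢ univ)
  bounded : ∀ α : Fin d → ℕ, ∃ C : ℝ, ∀ t ∈ Icc 0 T, ∀ x, ‖multiDeriv α (u t) x‖ ≤ C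
  absolutelyContinuous : ∀ x, AbsolutelyContinuousOnInterval (fun t => u t x) 0 T
  timeDeriv : ∃ g : ℝ → EuclideanSpace ℝ (Fin d) → ℂ, IsCpInf T p g ∧
    ∀ᵐ t ∂(volume.restrict (Icc 0 T)), ∀ x, HasDerivAt (fun s => u s x) (g t x) t

/-- The ellipticity condition with `(γ, κ)`. -/
def IsElliptic {d : ℕ} (ψ : ℝ → EuclideanSpace ℝ (Fin d) → ℂ) (γ κ : ℝ) : Prop :=
  0 < γ ∧ 0 < κ ∧ κ ≤ 1 ∧ ∀ t ξ, κ * ‖ξ‖ ^ γ ≤ (-ψ t ξ).re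

/-- An `n`-times regular upper bound with `(γ, M)`. -/
def HasRegularUpperBound {d : ℕ} (n : ℕ) (ψ : ℝ → EuclideanSpace ℝ (Fin d) → ℂ) (γ M : ℝ) :
    Prop :=
  0 < γ ∧ 0 < M ∧ (∀ t, ContDiffOn ℝ n (ψ t) {0}ᶜ) ∧
    ∀ α : Fin d → ℕ, ∑ i, α i ≤ n → ∀ t ξ, ξ ≠ 0 →
      ‖multiDeriv α (ψ t) ξ‖ ≤ M * ‖ξ‖ ^ (γ - ((∑ i, α i : ℕ) : ℝ))

/-- The inverse Fourier transform `(2π)^{-d/2} ∫ e^{i x·ξ} h(ξ) dξ` of an integrable function. -/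
def invFourier {d : ℕ} (h : EuclideanSpace ℝ (Fin d) → ℂ) (x : EuclideanSpace ℝ (Fin d)) : ℂ :=
  (((2 * Real.pi) ^ (-(d : ℝ) / 2) : ℝ) : ℂ) *
    ∫ ξ, Complex.exp (Complex.I * ((inner ℝ x ξ : ℝ) : ℂ)) * h ξ

open scoped Classical in
/-- The Fourier transform of `g ∈ L_2(ℝ^d)` (and `0` if `g ∉ L_2`), for the normalization
`(2π)^{-d/2} ∫ e^{-i ξ·x} g(x) dx`. Mathlib's `𝓕` is the continuous extension to `L_2` of
`∫ e^{-2πi ξ·x} g(x) dx`, whence the rescaling. -/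
def fourierL2 {d : ℕ} (g : EuclideanSpace ℝ (Fin d) → ℂ) (ξ : EuclideanSpace ℝ (Fin d)) : ℂ :=
  if hg : MemLp g 2 volume then
    (((2 * Real.pi) ^ (-(d : ℝ) / 2) : ℝ) : ℂ) *
      (𝓕 (hg.toLp g) : Lp ℂ 2 (volume : Measure (EuclideanSpace ℝ (Fin d))))
        ((2 * Real.pi)⁻¹ • ξ)
  else 0

/-- The operator `g ↦ ℱ⁻¹[m ℱ[g]]` with symbol `m`; for the functions `g` used here (all
derivatives in `L_2`) and a symbol of polynomial growth, `m ℱ[g]` is integrable. -/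
def pseudoDiff {d : ℕ} (m : EuclideanSpace ℝ (Fin d) → ℂ) (g : EuclideanSpace ℝ (Fin d) → ℂ) :
    EuclideanSpace ℝ (Fin d) → ℂ :=
  invFourier (fun ξ => m ξ * fourierL2 g ξ)

/-- `u` solves `∂_t u = ψ(t,-i∇)u + f` for almost every `t ∈ (0,T)` and all `x`, and
`u(0,·) = 0`. -/
def IsCauchySolution {d : ℕ} (T : ℝ) (ψ f u : ℝ → EuclideanSpace ℝ (Fin d) → ℂ) : Prop :=
  (∀ᵐ t ∂(volume.restrict (Ioo 0 T)), ∀ x,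
    HasDerivAt (fun s => u s x) (pseudoDiff (ψ t) (u t) x + f t x) t) ∧
  ∀ x, u 0 x = 0

/-- The fundamental solution
`p(t,s,x) = 1_{0<s<t} (2π)^{-d} ∫ exp(∫_s^t ψ(r,ξ) dr) e^{i x·ξ} dξ`. -/
def kernel {d : ℕ} (ψ : ℝ → EuclideanSpace ℝ (Fin d) → ℂ) (t s : ℝ)
    (x : EuclideanSpace ℝ (Fin d)) : ℂ :=
  if 0 < s ∧ s < t then
    (((2 * Real.pi) ^ (-(d : ℝ)) : ℝ) : ℂ) *
      ∫ ξ, Complex.exp (∫ r in s..t, ψ r ξ) * Complex.exp (Complex.I * ((inner ℝ x ξ : ℝ) : ℂ))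
  else 0

/-- The integrand `p(t,s,x-y) 1_{0<s<T} f(s,y)` of `𝒦f(t,x)`. -/
def kernelIntegrand {d : ℕ} (T : ℝ) (ψ f : ℝ → EuclideanSpace ℝ (Fin d) → ℂ) (t : ℝ)
    (x : EuclideanSpace ℝ (Fin d)) (s : ℝ) (y : EuclideanSpace ℝ (Fin d)) : ℂ :=
  kernel ψ t s (x - y) * (if 0 < s ∧ s < T then f s y else 0)

/-- `𝒦f(t,x) = ∫_{-∞}^t ∫ p(t,s,x-y) 1_{0<s<T} f(s,y) dy ds`. -/
def kernelOp {d : ℕ} (T : ℝ) (ψ f : ℝ → EuclideanSpace ℝ (Fin d) → ℂ) (t : ℝ)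
    (x : EuclideanSpace ℝ (Fin d)) : ℂ :=
  ∫ s in Iio t, ∫ y, kernelIntegrand T ψ f t x s y

end PseudoDiffCauchy

end

/-! On the Fourier side the problem is, at each frequency, the scalar equation `∂_t û = ψ û + f̂`.
The solution must therefore be Duhamel's integral of the propagators with symbol `exp ∫_s^t ψ`. What
has to be shown is that this formula stays inside `L_2 ∩ L_p` with all space derivatives, that it
may be differentiated in time, and that nothing else solves the problem.

The heart is a bound for the fundamental solution in `L_1`, uniform in `s < t`
(`exists_lintegral_fourierInv_phase_le`). Only `n = ⌊d/2⌋+1` derivatives of the symbol `m` are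
available, so decay in `x` is extracted through `L_2`. With `0 < ε ≤ γ` and `ε < 1/2`, ellipticity
makes `m - 1` of size `(t-s)^{ε/γ} |ξ|^ε`, with derivatives along coordinate lines to match. The
`n`-th difference of `m` with step `h` is then at most a constant times `(t-s)^{ε/γ} h^ε
(1+|ξ|/h)^{-(n-ε)}`, which is square integrable because `n - ε > d/2`. A difference of the symbol
multiplies the kernel by `e^{2πi v·x} - 1`, which is bounded below for a suitable direction when
`|x|` is comparable to `1/h`. Plancherel and Cauchy–Schwarz then give `O((t-s)^{ε/γ} R^{-ε})` on the
annulus `R ≤ |x| ≤ 2R`, and the dyadic sum converges. The ball `|x| ≤ (t-s)^{1/γ}` is treated by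
Cauchy–Schwarz alone, and at this radius all powers of `t-s` cancel.

The operator `ψ(t,-i∇)` is unbounded, but `ψ(t,ξ) ∏ (1+iξ_j)^{-N}` satisfies the same `L_1`
criterion for large `N`. On smooth functions the operator is thus a differential operator `liftOp`
followed by convolution with an integrable kernel, so it preserves the smooth class
(`smoothField_liftedConv`, through Minkowski's inequality). Integrating the scalar equation for `exp
∫_s^t ψ` under the Fourier integral and exchanging the order of integration shows that Duhamel's
integral equals `∫_0^t (ψ(r,-i∇)u + f) dr` (`duhamel_eq_integral`). Time regularity and the equation
follow.

Uniqueness is the energy method: by Parseval and `Re ψ ≤ 0` the time derivative of `‖w(t)‖²` is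
nonpositive for the difference `w` of two solutions (`eq_zero_of_energy`). The kernel formula for an
arbitrary solution is then a consequence of uniqueness.

Two reductions precede this. The symbol becomes jointly measurable after altering it on a null set
of times and at the origin, and `f` is replaced by a field whose bounds hold at every time. Since
`𝓕` uses `e^{-2πi x·ξ}`, the work is done with `χ(r,η) = ψ(r,2πη)`. -/

open scoped LineDeriv

noncomputable section

namespace PseudoDiffCauchy

/-! ### The Fourier transform on `L²` and its agreement with the integral transform. -/

section FourierLTwo

variable {V : Type*} [NormedAddCommGroup V] [InnerProductSpace ℝ V] [FiniteDimensional ℝ V]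
  [MeasurableSpace V] [BorelSpace V]

open scoped Classical in
/-- The Fourier transform of an `L²` function, as a function (and `0` off `L²`). -/
def ltwoFourier (g : V → ℂ) : V → ℂ :=
  if hg : MemLp g 2 volume then (𝓕 (hg.toLp g) : Lp ℂ 2 (volume : Measure V)) else 0

lemma ltwoFourier_of_memLp {g : V → ℂ} (hg : MemLp g 2 volume) :
    ltwoFourier g = (𝓕 (hg.toLp g) : Lp ℂ 2 (volume : Measure V)) := by
  simp [ltwoFourier, hg]

lemma memLp_ltwoFourier (g : V → ℂ) : MemLp (ltwoFourier g) 2 volume := by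
  by_cases hg : MemLp g 2 volume
  · rw [ltwoFourier_of_memLp hg]; exact Lp.memLp _
  · simp [ltwoFourier, hg]

lemma toLp_ltwoFourier {g : V → ℂ} (hg : MemLp g 2 volume) :
    (memLp_ltwoFourier g).toLp _ = 𝓕 (hg.toLp g) := by
  apply Lp.ext
  refine (MemLp.coeFn_toLp _).trans ?_
  rw [ltwoFourier_of_memLp hg]

lemma eLpNorm_ltwoFourier {g : V → ℂ} (hg : MemLp g 2 volume) :
    eLpNorm (ltwoFourier g) 2 volume = eLpNorm g 2 volume := by
  have h := congrArg (fun z => ‖z‖) (toLp_ltwoFourier hg)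
  simp only [Lp.norm_fourier_eq, Lp.norm_toLp] at h
  exact (ENNReal.toReal_eq_toReal_iff' (memLp_ltwoFourier g).2.ne hg.2.ne).1 h

lemma ltwoFourier_add {g h : V → ℂ} (hg : MemLp g 2 volume) (hh : MemLp h 2 volume) :
    ltwoFourier (g + h) =ᵐ[volume] ltwoFourier g + ltwoFourier h := by
  rw [ltwoFourier_of_memLp hg, ltwoFourier_of_memLp hh, ltwoFourier_of_memLp (hg.add hh),
    MemLp.toLp_add, FourierTransform.fourier_add]
  exact Lp.coeFn_add _ _

lemma ltwoFourier_sub {g h : V → ℂ} (hg : MemLp g 2 volume) (hh : MemLp h 2 volume) :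
    ltwoFourier (g - h) =ᵐ[volume] ltwoFourier g - ltwoFourier h := by
  rw [ltwoFourier_of_memLp hg, ltwoFourier_of_memLp hh, ltwoFourier_of_memLp (hg.sub hh),
    MemLp.toLp_sub hg hh]
  have : 𝓕 (hg.toLp g - hh.toLp h) = 𝓕 (hg.toLp g) - 𝓕 (hh.toLp h) :=
    (Lp.fourierTransformₗᵢ V ℂ).map_sub _ _
  rw [this]
  exact Lp.coeFn_sub _ _

lemma ltwoFourier_const_mul {g : V → ℂ} (hg : MemLp g 2 volume) (c : ℂ) :
    ltwoFourier (fun x => c * g x) =ᵐ[volume] fun x => c * ltwoFourier g x := by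
  have hc : MemLp (c • g) 2 volume := hg.const_smul c
  change ltwoFourier (c • g) =ᵐ[volume] _
  rw [ltwoFourier_of_memLp hg, ltwoFourier_of_memLp hc, MemLp.toLp_const_smul,
    FourierTransform.fourier_smul]
  exact Lp.coeFn_smul _ _

/-- Parseval's identity. -/
lemma integral_ltwoFourier_mul_conj {g h : V → ℂ} (hg : MemLp g 2 volume)
    (hh : MemLp h 2 volume) :
    ∫ x, ltwoFourier h x * (starRingEnd ℂ) (ltwoFourier g x) = ∫ x, h x * (starRingEnd ℂ) (g x) := by
  have h1 := Lp.inner_fourier_eq (hg.toLp g) (hh.toLp h)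
  rw [← toLp_ltwoFourier hg, ← toLp_ltwoFourier hh, L2.inner_def, L2.inner_def] at h1
  refine Eq.trans (integral_congr_ae ?_) (h1.trans (integral_congr_ae ?_))
  · filter_upwards [(memLp_ltwoFourier g).coeFn_toLp, (memLp_ltwoFourier h).coeFn_toLp]
      with x hx hy
    rw [hx, hy]; rfl
  · filter_upwards [hg.coeFn_toLp, hh.coeFn_toLp] with x hx hy
    rw [hx, hy]; rfl

/-- The multiplication formula against Schwartz functions. -/
lemma integral_schwartz_mul_ltwoFourier {g : V → ℂ} (hg : MemLp g 2 volume)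
    (h : SchwartzMap V ℂ) :
    ∫ x, h x * ltwoFourier g x = ∫ x, (𝓕 h : SchwartzMap V ℂ) x * g x := by
  have h1 := DFunLike.congr_fun (Lp.fourier_toTemperedDistribution_eq (hg.toLp g)) h
  rw [TemperedDistribution.fourier_apply, Lp.toTemperedDistribution_apply,
    Lp.toTemperedDistribution_apply] at h1
  rw [ltwoFourier_of_memLp hg]
  refine Eq.trans h1.symm (integral_congr_ae ?_)
  filter_upwards [hg.coeFn_toLp] with x hx
  rw [hx]; rfl

/-- Smooth compactly supported functions are Schwartz, so this is the fundamental lemma of the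
calculus of variations. It turns the distributional identities for `𝓕` into almost everywhere
identities. -/
lemma ae_eq_of_integral_schwartz_mul {u v : V → ℂ} (hu : LocallyIntegrable u volume)
    (hv : LocallyIntegrable v volume)
    (h : ∀ s : SchwartzMap V ℂ, ∫ x, s x * u x = ∫ x, s x * v x) : u =ᵐ[volume] v := by
  refine ae_eq_of_integral_contDiff_smul_eq hu hv fun g g_smooth g_cpt => ?_
  have hg₁ : HasCompactSupport (Complex.ofRealCLM ∘ g) := g_cpt.comp_left rfl
  have hg₂ : ContDiff ℝ ∞ (Complex.ofRealCLM ∘ g) := by fun_prop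
  simpa using h (hg₁.toSchwartzMap hg₂)

lemma ltwoFourier_eq_fourier {g : V → ℂ} (h1 : Integrable g) (h2 : MemLp g 2 volume) :
    ltwoFourier g =ᵐ[volume] 𝓕 g := by
  refine ae_eq_of_integral_schwartz_mul ((memLp_ltwoFourier g).locallyIntegrable (by norm_num))
    ?_ fun s => ?_
  · exact (VectorFourier.fourierIntegral_continuous Real.continuous_fourierChar
      (by simp only [innerₗ_apply_apply]; fun_prop) h1).locallyIntegrable
  · rw [integral_schwartz_mul_ltwoFourier h2]
    have := VectorFourier.integral_fourierIntegral_smul_eq_flip (L := innerₗ V)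
      Real.continuous_fourierChar (by simp only [innerₗ_apply_apply]; fun_prop) (s.integrable (μ := volume)) h1
    simp only [flip_innerₗ, smul_eq_mul] at this
    exact this

lemma memLp_fourierInv {h : V → ℂ} (h1 : Integrable h) (h2 : MemLp h 2 volume) :
    MemLp (𝓕⁻ h) 2 volume := by
  have : 𝓕⁻ h = (𝓕 h) ∘ (fun x => -x) := by
    ext x; exact Real.fourierInv_eq_fourier_neg h x
  rw [this]
  refine MemLp.comp_measurePreserving ?_ (Measure.measurePreserving_neg (volume : Measure V))
  exact (memLp_ltwoFourier h).ae_eq (ltwoFourier_eq_fourier h1 h2)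

/-- Both transforms satisfy the same multiplication formula against Schwartz functions: the integral
by Fubini, the `L²` one by its compatibility with tempered distributions. -/
lemma toLp_fourierInv {h : V → ℂ} (h1 : Integrable h) (h2 : MemLp h 2 volume) :
    (memLp_fourierInv h1 h2).toLp _ = 𝓕⁻ (h2.toLp h) := by
  refine Lp.ext (((MemLp.coeFn_toLp _).trans ?_))
  refine ae_eq_of_integral_schwartz_mul
    ((memLp_fourierInv h1 h2).locallyIntegrable (by norm_num))
    ((Lp.memLp _).locallyIntegrable (by norm_num)) fun s => ?_
  have h3 := DFunLike.congr_fun (Lp.fourierInv_toTemperedDistribution_eq (h2.toLp h)) s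
  rw [TemperedDistribution.fourierInv_apply, Lp.toTemperedDistribution_apply,
    Lp.toTemperedDistribution_apply] at h3
  refine Eq.trans ?_ h3
  have h4 : ∫ x, (𝓕⁻ s : SchwartzMap V ℂ) x • (h2.toLp h) x
      = ∫ x, (𝓕⁻ s : SchwartzMap V ℂ) x * h x := by
    refine integral_congr_ae ?_
    filter_upwards [h2.coeFn_toLp] with x hx
    rw [hx]; rfl
  rw [h4]
  have h5 := VectorFourier.integral_fourierIntegral_smul_eq_flip (L := -innerₗ V)
      (μ := volume) (ν := volume)
      Real.continuous_fourierChar (by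
        simp only [LinearMap.neg_apply, innerₗ_apply_apply]; fun_prop)
      (s.integrable (μ := volume)) h1
  have h6 : ∀ (q : V → ℂ), VectorFourier.fourierIntegral 𝐞 volume (-innerₗ V) q = 𝓕⁻ q := by
    intro q; ext x
    simp [VectorFourier.fourierIntegral, Real.fourierInv_eq]
  have h7 : (-innerₗ V).flip = -innerₗ V := by
    ext x y; simp [real_inner_comm]
  rw [h7, h6, h6] at h5
  simp only [smul_eq_mul] at h5
  rw [h5.symm]
  simp [SchwartzMap.fourierInv_coe]

lemma ltwoFourier_fourierInv {h : V → ℂ} (h1 : Integrable h) (h2 : MemLp h 2 volume) :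
    ltwoFourier (𝓕⁻ h) =ᵐ[volume] h := by
  rw [ltwoFourier_of_memLp (memLp_fourierInv h1 h2), toLp_fourierInv h1 h2,
    FourierInvPair.fourier_fourierInv_eq]
  exact h2.coeFn_toLp

lemma norm_fourierChar_mul (t : ℝ) (z : ℂ) : ‖((𝐞 t : Circle) : ℂ) * z‖ = ‖z‖ := by
  rw [norm_mul, Circle.norm_coe, one_mul]

/-- Convolution with `𝓕⁻ m` is the Fourier multiplier `m`. -/
lemma integral_fourierInv_mul {m g : V → ℂ} (h1 : Integrable m) (h2 : MemLp m 2 volume)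
    (hg : MemLp g 2 volume) (x : V) :
    ∫ y, 𝓕⁻ m y * g (x - y) = 𝓕⁻ (fun ξ => m ξ * ltwoFourier g ξ) x := by
  -- Chosen so that the conjugate of `𝓕⁻ b y` is `𝓕⁻ m (x - y)`. The convolution becomes an `L²`
  -- inner product and Parseval applies.
  let b : V → ℂ := fun ξ => (starRingEnd ℂ) (𝐞 (inner ℝ ξ x) * m ξ)
  have hmeas : AEStronglyMeasurable (fun ξ : V => ((𝐞 (inner ℝ ξ x) : Circle) : ℂ)) volume := by
    apply Continuous.aestronglyMeasurable
    have := Real.continuous_fourierChar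
    fun_prop
  have hc1 : Integrable (fun ξ => ((𝐞 (inner ℝ ξ x) : Circle) : ℂ) * m ξ) := by
    refine h1.mono (hmeas.mul h1.1) (Filter.Eventually.of_forall fun ξ => ?_)
    exact (norm_fourierChar_mul _ _).le
  have hc2 : MemLp (fun ξ => ((𝐞 (inner ℝ ξ x) : Circle) : ℂ) * m ξ) 2 volume := by
    refine h2.of_le (hmeas.mul h1.1) (Filter.Eventually.of_forall fun ξ => ?_)
    exact (norm_fourierChar_mul _ _).le
  have hb1 : Integrable b := hc1.mono (Complex.continuous_conj.comp_aestronglyMeasurable hc1.1)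
    (Filter.Eventually.of_forall fun ξ => (RCLike.norm_conj _).le)
  have hb2 : MemLp b 2 volume :=
    hc2.of_le (Complex.continuous_conj.comp_aestronglyMeasurable hc1.1)
    (Filter.Eventually.of_forall fun ξ => (RCLike.norm_conj _).le)
  have hba : ∀ y, (starRingEnd ℂ) (𝓕⁻ b y) = 𝓕⁻ m (x - y) := by
    intro y
    rw [Real.fourierInv_eq, Real.fourierInv_eq, ← integral_conj]
    refine integral_congr_ae (Filter.Eventually.of_forall fun ξ => ?_)
    simp only [b, Circle.smul_def, smul_eq_mul, map_mul, Complex.conj_conj, inner_sub_right]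
    rw [AddChar.map_sub_eq_div, Circle.coe_div, ← Circle.coe_inv_eq_conj, Circle.coe_inv]
    ring
  calc ∫ y, 𝓕⁻ m y * g (x - y) = ∫ y, 𝓕⁻ m (x - y) * g y := by
        rw [← integral_sub_left_eq_self (fun y => 𝓕⁻ m y * g (x - y)) volume x]
        simp
    _ = ∫ y, g y * (starRingEnd ℂ) (𝓕⁻ b y) := by
        simp_rw [hba, mul_comm]
    _ = ∫ ξ, ltwoFourier g ξ * (starRingEnd ℂ) (b ξ) := by
        rw [← integral_ltwoFourier_mul_conj (memLp_fourierInv hb1 hb2) hg]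
        refine integral_congr_ae ?_
        filter_upwards [ltwoFourier_fourierInv hb1 hb2] with ξ hξ
        rw [hξ]
    _ = _ := by
        rw [Real.fourierInv_eq]
        refine integral_congr_ae (Filter.Eventually.of_forall fun ξ => ?_)
        simp only [b, Circle.smul_def, smul_eq_mul, Complex.conj_conj]
        ring

lemma integrable_mul_ltwoFourier {m : V → ℂ} (h2 : MemLp m 2 volume) (g : V → ℂ) :
    Integrable (fun ξ => m ξ * ltwoFourier g ξ) :=
  h2.integrable_mul (memLp_ltwoFourier g)

lemma memLp_mul_ltwoFourier {m : V → ℂ} (hm : AEStronglyMeasurable m volume) {C : ℝ}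
    (hC : ∀ ξ, ‖m ξ‖ ≤ C) (g : V → ℂ) :
    MemLp (fun ξ => m ξ * ltwoFourier g ξ) 2 volume :=
  (memLp_ltwoFourier g).of_le_mul (hm.mul (memLp_ltwoFourier g).1)
    (Filter.Eventually.of_forall fun ξ => by
      rw [norm_mul]; exact mul_le_mul_of_nonneg_right (hC ξ) (norm_nonneg _))

/-- The Fourier inversion formula for `L²` functions with integrable Fourier transform. -/
lemma fourierInv_ltwoFourier {g : V → ℂ} (hg : MemLp g 2 volume)
    (h1 : Integrable (ltwoFourier g)) : 𝓕⁻ (ltwoFourier g) =ᵐ[volume] g := by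
  have h2 := toLp_fourierInv h1 (memLp_ltwoFourier g)
  rw [toLp_ltwoFourier hg, FourierPair.fourierInv_fourier_eq] at h2
  have h3 := (memLp_fourierInv h1 (memLp_ltwoFourier g)).coeFn_toLp
  rw [h2] at h3
  exact h3.symm.trans hg.coeFn_toLp

/-- The Fourier transform of a line derivative. -/
lemma ltwoFourier_lineDeriv {g g' : V → ℂ} {v : V} (hg : MemLp g 2 volume)
    (hg' : MemLp g' 2 volume) (h : ∀ x, HasLineDerivAt ℝ g (g' x) x v) :
    ltwoFourier g' =ᵐ[volume]
      fun ξ => (2 * Real.pi * Complex.I * (inner ℝ ξ v : ℝ)) * ltwoFourier g ξ := by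
  refine ae_eq_of_integral_schwartz_mul ((memLp_ltwoFourier _).locallyIntegrable (by norm_num))
    ?_ fun s => ?_
  · exact ((memLp_ltwoFourier g).locallyIntegrable (by norm_num)).continuous_mul (by fun_prop)
  · have hbase : ∀ x, (∂_{v} (𝓕 s)) x = 𝓕 (-(2 * Real.pi * Complex.I) •
        SchwartzMap.smulLeftCLM ℂ (inner ℝ · v) s) x := by
      intro x; rw [SchwartzMap.lineDerivOp_fourier_eq]
    have hp : ∀ x, (-(2 * Real.pi * Complex.I) • SchwartzMap.smulLeftCLM ℂ (inner ℝ · v) s) x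
        = -(2 * Real.pi * Complex.I * (inner ℝ x v : ℝ) * s x) := by
      intro x
      have : (fun y : V => (inner ℝ y v : ℝ)).HasTemperateGrowth := by fun_prop
      rw [_root_.smul_apply, SchwartzMap.smulLeftCLM_apply_apply this]
      simp; ring
    -- Integration by parts moves the derivative onto `𝓕 s`, where it is the transform of `s` times
    -- a linear factor.
    have hint := integral_bilinear_hasLineDerivAt_right_eq_neg_left_of_integrable
      (μ := (volume : Measure V)) (f := fun x => (𝓕 s : SchwartzMap V ℂ) x) (g := g)
      (f' := fun x => (∂_{v} (𝓕 s) : SchwartzMap V ℂ) x) (g' := g') (v := v)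
      (B := ContinuousLinearMap.mul ℝ ℂ)
      (((∂_{v} (𝓕 s) : SchwartzMap V ℂ).memLp 2 volume).integrable_mul hg)
      (((𝓕 s : SchwartzMap V ℂ).memLp 2 volume).integrable_mul hg')
      (((𝓕 s : SchwartzMap V ℂ).memLp 2 volume).integrable_mul hg)
      (fun x _ => by
        rw [SchwartzMap.lineDerivOp_apply]
        exact ((𝓕 s : SchwartzMap V ℂ).differentiableAt.lineDifferentiableAt).hasLineDerivAt)
      (fun x _ => h x)
    simp only [ContinuousLinearMap.mul_apply'] at hint
    rw [integral_schwartz_mul_ltwoFourier hg', hint]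
    simp_rw [hbase]
    rw [← integral_schwartz_mul_ltwoFourier hg, ← integral_neg]
    refine integral_congr_ae (Filter.Eventually.of_forall fun x => ?_)
    simp only [hp]; ring

end FourierLTwo

/-! ### A calculus of scaled derivative bounds along a line, and finite differences. -/

section SymbolBound

/-- `g` has `n` derivatives on `J`, the `k`-th of which is bounded by `B / ρ ^ k`. -/
def SymbolBound : ℕ → ℝ → ℝ → Set ℝ → (ℝ → ℂ) → Prop
  | 0, _, B, J, g => ∀ s ∈ J, ‖g s‖ ≤ B
  | n + 1, ρ, B, J, g => (∀ s ∈ J, ‖g s‖ ≤ B) ∧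
      ∃ g' : ℝ → ℂ, (∀ s ∈ J, HasDerivAt g (g' s) s) ∧ SymbolBound n ρ (B / ρ) J g'

namespace SymbolBound

variable {n : ℕ} {ρ B B' : ℝ} {J J' : Set ℝ} {g h : ℝ → ℂ}

lemma norm_le (hg : SymbolBound n ρ B J g) {s : ℝ} (hs : s ∈ J) : ‖g s‖ ≤ B := by
  cases n with
  | zero => exact hg s hs
  | succ n => exact hg.1 s hs

lemma mono (hρ : 0 < ρ) (hB : B ≤ B') (hJ : J' ⊆ J) (hg : SymbolBound n ρ B J g) :
    SymbolBound n ρ B' J' g := by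
  induction n generalizing B B' g with
  | zero => exact fun s hs => (hg s (hJ hs)).trans hB
  | succ n ih =>
    obtain ⟨h0, g', h1, h2⟩ := hg
    exact ⟨fun s hs => (h0 s (hJ hs)).trans hB, g', fun s hs => h1 s (hJ hs),
      ih (by gcongr) h2⟩

lemma of_succ (hg : SymbolBound (n + 1) ρ B J g) : SymbolBound n ρ B J g := by
  induction n generalizing B g with
  | zero => exact hg.1
  | succ n ih =>
    obtain ⟨h0, g', h1, h2⟩ := hg
    exact ⟨h0, g', h1, ih h2⟩

lemma of_le {m : ℕ} (hmn : m ≤ n) (hg : SymbolBound n ρ B J g) : SymbolBound m ρ B J g := by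
  induction n, hmn using Nat.le_induction with
  | base => exact hg
  | succ n _ ih => exact ih hg.of_succ

lemma add (hg : SymbolBound n ρ B J g) (hh : SymbolBound n ρ B' J h) :
    SymbolBound n ρ (B + B') J (fun s => g s + h s) := by
  induction n generalizing B B' g h with
  | zero => exact fun s hs => (norm_add_le _ _).trans (add_le_add (hg s hs) (hh s hs))
  | succ n ih =>
    obtain ⟨h0, g', h1, h2⟩ := hg
    obtain ⟨k0, h', k1, k2⟩ := hh
    refine ⟨fun s hs => (norm_add_le _ _).trans (add_le_add (h0 s hs) (k0 s hs)),
      fun s => g' s + h' s, fun s hs => (h1 s hs).add (k1 s hs), ?_⟩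
    rw [add_div]; exact ih h2 k2

lemma mul (hρ : 0 < ρ) (hB : 0 ≤ B) (hB' : 0 ≤ B') (hg : SymbolBound n ρ B J g)
    (hh : SymbolBound n ρ B' J h) :
    SymbolBound n ρ (2 ^ n * (B * B')) J (fun s => g s * h s) := by
  induction n generalizing B B' g h with
  | zero =>
    intro s hs
    rw [norm_mul, pow_zero, one_mul]
    exact mul_le_mul (hg s hs) (hh s hs) (norm_nonneg _) hB
  | succ n ih =>
    obtain ⟨h0, g', h1, h2⟩ := id hg
    obtain ⟨k0, h', k1, k2⟩ := id hh
    refine ⟨fun s hs => ?_, fun s => g' s * h s + g s * h' s,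
      fun s hs => (h1 s hs).mul (k1 s hs), ?_⟩
    · rw [norm_mul]
      calc ‖g s‖ * ‖h s‖ ≤ 1 * (B * B') := by
            rw [one_mul]; exact mul_le_mul (h0 s hs) (k0 s hs) (norm_nonneg _) hB
        _ ≤ _ := by gcongr; exact one_le_pow₀ (by norm_num)
    · have e : 2 ^ (n + 1) * (B * B') / ρ = 2 ^ n * (B / ρ * B') + 2 ^ n * (B * (B' / ρ)) := by
        field_simp; ring
      rw [e]
      exact (ih (by positivity) hB' h2 hh.of_succ).add (ih hB (by positivity) hg.of_succ k2)

lemma const_mul (hg : SymbolBound n ρ B J g) (c : ℂ) :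
    SymbolBound n ρ (‖c‖ * B) J (fun s => c * g s) := by
  induction n generalizing B g with
  | zero =>
    intro s hs
    rw [norm_mul]
    exact mul_le_mul_of_nonneg_left (hg s hs) (norm_nonneg _)
  | succ n ih =>
    obtain ⟨h0, g', h1, h2⟩ := hg
    refine ⟨fun s hs => ?_, fun s => c * g' s, fun s hs => (h1 s hs).const_mul c, ?_⟩
    · rw [norm_mul]
      exact mul_le_mul_of_nonneg_left (h0 s hs) (norm_nonneg _)
    · rw [mul_div_assoc]; exact ih h2

/-- Change of scale. -/
lemma of_one (hρ : 0 < ρ) (hB : 0 ≤ B) (hg : SymbolBound n 1 B J g) :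
    SymbolBound n ρ (B * (1 + ρ) ^ n) J g := by
  induction n generalizing B g with
  | zero => simpa [SymbolBound] using hg
  | succ n ih =>
    obtain ⟨h0, g', h1, h2⟩ := hg
    refine ⟨fun s hs => (h0 s hs).trans (le_mul_of_one_le_right hB
      (one_le_pow₀ (by linarith))), g', h1, ?_⟩
    rw [div_one] at h2
    refine (ih hB h2).mono hρ ?_ le_rfl
    rw [le_div_iff₀ hρ, mul_assoc, pow_succ]
    gcongr
    linarith

/-- Change of variables by a dilation and a translation. -/
lemma comp_affine (hg : SymbolBound n ρ B J g) {a b : ℝ} (ha : a ≠ 0)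
    (hJ : ∀ s ∈ J', a * s + b ∈ J) :
    SymbolBound n (ρ / |a|) B J' (fun s => g (a * s + b)) := by
  induction n generalizing B g with
  | zero => exact fun s hs => hg _ (hJ s hs)
  | succ n ih =>
    obtain ⟨h0, g', h1, h2⟩ := hg
    refine ⟨fun s hs => h0 _ (hJ s hs), fun s => a * g' (a * s + b), fun s hs => ?_, ?_⟩
    · have h3 : HasDerivAt (fun s : ℝ => a * s + b) a s := by
        simpa using ((hasDerivAt_id s).const_mul a).add_const b
      exact ((h1 _ (hJ s hs)).scomp s h3).congr_deriv (by simp)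
    · have h4 := (ih h2).const_mul (a : ℂ)
      have e : ‖(a : ℂ)‖ * (B / ρ) = B / (ρ / |a|) := by
        have : |a| ≠ 0 := abs_ne_zero.2 ha
        rw [Complex.norm_real, Real.norm_eq_abs]
        field_simp
      rwa [e] at h4

/-- The derivative of `e^g` is `e^g g'`, so each differentiation costs one product bound, absorbed
by a factor `1 + 2^n L`. The decay `E₀` of the exponential survives all derivatives. -/
lemma exp {L E₀ : ℝ} (hρ : 0 < ρ) (hL : 0 ≤ L) (hE : 0 ≤ E₀) (hg : SymbolBound n ρ L J g)
    (h0 : ∀ s ∈ J, ‖Complex.exp (g s)‖ ≤ E₀) :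
    ∀ k ≤ n, SymbolBound k ρ ((1 + 2 ^ n * L) ^ k * E₀) J (fun s => Complex.exp (g s)) := by
  intro k
  induction k with
  | zero => intro _ s hs; simpa using h0 s hs
  | succ k ih =>
    intro hk
    obtain ⟨-, g', h1, h2⟩ := hg.of_le hk
    refine ⟨fun s hs => (h0 s hs).trans (le_mul_of_one_le_left hE (one_le_pow₀ ?_)),
      fun s => Complex.exp (g s) * g' s, fun s hs => (h1 s hs).cexp, ?_⟩
    · have : 0 ≤ 2 ^ n * L := by positivity
      linarith
    · refine (mul hρ (by positivity) (by positivity) (ih (by omega)) h2).mono hρ ?_ le_rfl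
      rw [pow_succ]
      have h3 : (2 : ℝ) ^ k ≤ 2 ^ n := pow_le_pow_right₀ (by norm_num) (by omega)
      calc 2 ^ k * ((1 + 2 ^ n * L) ^ k * E₀ * (L / ρ))
          = (1 + 2 ^ n * L) ^ k * (2 ^ k * L) * E₀ / ρ := by field_simp
        _ ≤ (1 + 2 ^ n * L) ^ k * (1 + 2 ^ n * L) * E₀ / ρ := by
            gcongr
            nlinarith [mul_le_mul_of_nonneg_right h3 hL]

/-- The value of `e^g - 1` is bounded separately. Its derivatives are those of `e^g`; each carries
at least one factor `L`, which makes them small when `g` is small. -/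
lemma exp_sub_one {L E₀ : ℝ} (hρ : 0 < ρ) (hL : 0 ≤ L) (hE : 0 ≤ E₀)
    (hg : SymbolBound n ρ L J g) (h0 : ∀ s ∈ J, ‖Complex.exp (g s)‖ ≤ E₀)
    (h1 : ∀ s ∈ J, ‖Complex.exp (g s) - 1‖ ≤ B)
    (h2 : 2 ^ n * L * (1 + 2 ^ n * L) ^ n * E₀ ≤ B) :
    SymbolBound n ρ B J (fun s => Complex.exp (g s) - 1) := by
  cases n with
  | zero => exact h1
  | succ n =>
    obtain ⟨-, g', k1, k2⟩ := id hg
    refine ⟨h1, fun s => Complex.exp (g s) * g' s, fun s hs => ((k1 s hs).cexp).sub_const _, ?_⟩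
    refine (mul hρ (by positivity) (by positivity)
      (hg.exp hρ hL hE h0 n (by omega)) k2).mono hρ ?_ le_rfl
    refine le_trans ?_ ((div_le_div_iff_of_pos_right hρ).2 h2)
    have h3 : (2 : ℝ) ^ n ≤ 2 ^ (n + 1) := pow_le_pow_right₀ (by norm_num) (by omega)
    have h4 : (1 + 2 ^ (n + 1) * L) ^ n ≤ (1 + 2 ^ (n + 1) * L) ^ (n + 1) :=
      pow_le_pow_right₀ (by have : 0 ≤ 2 ^ (n + 1) * L := by positivity
                            linarith) (by omega)
    calc 2 ^ n * ((1 + 2 ^ (n + 1) * L) ^ n * E₀ * (L / ρ))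
        = 2 ^ n * L * (1 + 2 ^ (n + 1) * L) ^ n * E₀ / ρ := by field_simp
      _ ≤ _ := by gcongr

/-- Negative powers of `1 + i (a + s)`. -/
lemma exists_inv_pow (n N : ℕ) : ∃ C : ℝ, 0 ≤ C ∧ ∀ (a : ℝ) (J : Set ℝ) (W : ℝ), 0 ≤ W →
    (∀ s ∈ J, ‖((1 + Complex.I * (a + s : ℝ)) ^ N)⁻¹‖ ≤ W) →
    SymbolBound n 1 (C * W) J (fun s => ((1 + Complex.I * (a + s : ℝ)) ^ N)⁻¹) := by
  induction n generalizing N with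
  | zero => exact ⟨1, zero_le_one, fun a J W _ h s hs => by simpa using h s hs⟩
  | succ n ih =>
    -- Differentiation raises the exponent to `N + 1`. The additional factor has norm at most one,
    -- so the same `W` bounds the new power.
    obtain ⟨C, hC, ih⟩ := ih (N + 1)
    have hne : ∀ t : ℝ, (1 + Complex.I * (t : ℂ)) ≠ 0 := by
      intro t h0
      have := congrArg Complex.re h0
      simp at this
    have hone : ∀ t : ℝ, ‖(1 + Complex.I * (t : ℂ))⁻¹‖ ≤ 1 := by
      intro t
      rw [norm_inv]
      refine inv_le_one_of_one_le₀ ?_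
      refine le_trans ?_ (Complex.abs_re_le_norm _)
      simp
    refine ⟨1 + N * C, by positivity, fun a J W hW h => ⟨fun s hs => ?_,
      fun s => (-(N : ℂ) * Complex.I) * ((1 + Complex.I * (a + s : ℝ)) ^ (N + 1))⁻¹,
      fun s _ => ?_, ?_⟩⟩
    · refine (h s hs).trans (le_mul_of_one_le_left hW ?_)
      have : 0 ≤ N * C := by positivity
      linarith
    · have h1 : HasDerivAt (fun s : ℝ => (1 + Complex.I * (a + s : ℝ) : ℂ)) Complex.I s := by
        have h2 : HasDerivAt (fun s : ℝ => ((a + s : ℝ) : ℂ)) 1 s := by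
          simpa using ((hasDerivAt_id s).const_add a).ofReal_comp
        simpa using (h2.const_mul Complex.I).const_add 1
      have h3 := (h1.pow N).inv (pow_ne_zero N (hne (a + s)))
      refine h3.congr_deriv ?_
      have h5 := hne (a + s)
      cases N with
      | zero => simp
      | succ N =>
        have h6 : (1 + Complex.I * ((a + s : ℝ) : ℂ)) ^ (N + 1) ≠ 0 := pow_ne_zero _ h5
        simp only [Pi.pow_apply, Nat.add_sub_cancel]
        field_simp
        ring
    · have h6 := (ih a J W hW fun s hs => ?_).const_mul (-(N : ℂ) * Complex.I)
      · refine h6.mono one_pos ?_ le_rfl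
        simp only [norm_mul, norm_neg, Complex.norm_natCast, Complex.norm_I, div_one, mul_one]
        nlinarith
      · rw [pow_succ, mul_inv, norm_mul]
        calc _ ≤ W * 1 := mul_le_mul (h s hs) (hone _) (norm_nonneg _) hW
          _ = W := mul_one W

/-- Integrals of symbols over a parameter. -/
lemma integral {Z : Type*} [MeasurableSpace Z] {μ : Measure Z} [IsFiniteMeasure μ]
    {G : Z → ℝ → ℂ} (hJ : IsOpen J) (hm : ∀ s ∈ J, AEStronglyMeasurable (fun z => G z s) μ)
    (hg : ∀ z, SymbolBound n ρ B J (G z)) :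
    SymbolBound n ρ (B * μ.real univ) J (fun s => ∫ z, G z s ∂μ) := by
  induction n generalizing B G with
  | zero =>
    intro s hs
    exact norm_integral_le_of_norm_le_const (Filter.Eventually.of_forall fun z => hg z s hs)
  | succ n ih =>
    refine ⟨fun s hs => norm_integral_le_of_norm_le_const
      (Filter.Eventually.of_forall fun z => (hg z).1 s hs), ?_⟩
    choose h0 G' h1 h2 using hg
    have hm' : ∀ s ∈ J, AEStronglyMeasurable (fun z => G' z s) μ := by
      intro s hs
      -- The derivative in `s` is measurable in the parameter as a limit of difference quotients
      -- along `s + 1/(k+1)`. The index is shifted by `K` so that these points lie in `J`.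
      have hev : ∀ᶠ k : ℕ in Filter.atTop, s + (1 : ℝ) / (k + 1) ∈ J := by
        have : Filter.Tendsto (fun k : ℕ => s + (1 : ℝ) / (k + 1)) Filter.atTop (nhds s) := by
          simpa using tendsto_const_nhds.add (tendsto_one_div_add_atTop_nhds_zero_nat (𝕜 := ℝ))
        exact this (hJ.mem_nhds hs)
      obtain ⟨K, hK⟩ := Filter.eventually_atTop.1 hev
      refine aestronglyMeasurable_of_tendsto_ae (u := Filter.atTop)
        (f := fun (k : ℕ) z => slope (G z) s (s + (1 : ℝ) / ((k + K : ℕ) + 1))) (fun k => ?_)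
        (Filter.Eventually.of_forall fun z => ?_)
      · simp only [slope_def_module]
        exact ((hm _ (hK _ (by omega))).sub (hm _ hs)).const_smul _
      · have := hasDerivAt_iff_tendsto_slope.1 (h1 z s hs)
        refine this.comp ?_
        refine tendsto_nhdsWithin_iff.2 ⟨?_, Filter.Eventually.of_forall fun k => ?_⟩
        · have h3 := (Filter.tendsto_add_atTop_iff_nat K).2
            (tendsto_one_div_add_atTop_nhds_zero_nat (𝕜 := ℝ))
          simpa using tendsto_const_nhds.add h3
        · simp only [mem_compl_iff, mem_singleton_iff, add_eq_left]
          positivity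
    refine ⟨fun s => ∫ z, G' z s ∂μ, fun s hs => ?_, ?_⟩
    · refine (hasDerivAt_integral_of_dominated_loc_of_deriv_le (hJ.mem_nhds hs)
        (F := fun s z => G z s) (F' := fun s z => G' z s)
        (bound := fun _ => B / ρ) ?_ ?_ (hm' s hs) ?_ (integrable_const _) ?_).2
      · filter_upwards [hJ.mem_nhds hs] with t ht using hm t ht
      · exact Integrable.of_bound (hm s hs) B (Filter.Eventually.of_forall fun z => h0 z s hs)
      · exact Filter.Eventually.of_forall fun z t ht => (h2 z).norm_le ht
      · exact Filter.Eventually.of_forall fun z t ht => h1 z t ht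
    · have := ih hm' h2
      rwa [div_mul_eq_mul_div] at this

end SymbolBound

/-- The backward difference operator. -/
def diffOp {V : Type*} [AddGroup V] (h : V) (g : V → ℂ) : V → ℂ := fun x => g (x - h) - g x

/-- By the mean value inequality, each difference trades one available derivative for a factor `h /
ρ`, at the cost of shrinking the domain to points whose backward translates remain in `J`. -/
lemma SymbolBound.norm_iterate_diffOp_le {n : ℕ} {ρ B : ℝ} {J : Set ℝ} {g : ℝ → ℂ} (hρ : 0 < ρ)
    (hJ : Convex ℝ J) (hg : SymbolBound n ρ B J g) {h : ℝ} (hh : 0 ≤ h) {s : ℝ} (hs : s ∈ J)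
    (hs' : s - n * h ∈ J) : ‖(diffOp h)^[n] g s‖ ≤ B * (h / ρ) ^ n := by
  suffices H : ∀ (n : ℕ) (B : ℝ) (J : Set ℝ) (g : ℝ → ℂ), Convex ℝ J → SymbolBound n ρ B J g →
      ∀ m ≤ n, SymbolBound (n - m) ρ (B * (h / ρ) ^ m) {x | x ∈ J ∧ x - m * h ∈ J}
        ((diffOp h)^[m] g) by
    have := (H n B J g hJ hg n le_rfl).norm_le (s := s) ⟨hs, hs'⟩
    exact this
  clear hg hs hs' hJ s B g J n
  intro n B J g hJ hg m
  induction m with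
  | zero =>
    intro _
    rw [pow_zero, mul_one]
    exact hg.mono hρ le_rfl fun x hx => hx.1
  | succ m ih =>
    intro hm
    have h1 := ih (by omega)
    obtain ⟨k, hk⟩ : ∃ k, n - m = k + 1 := ⟨n - m - 1, by omega⟩
    have hk' : n - (m + 1) = k := by omega
    rw [hk] at h1
    rw [hk', Function.iterate_succ_apply']
    set G := (diffOp h)^[m] g
    have hconv : ∀ m : ℕ, Convex ℝ {x | x ∈ J ∧ x - m * h ∈ J} := by
      intro m
      have h2 := hJ.inter (hJ.translate_preimage_right (-(m * h)))
      have e : {x | x ∈ J ∧ x - m * h ∈ J} = J ∩ (fun z => -(m * h) + z) ⁻¹' J := by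
        ext x
        rw [mem_inter_iff, mem_preimage, show -(m * h) + x = x - m * h by ring]
        rfl
      rw [e]; exact h2
    have hKc := hconv m
    set K := {x | x ∈ J ∧ x - m * h ∈ J}
    have hsub : ∀ x, (x ∈ J ∧ x - (m + 1 : ℕ) * h ∈ J) → x ∈ K ∧ x - h ∈ K := by
      rintro x ⟨hx, hx'⟩
      have hord := hJ.ordConnected
      push_cast at hx'
      have e1 : 0 ≤ m * h := by positivity
      have hin : ∀ y, x - (m + 1) * h ≤ y → y ≤ x → y ∈ J := fun y h1 h2 =>
        hord.out hx' hx ⟨h1, h2⟩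
      refine ⟨⟨hx, hin _ (by nlinarith) (by nlinarith)⟩, hin _ (by nlinarith) (by nlinarith), ?_⟩
      exact hin _ (by nlinarith) (by nlinarith)
    clear_value G K
    clear ih
    have key : ∀ (k : ℕ) (B : ℝ) (G : ℝ → ℂ), SymbolBound (k + 1) ρ B K G →
        SymbolBound k ρ (B * (h / ρ)) {x | x ∈ J ∧ x - (m + 1 : ℕ) * h ∈ J} (diffOp h G) := by
      intro k
      have hmvt : ∀ (B : ℝ) (G G' : ℝ → ℂ), (∀ s ∈ K, HasDerivAt G (G' s) s) →
          (∀ s ∈ K, ‖G' s‖ ≤ B / ρ) →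
          ∀ x ∈ {x | x ∈ J ∧ x - (m + 1 : ℕ) * h ∈ J}, ‖diffOp h G x‖ ≤ B * (h / ρ) := by
        intro B G G' h1 h2 x hx
        have := hKc.norm_image_sub_le_of_norm_hasDerivWithin_le
          (fun s hs => (h1 s hs).hasDerivWithinAt) h2 (hsub x hx).1 (hsub x hx).2
        refine this.trans (le_of_eq ?_)
        rw [show x - h - x = -h by ring, norm_neg, Real.norm_of_nonneg hh]
        ring
      induction k with
      | zero =>
        rintro B G ⟨-, G', h1, h2⟩
        exact hmvt B G G' h1 h2
      | succ k ih =>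
        rintro B G ⟨-, G', h1, h2⟩
        refine ⟨hmvt B G G' h1 (fun s hs => h2.norm_le hs), diffOp h G', fun x hx => ?_, ?_⟩
        · have h3 := (h1 _ (hsub x hx).2).comp_sub_const x h
          exact h3.sub (h1 _ (hsub x hx).1)
        · have := ih (B / ρ) G' h2
          rwa [show B / ρ * (h / ρ) = B * (h / ρ) / ρ by ring] at this
    have := key k _ G h1
    rwa [show B * (h / ρ) ^ m * (h / ρ) = B * (h / ρ) ^ (m + 1) by ring] at this

end SymbolBound

variable {d : ℕ}

local notation "E" => EuclideanSpace ℝ (Fin d)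

/-! ### From differences of a symbol to an `L¹` bound for its kernel. -/

section

variable {V : Type*} [NormedAddCommGroup V] [InnerProductSpace ℝ V] [FiniteDimensional ℝ V]
  [MeasurableSpace V] [BorelSpace V]

lemma eLpNorm_fourierInv {h : V → ℂ} (h1 : Integrable h) (h2 : MemLp h 2 volume) :
    eLpNorm (𝓕⁻ h) 2 volume = eLpNorm h 2 volume := by
  rw [← eLpNorm_ltwoFourier (memLp_fourierInv h1 h2)]
  exact eLpNorm_congr_ae (ltwoFourier_fourierInv h1 h2)

lemma integrable_diffOp {m : V → ℂ} (v : V) (hm : Integrable m) : Integrable (diffOp v m) :=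
  (hm.comp_sub_right v).sub hm

lemma memLp_diffOp {m : V → ℂ} (v : V) (hm : MemLp m 2 volume) :
    MemLp (diffOp v m) 2 volume :=
  (hm.comp_measurePreserving (measurePreserving_sub_right volume v)).sub hm

/-- Translating a symbol modulates its kernel. This replaces differentiation of the symbol, which
would require control across the origin. -/
lemma fourierInv_diffOp {m : V → ℂ} (v x : V) (hm : Integrable m) :
    𝓕⁻ (diffOp v m) x = (((𝐞 (inner ℝ v x) : Circle) : ℂ) - 1) * 𝓕⁻ m x := by
  have hc : ∀ {q : V → ℂ}, Integrable q →
      Integrable (fun ξ : V => ((𝐞 (inner ℝ ξ x) : Circle) : ℂ) * q ξ) := by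
    intro q hq
    have hmeas : AEStronglyMeasurable (fun ξ : V => ((𝐞 (inner ℝ ξ x) : Circle) : ℂ)) volume := by
      apply Continuous.aestronglyMeasurable
      have := Real.continuous_fourierChar
      fun_prop
    exact hq.mono (hmeas.mul hq.1)
      (Filter.Eventually.of_forall fun ξ => (norm_fourierChar_mul _ _).le)
  rw [Real.fourierInv_eq, Real.fourierInv_eq]
  simp only [Circle.smul_def, smul_eq_mul, diffOp, mul_sub]
  rw [integral_sub (hc (hm.comp_sub_right v)) (hc hm), sub_mul, one_mul]
  congr 1
  rw [← integral_sub_right_eq_self (fun ξ => ((𝐞 (inner ℝ ξ x) : Circle) : ℂ) * m ξ) v,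
    ← integral_const_mul, ← sub_eq_zero, ← integral_sub (hc (hm.comp_sub_right v)) ?_]
  · refine integral_eq_zero_of_ae (Filter.Eventually.of_forall fun ξ => ?_)
    simp only [inner_sub_left, AddChar.map_sub_eq_div, Circle.coe_div, Pi.zero_apply]
    field_simp [Circle.coe_ne_zero]
    ring
  · exact ((hc hm).comp_sub_right v).const_mul _

lemma iterate_diffOp_props {m : V → ℂ} (v : V) (hm : Integrable m) (h2 : MemLp m 2 volume)
    (n : ℕ) : Integrable ((diffOp v)^[n] m) ∧ MemLp ((diffOp v)^[n] m) 2 volume ∧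
      ∀ x, 𝓕⁻ ((diffOp v)^[n] m) x
        = (((𝐞 (inner ℝ v x) : Circle) : ℂ) - 1) ^ n * 𝓕⁻ m x := by
  induction n with
  | zero => exact ⟨hm, h2, fun x => by simp⟩
  | succ n ih =>
    obtain ⟨i1, i2, i3⟩ := ih
    rw [Function.iterate_succ_apply']
    refine ⟨integrable_diffOp v i1, memLp_diffOp v i2, fun x => ?_⟩
    rw [fourierInv_diffOp v x i1, i3, pow_succ]
    ring

/-- Cauchy–Schwarz on `S`. With Plancherel, it is how `L²` information on symbols gives `L¹`
information on kernels. -/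
lemma setLIntegral_enorm_le (K : V → ℂ) (hK : AEStronglyMeasurable K volume) (S : Set V) :
    ∫⁻ x in S, ‖K x‖ₑ ≤ eLpNorm K 2 volume * volume S ^ (1 / 2 : ℝ) := by
  have := eLpNorm_le_eLpNorm_mul_rpow_measure_univ (μ := volume.restrict S) (p := 1) (q := 2)
    (by norm_num) hK.restrict
  rw [eLpNorm_one_eq_lintegral_enorm] at this
  refine this.trans ?_
  rw [Measure.restrict_apply_univ]
  have e : (1 / (1 : ℝ≥0∞).toReal - 1 / (2 : ℝ≥0∞).toReal) = (1 / 2 : ℝ) := by norm_num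
  rw [e]
  gcongr
  exact Measure.restrict_le_self

lemma eLpNorm_two_comp_smul {F : Type*} [NormedAddCommGroup F] (b : V → F) {h : ℝ} (hh : 0 < h) :
    eLpNorm (fun ξ => b (h⁻¹ • ξ)) 2 volume =
      ENNReal.ofReal (h ^ ((Module.finrank ℝ V : ℝ) / 2)) * eLpNorm b 2 volume := by
  have hne : h⁻¹ ≠ 0 := (inv_pos.2 hh).ne'
  have h1 := (Homeomorph.smulOfNeZero (α := V) h⁻¹ hne).measurableEmbedding.eLpNorm_map_measure
    (p := 2) (μ := (volume : Measure V)) (g := b)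
  have h2 : (⇑(Homeomorph.smulOfNeZero (α := V) h⁻¹ hne)) = fun x : V => h⁻¹ • x := rfl
  rw [h2] at h1
  rw [Measure.map_addHaar_smul volume hne] at h1
  change _ = eLpNorm (fun ξ => b (h⁻¹ • ξ)) 2 volume at h1
  rw [← h1, eLpNorm_smul_measure_of_ne_top (by norm_num), smul_eq_mul]
  congr 1
  rw [ENNReal.ofReal_rpow_of_nonneg (abs_nonneg _) (by norm_num)]
  congr 1
  rw [inv_pow, inv_inv, abs_of_pos (by positivity), ← Real.rpow_natCast, ← Real.rpow_mul hh.le]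
  congr 1
  norm_num
  ring

lemma memLp_two_one_add_norm {ρ : ℝ} (hρ : (Module.finrank ℝ V : ℝ) / 2 < ρ) :
    MemLp (fun η : V => (1 + ‖η‖) ^ (-ρ)) 2 volume := by
  rw [memLp_two_iff_integrable_sq]
  · have h1 := integrable_one_add_norm (μ := (volume : Measure V)) (r := 2 * ρ) (by linarith)
    refine h1.congr (Filter.Eventually.of_forall fun η => ?_)
    simp only
    rw [← Real.rpow_natCast, ← Real.rpow_mul (by positivity)]
    congr 1
    push_cast; ring
  · refine Continuous.aestronglyMeasurable ?_
    refine Continuous.rpow_const (by fun_prop) fun x => Or.inl ?_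
    positivity

lemma eLpNorm_two_le_of_norm_le {D : V → ℂ} {c h ρ : ℝ} (hh : 0 < h) (hc : 0 ≤ c)
    (hD : ∀ ξ, ‖D ξ‖ ≤ c * (1 + ‖ξ‖ / h) ^ (-ρ)) :
    eLpNorm D 2 volume ≤ ENNReal.ofReal (c * h ^ ((Module.finrank ℝ V : ℝ) / 2)) *
      eLpNorm (fun η : V => (1 + ‖η‖) ^ (-ρ)) 2 volume := by
  calc eLpNorm D 2 volume
      ≤ eLpNorm (c • fun ξ : V => (1 + ‖h⁻¹ • ξ‖) ^ (-ρ)) 2 volume := by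
        refine eLpNorm_mono_real fun ξ => (hD ξ).trans (le_of_eq ?_)
        rw [Pi.smul_apply, smul_eq_mul, norm_smul, Real.norm_of_nonneg (by positivity)]
        congr 3
        ring
    _ = _ := by
        rw [eLpNorm_const_smul, eLpNorm_two_comp_smul (fun η : V => (1 + ‖η‖) ^ (-ρ)) hh,
          ← mul_assoc, ENNReal.ofReal_mul hc]
        congr 2
        rw [Real.enorm_eq_ofReal hc]

end

/-- The chord has length `2 |sin(πθ)|`, and Jordan's inequality bounds the sine below by a linear
function. -/
lemma le_norm_fourierChar_sub_one {θ : ℝ} (h : |θ| ≤ 1 / 2) :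
    4 * |θ| ≤ ‖((𝐞 θ : Circle) : ℂ) - 1‖ := by
  have e : ((𝐞 θ : Circle) : ℂ) = Complex.exp (Complex.I * ((2 * Real.pi * θ : ℝ) : ℂ)) := by
    rw [Real.fourierChar_apply]; congr 1; ring
  have h1 := Real.mul_le_sin (x := Real.pi * |θ|) (by positivity) (by nlinarith [Real.pi_pos])
  have h2 : 2 / Real.pi * (Real.pi * |θ|) = 2 * |θ| := by field_simp
  have h3 : |Real.sin (Real.pi * θ)| = |Real.sin (Real.pi * |θ|)| := by
    rcases abs_choice θ with h | h <;> rw [h]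
    rw [mul_neg, Real.sin_neg, abs_neg]
  rw [e, Complex.norm_exp_I_mul_ofReal_sub_one, norm_mul, Real.norm_ofNat, Real.norm_eq_abs,
    show 2 * Real.pi * θ / 2 = Real.pi * θ by ring, h3]
  rw [h2] at h1
  linarith [le_abs_self (Real.sin (Real.pi * |θ|))]

lemma exists_norm_le_sqrt_mul_abs (hd : 0 < d) (x : E) :
    ∃ i, ‖x‖ ≤ √d * |x i| := by
  have : Nonempty (Fin d) := ⟨⟨0, hd⟩⟩
  obtain ⟨i, -, hi⟩ := Finset.exists_max_image Finset.univ (fun i => |x i|) Finset.univ_nonempty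
  refine ⟨i, ?_⟩
  rw [EuclideanSpace.norm_eq]
  have h1 : ∑ j, ‖x j‖ ^ 2 ≤ d * |x i| ^ 2 := by
    calc ∑ j, ‖x j‖ ^ 2 ≤ ∑ _j : Fin d, |x i| ^ 2 := by
          refine Finset.sum_le_sum fun j _ => ?_
          rw [Real.norm_eq_abs]
          have := hi j (Finset.mem_univ j)
          gcongr
      _ = _ := by simp
  calc √(∑ j, ‖x j‖ ^ 2) ≤ √(d * |x i| ^ 2) := Real.sqrt_le_sqrt h1
    _ = _ := by rw [Real.sqrt_mul (by positivity), Real.sqrt_sq (abs_nonneg _)]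

/-- The constant in the annulus estimate. -/
def annulusConst (d n : ℕ) (ρ : ℝ) : ℝ≥0∞ :=
  ENNReal.ofReal (√d ^ n) * d * eLpNorm (fun η : EuclideanSpace ℝ (Fin d) => (1 + ‖η‖) ^ (-ρ))
    2 volume * volume (Metric.ball (0 : EuclideanSpace ℝ (Fin d)) 1) ^ (1 / 2 : ℝ)

lemma volume_closedBall_rpow {R : ℝ} (hR : 0 ≤ R) :
    volume (Metric.closedBall (0 : E) R) ^ (1 / 2 : ℝ) =
      ENNReal.ofReal (R ^ ((d : ℝ) / 2)) * volume (Metric.ball (0 : E) 1) ^ (1 / 2 : ℝ) := by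
  rw [Measure.addHaar_closedBall _ _ hR, ENNReal.mul_rpow_of_nonneg _ _ (by norm_num),
    ENNReal.ofReal_rpow_of_nonneg (by positivity) (by norm_num), finrank_euclideanSpace_fin,
    ← Real.rpow_natCast, ← Real.rpow_mul hR]
  congr 3
  ring

/-- At each point of the annulus the largest coordinate gives a direction in which multiplication by
`(e(v·x) - 1)^n` loses only the factor `√d ^ n`. Hence the kernel is dominated by the kernels of the
differences, to which Cauchy–Schwarz and Plancherel apply. -/
lemma setLIntegral_annulus_le (hd : 0 < d) {n : ℕ} {ε ρ A : ℝ} (hε : 0 < ε) (hA : 0 ≤ A)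
    {m : E → ℂ} (h1 : Integrable m) (h2 : MemLp m 2 volume)
    (hD : ∀ h : ℝ, 0 < h → ∀ i : Fin d, ∀ ξ,
      ‖(diffOp (h • EuclideanSpace.single i (1 : ℝ)))^[n] m ξ‖
        ≤ A * h ^ ε * (1 + ‖ξ‖ / h) ^ (-ρ)) {R : ℝ} (hR : 0 < R) :
    ∫⁻ x in {x : E | R ≤ ‖x‖ ∧ ‖x‖ ≤ 2 * R}, ‖𝓕⁻ m x‖ₑ ≤
      annulusConst d n ρ * ENNReal.ofReal (A * R ^ (-ε)) := by
  set S := {x : E | R ≤ ‖x‖ ∧ ‖x‖ ≤ 2 * R}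
  -- With this step `|h x_i| ≤ 1/2` throughout the annulus, and `4 h R = 1` makes the lower bound
  -- for the modulation factor exactly one.
  set h : ℝ := (4 * R)⁻¹ with hh
  have hh0 : 0 < h := by positivity
  set v : Fin d → E := fun i => h • EuclideanSpace.single i (1 : ℝ) with hv
  set D : Fin d → E → ℂ := fun i => (diffOp (v i))^[n] m
  have hprop := fun i => iterate_diffOp_props (v i) h1 h2 n
  have hSm : MeasurableSet S :=
    (measurableSet_le measurable_const measurable_norm).inter
      (measurableSet_le measurable_norm measurable_const)
  have hpt : ∀ x ∈ S, ‖𝓕⁻ m x‖ₑ ≤ ENNReal.ofReal (√d ^ n) * ∑ i, ‖𝓕⁻ (D i) x‖ₑ := by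
    rintro x ⟨hx1, hx2⟩
    obtain ⟨i, hi⟩ := exists_norm_le_sqrt_mul_abs hd x
    have hin : inner ℝ (v i) x = h * x i := by
      simp [hv, inner_smul_left, EuclideanSpace.inner_single_left]
    have hle : |h * x i| ≤ 1 / 2 := by
      rw [abs_mul, abs_of_pos hh0, hh, inv_mul_le_iff₀ (by positivity)]
      have : |x i| ≤ ‖x‖ := by simpa using PiLp.norm_apply_le x i
      linarith
    have h4 := le_norm_fourierChar_sub_one hle
    have h5 : 1 ≤ √d * ‖((𝐞 (h * x i) : Circle) : ℂ) - 1‖ := by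
      calc (1 : ℝ) = 4 * h * R := by rw [hh]; field_simp
        _ ≤ 4 * h * (√d * |x i|) := by gcongr; exact hx1.trans hi
        _ = √d * (4 * |h * x i|) := by rw [abs_mul, abs_of_pos hh0]; ring
        _ ≤ _ := by gcongr
    have h6 : ‖𝓕⁻ m x‖ ≤ √d ^ n * ‖𝓕⁻ (D i) x‖ := by
      rw [(hprop i).2.2 x, hin, norm_mul, norm_pow, ← mul_assoc, ← mul_pow]
      exact le_mul_of_one_le_left (norm_nonneg _) (one_le_pow₀ h5)
    calc ‖𝓕⁻ m x‖ₑ ≤ ENNReal.ofReal (√d ^ n) * ‖𝓕⁻ (D i) x‖ₑ := by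
          rw [← ofReal_norm, ← ofReal_norm, ← ENNReal.ofReal_mul (by positivity)]
          exact ENNReal.ofReal_le_ofReal h6
      _ ≤ _ := by
          gcongr
          exact Finset.single_le_sum (f := fun i => ‖𝓕⁻ (D i) x‖ₑ) (fun _ _ => zero_le)
            (Finset.mem_univ i)
  have hmeasD : ∀ i, AEStronglyMeasurable (𝓕⁻ (D i)) volume := fun i =>
    (memLp_fourierInv (hprop i).1 (hprop i).2.1).1
  have hSball : volume S ^ (1 / 2 : ℝ) ≤ ENNReal.ofReal ((2 * R) ^ ((d : ℝ) / 2)) *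
      volume (Metric.ball (0 : E) 1) ^ (1 / 2 : ℝ) := by
    rw [← volume_closedBall_rpow (by positivity)]
    gcongr
    rintro x ⟨-, hx⟩
    simpa using hx
  have hDi : ∀ i, ∫⁻ x in S, ‖𝓕⁻ (D i) x‖ₑ ≤ ENNReal.ofReal (A * R ^ (-ε)) *
      eLpNorm (fun η : E => (1 + ‖η‖) ^ (-ρ)) 2 volume *
      volume (Metric.ball (0 : E) 1) ^ (1 / 2 : ℝ) := by
    intro i
    refine (setLIntegral_enorm_le _ (hmeasD i) S).trans ?_
    rw [eLpNorm_fourierInv (hprop i).1 (hprop i).2.1]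
    have h7 := eLpNorm_two_le_of_norm_le hh0 (by positivity) (hD h hh0 i)
    rw [finrank_euclideanSpace_fin] at h7
    refine (mul_le_mul' h7 hSball).trans ?_
    -- The factor `h^{d/2}` from scaling the `L²` norm offsets `(2R)^{d/2}` from the volume, and
    -- `h^ε ≤ R^{-ε}` remains.
    have h8 : A * h ^ ε * h ^ ((d : ℝ) / 2) * (2 * R) ^ ((d : ℝ) / 2) ≤ A * R ^ (-ε) := by
      rw [mul_assoc, mul_assoc, ← Real.mul_rpow hh0.le (by positivity)]
      refine mul_le_mul_of_nonneg_left ?_ hA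
      calc h ^ ε * (h * (2 * R)) ^ ((d : ℝ) / 2) ≤ (R⁻¹) ^ ε * 1 := by
            refine mul_le_mul ?_ ?_ (by positivity) (by positivity)
            · refine Real.rpow_le_rpow hh0.le ?_ hε.le
              rw [hh]; exact inv_anti₀ hR (by linarith)
            · refine Real.rpow_le_one (by positivity) ?_ (by positivity)
              rw [hh, inv_mul_le_iff₀ (by positivity)]; linarith
        _ = R ^ (-ε) := by rw [mul_one, Real.inv_rpow hR.le, Real.rpow_neg hR.le]
    calc _ = ENNReal.ofReal (A * h ^ ε * h ^ ((d : ℝ) / 2) * (2 * R) ^ ((d : ℝ) / 2)) *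
          eLpNorm (fun η : E => (1 + ‖η‖) ^ (-ρ)) 2 volume *
          volume (Metric.ball (0 : E) 1) ^ (1 / 2 : ℝ) := by
            rw [ENNReal.ofReal_mul (p := A * h ^ ε * h ^ ((d : ℝ) / 2)) (by positivity)]; ring
      _ ≤ _ := by gcongr
  calc ∫⁻ x in S, ‖𝓕⁻ m x‖ₑ
      ≤ ∫⁻ x in S, ENNReal.ofReal (√d ^ n) * ∑ i, ‖𝓕⁻ (D i) x‖ₑ :=
        setLIntegral_mono' hSm hpt
    _ = ENNReal.ofReal (√d ^ n) * ∑ i, ∫⁻ x in S, ‖𝓕⁻ (D i) x‖ₑ := by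
        rw [lintegral_const_mul'' _ (Finset.aemeasurable_fun_sum _ fun i _ =>
          (hmeasD i).restrict.enorm), lintegral_finsetSum' _ fun i _ => (hmeasD i).restrict.enorm]
    _ ≤ ENNReal.ofReal (√d ^ n) * ∑ _i : Fin d, (ENNReal.ofReal (A * R ^ (-ε)) *
      eLpNorm (fun η : E => (1 + ‖η‖) ^ (-ρ)) 2 volume *
      volume (Metric.ball (0 : E) 1) ^ (1 / 2 : ℝ)) := by
        gcongr with i; exact hDi i
    _ = _ := by
        rw [Finset.sum_const, Finset.card_univ, Fintype.card_fin, nsmul_eq_mul, annulusConst]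
        ring

/-- The `L¹` bound for kernels whose symbol has small iterated differences. -/
lemma exists_lintegral_fourierInv_le (hd : 0 < d) (n : ℕ) {ε ρ : ℝ} (hε : 0 < ε)
    (hρ : (d : ℝ) / 2 < ρ) : ∃ C : ℝ≥0∞, C ≠ ⊤ ∧ ∀ (A R : ℝ) (m : E → ℂ), 0 ≤ A → 0 < R →
      Integrable m → MemLp m 2 volume →
      (∀ h : ℝ, 0 < h → ∀ i : Fin d, ∀ ξ,
        ‖(diffOp (h • EuclideanSpace.single i (1 : ℝ)))^[n] m ξ‖
          ≤ A * h ^ ε * (1 + ‖ξ‖ / h) ^ (-ρ)) →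
      ∫⁻ x, ‖𝓕⁻ m x‖ₑ ≤ C * (ENNReal.ofReal (R ^ ((d : ℝ) / 2)) * eLpNorm m 2 volume +
        ENNReal.ofReal (A * R ^ (-ε))) := by
  -- The ratio of the geometric series over the dyadic annuli `R 2^k ≤ ‖x‖ ≤ R 2^{k+1}`.
  set q : ℝ := 2 ^ (-ε) with hq
  have hq0 : 0 < q := by positivity
  have hq1 : q < 1 := Real.rpow_lt_one_of_one_lt_of_neg (by norm_num) (by linarith)
  have hvol : volume (Metric.ball (0 : E) 1) ^ (1 / 2 : ℝ) ≠ ⊤ :=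
    ENNReal.rpow_ne_top_of_nonneg (by norm_num) measure_ball_lt_top.ne
  refine ⟨volume (Metric.ball (0 : E) 1) ^ (1 / 2 : ℝ) +
    annulusConst d n ρ * ENNReal.ofReal (1 - q)⁻¹, ?_, ?_⟩
  · refine ENNReal.add_ne_top.2 ⟨hvol, ENNReal.mul_ne_top ?_ ENNReal.ofReal_ne_top⟩
    refine ENNReal.mul_ne_top (ENNReal.mul_ne_top (ENNReal.mul_ne_top ENNReal.ofReal_ne_top
      (ENNReal.natCast_ne_top d)) ?_) hvol
    exact (memLp_two_one_add_norm (by rwa [finrank_euclideanSpace_fin])).2.ne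
  intro A R m hA hR h1 h2 hD
  have hcover : (univ : Set E) ⊆ Metric.closedBall 0 R ∪
      ⋃ k : ℕ, {x : E | R * 2 ^ k ≤ ‖x‖ ∧ ‖x‖ ≤ 2 * (R * 2 ^ k)} := by
    intro x _
    rcases le_total ‖x‖ R with hx | hx
    · left; simpa using hx
    · right
      obtain ⟨k, hk1, hk2⟩ := exists_nat_pow_near (x := ‖x‖ / R) (y := 2)
        ((one_le_div hR).2 hx) (by norm_num)
      rw [mem_iUnion]
      rw [le_div_iff₀ hR] at hk1
      rw [div_lt_iff₀ hR, pow_succ] at hk2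
      exact ⟨k, by linarith, by linarith⟩
  have hin : ∫⁻ x in Metric.closedBall 0 R, ‖𝓕⁻ m x‖ₑ ≤
      volume (Metric.ball (0 : E) 1) ^ (1 / 2 : ℝ) *
        (ENNReal.ofReal (R ^ ((d : ℝ) / 2)) * eLpNorm m 2 volume) := by
    refine (setLIntegral_enorm_le _ (memLp_fourierInv h1 h2).1 _).trans (le_of_eq ?_)
    rw [eLpNorm_fourierInv h1 h2, volume_closedBall_rpow hR.le]
    ring
  have hout : ∑' k : ℕ, ∫⁻ x in {x : E | R * 2 ^ k ≤ ‖x‖ ∧ ‖x‖ ≤ 2 * (R * 2 ^ k)}, ‖𝓕⁻ m x‖ₑ ≤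
      annulusConst d n ρ * ENNReal.ofReal (1 - q)⁻¹ * ENNReal.ofReal (A * R ^ (-ε)) := by
    have hk : ∀ k : ℕ, ENNReal.ofReal (A * (R * 2 ^ k) ^ (-ε)) =
        ENNReal.ofReal (A * R ^ (-ε)) * ENNReal.ofReal q ^ k := by
      intro k
      rw [← ENNReal.ofReal_pow hq0.le, ← ENNReal.ofReal_mul (by positivity),
        Real.mul_rpow hR.le (by positivity), hq, ← Real.rpow_natCast, ← Real.rpow_natCast,
        ← Real.rpow_mul (by norm_num), ← Real.rpow_mul (by norm_num), mul_comm (k : ℝ), mul_assoc]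
    calc _ ≤ ∑' k : ℕ, annulusConst d n ρ * ENNReal.ofReal (A * (R * 2 ^ k) ^ (-ε)) :=
          ENNReal.tsum_le_tsum fun k => setLIntegral_annulus_le hd hε hA h1 h2 hD (by positivity)
      _ = _ := by
          simp_rw [hk]
          rw [ENNReal.tsum_mul_left, ENNReal.tsum_mul_left, ENNReal.tsum_geometric,
            ENNReal.ofReal_inv_of_pos (by linarith), ENNReal.ofReal_sub _ hq0.le,
            ENNReal.ofReal_one]
          ring
  calc ∫⁻ x, ‖𝓕⁻ m x‖ₑ = ∫⁻ x in univ, ‖𝓕⁻ m x‖ₑ := by rw [Measure.restrict_univ]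
    _ ≤ ∫⁻ x in Metric.closedBall 0 R ∪
      ⋃ k : ℕ, {x : E | R * 2 ^ k ≤ ‖x‖ ∧ ‖x‖ ≤ 2 * (R * 2 ^ k)}, ‖𝓕⁻ m x‖ₑ :=
        lintegral_mono_set hcover
    _ ≤ _ := lintegral_union_le _ _ _
    _ ≤ _ := add_le_add hin ((lintegral_iUnion_le _ _).trans hout)
    _ ≤ _ := by
        rw [mul_add]
        gcongr
        · exact le_self_add
        · exact le_add_self

/-! ### Iterated derivatives along words, and smooth functions with all derivatives in `L²`. -/

/-- Iterated partial derivatives along a list of directions. -/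
def wordDeriv (L : List (Fin d)) (g : E → ℂ) : E → ℂ := L.foldr partialDeriv g

@[simp] lemma wordDeriv_cons (i : Fin d) (L : List (Fin d)) (g : E → ℂ) :
    wordDeriv (i :: L) g = partialDeriv i (wordDeriv L g) := rfl

lemma wordDeriv_append (L L' : List (Fin d)) (g : E → ℂ) :
    wordDeriv (L ++ L') g = wordDeriv L (wordDeriv L' g) := by
  simp [wordDeriv, List.foldr_append]

lemma wordDeriv_replicate (k : ℕ) (i : Fin d) (g : E → ℂ) :
    wordDeriv (List.replicate k i) g = (partialDeriv i)^[k] g := by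
  induction k with
  | zero => rfl
  | succ k ih => rw [List.replicate_succ, wordDeriv_cons, ih, Function.iterate_succ_apply']

/-- The list of directions of a multi-index. -/
def multiWord (α : Fin d → ℕ) : List (Fin d) :=
  (List.finRange d).flatMap fun i => List.replicate (α i) i

lemma multiDeriv_eq_wordDeriv (α : Fin d → ℕ) (g : E → ℂ) :
    multiDeriv α g = wordDeriv (multiWord α) g := by
  unfold multiDeriv multiWord
  induction List.finRange d with
  | nil => rfl
  | cons i l ih =>
    rw [List.foldr_cons, ih, List.flatMap_cons, wordDeriv_append, wordDeriv_replicate]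

lemma multiDeriv_single (i : Fin d) (k : ℕ) (g : E → ℂ) :
    multiDeriv (Pi.single i k) g = (partialDeriv i)^[k] g := by
  rw [← wordDeriv_replicate, multiDeriv_eq_wordDeriv]
  have h : ∀ l : List (Fin d), l.Nodup →
      (l.flatMap fun j => List.replicate ((Pi.single i k : Fin d → ℕ) j) j) =
        if i ∈ l then List.replicate k i else [] := by
    intro l
    induction l with
    | nil => simp
    | cons j l ih =>
      intro hl
      rw [List.nodup_cons] at hl
      rw [List.flatMap_cons, ih hl.2]
      by_cases hij : i = j
      · subst hij
        simp [hl.1]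
      · have : j ≠ i := fun h => hij h.symm
        simp [this, hij]
  rw [multiWord, h _ (List.nodup_finRange d)]
  simp

lemma partialDeriv_eq_fderiv {g : E → ℂ} (hg : Differentiable ℝ g) (i : Fin d) :
    partialDeriv i g = fun x => fderiv ℝ g x (EuclideanSpace.single i 1) := by
  ext x
  exact (hg x).lineDeriv_eq_fderiv

lemma contDiff_partialDeriv {g : E → ℂ} (hg : ContDiff ℝ ∞ g) (i : Fin d) :
    ContDiff ℝ ∞ (partialDeriv i g) := by
  rw [partialDeriv_eq_fderiv (hg.differentiable (by simp))]
  exact (hg.fderiv_right (m := ∞) (by simp)).clm_apply contDiff_const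

lemma contDiff_wordDeriv {g : E → ℂ} (hg : ContDiff ℝ ∞ g) (L : List (Fin d)) :
    ContDiff ℝ ∞ (wordDeriv L g) := by
  induction L with
  | nil => exact hg
  | cons i L ih => exact contDiff_partialDeriv ih i

lemma hasLineDerivAt_partialDeriv {g : E → ℂ} (hg : Differentiable ℝ g) (i : Fin d) (x : E) :
    HasLineDerivAt ℝ g (partialDeriv i g x) x (EuclideanSpace.single i 1) :=
  (hg x).lineDifferentiableAt.hasLineDerivAt

lemma partialDeriv_comm {g : E → ℂ} (hg : ContDiff ℝ ∞ g) (i j : Fin d) :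
    partialDeriv i (partialDeriv j g) = partialDeriv j (partialDeriv i g) := by
  have h2 : Differentiable ℝ (fderiv ℝ g) :=
    (hg.fderiv_right (m := ∞) (by simp)).differentiable (by simp)
  have key : ∀ i j : Fin d, ∀ x, partialDeriv i (partialDeriv j g) x =
      fderiv ℝ (fderiv ℝ g) x (EuclideanSpace.single i 1) (EuclideanSpace.single j 1) := by
    intro i j x
    rw [partialDeriv_eq_fderiv ((contDiff_partialDeriv hg j).differentiable (by simp)),
      partialDeriv_eq_fderiv (hg.differentiable (by simp))]
    simp only
    rw [fderiv_clm_apply (h2 x) (differentiableAt_const _)]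
    simp
  ext x
  rw [key, key]
  exact ((hg.contDiffAt (x := x)).isSymmSndFDerivAt (by
    simp only [minSmoothness_of_isRCLikeNormedField]
    exact WithTop.coe_le_coe.2 le_top)).eq _ _

lemma wordDeriv_perm {L L' : List (Fin d)} (h : L.Perm L') {g : E → ℂ} (hg : ContDiff ℝ ∞ g) :
    wordDeriv L g = wordDeriv L' g := by
  induction h with
  | nil => rfl
  | cons i _ ih => rw [wordDeriv_cons, wordDeriv_cons, ih]
  | swap i j l => exact partialDeriv_comm (contDiff_wordDeriv hg l) _ _
  | trans _ _ ih1 ih2 => exact ih1.trans ih2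

/-- Partial derivatives of smooth functions commute, so only the multiplicities in a word matter.
Words are convenient for induction, and this returns them to the multi-indices of the statement. -/
lemma wordDeriv_eq_multiDeriv (L : List (Fin d)) {g : E → ℂ} (hg : ContDiff ℝ ∞ g) :
    wordDeriv L g = multiDeriv (fun i => L.count i) g := by
  rw [multiDeriv_eq_wordDeriv]
  refine wordDeriv_perm (List.perm_iff_count.2 fun a => ?_) hg
  have h : ∀ l : List (Fin d), l.Nodup →
      (l.flatMap fun j => List.replicate (L.count j) j).count a =
        if a ∈ l then L.count a else 0 := by
    intro l
    induction l with
    | nil => simp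
    | cons j l ih =>
      intro hl
      rw [List.nodup_cons] at hl
      rw [List.flatMap_cons, List.count_append, ih hl.2, List.count_replicate]
      by_cases hij : a = j
      · subst hij
        simp [hl.1]
      · have : j ≠ a := fun h => hij h.symm
        simp [this, hij]
  rw [multiWord, h _ (List.nodup_finRange d)]
  simp

lemma partialDeriv_add {g h : E → ℂ} (hg : Differentiable ℝ g) (hh : Differentiable ℝ h)
    (i : Fin d) : partialDeriv i (fun x => g x + h x) =
      fun x => partialDeriv i g x + partialDeriv i h x := by
  ext x
  have := HasDerivAt.add (hasLineDerivAt_partialDeriv hg i x) (hasLineDerivAt_partialDeriv hh i x)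
  exact HasLineDerivAt.lineDeriv this

lemma partialDeriv_const_mul {g : E → ℂ} (hg : Differentiable ℝ g) (c : ℂ)
    (i : Fin d) : partialDeriv i (fun x => c * g x) = fun x => c * partialDeriv i g x := by
  ext x
  have := HasDerivAt.const_mul c (hasLineDerivAt_partialDeriv hg i x)
  exact HasLineDerivAt.lineDeriv this

lemma wordDeriv_add {g h : E → ℂ} (hg : ContDiff ℝ ∞ g) (hh : ContDiff ℝ ∞ h)
    (L : List (Fin d)) : wordDeriv L (fun x => g x + h x) =
      fun x => wordDeriv L g x + wordDeriv L h x := by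
  induction L with
  | nil => rfl
  | cons i L ih =>
    rw [wordDeriv_cons, ih, partialDeriv_add ((contDiff_wordDeriv hg L).differentiable (by simp))
      ((contDiff_wordDeriv hh L).differentiable (by simp))]
    rfl

lemma wordDeriv_const_mul {g : E → ℂ} (hg : ContDiff ℝ ∞ g) (c : ℂ)
    (L : List (Fin d)) : wordDeriv L (fun x => c * g x) = fun x => c * wordDeriv L g x := by
  induction L with
  | nil => rfl
  | cons i L ih =>
    rw [wordDeriv_cons, ih,
      partialDeriv_const_mul ((contDiff_wordDeriv hg L).differentiable (by simp))]
    rfl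

lemma wordDeriv_comp_sub (g : E → ℂ) (y : E) (L : List (Fin d)) :
    wordDeriv L (fun x => g (x - y)) = fun x => wordDeriv L g (x - y) := by
  induction L with
  | nil => rfl
  | cons i L ih =>
    rw [wordDeriv_cons, ih]
    ext x
    simp only [partialDeriv, lineDeriv, wordDeriv_cons]
    congr 1
    ext t
    congr 1
    abel

/-- Smooth functions all of whose derivatives are square integrable. -/
structure SmoothLTwo (g : E → ℂ) : Prop where
  contDiff : ContDiff ℝ ∞ g
  memLp : ∀ L, MemLp (wordDeriv L g) 2 volume

namespace SmoothLTwo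

lemma memLp_self {g : E → ℂ} (hg : SmoothLTwo g) : MemLp g 2 volume := hg.memLp []

lemma partialDeriv {g : E → ℂ} (hg : SmoothLTwo g) (i : Fin d) : SmoothLTwo (partialDeriv i g) where
  contDiff := contDiff_partialDeriv hg.contDiff i
  memLp L := by
    have := hg.memLp (L ++ [i])
    rwa [wordDeriv_append] at this

lemma add {g h : E → ℂ} (hg : SmoothLTwo g) (hh : SmoothLTwo h) : SmoothLTwo (fun x => g x + h x) where
  contDiff := hg.contDiff.add hh.contDiff
  memLp L := by
    rw [wordDeriv_add hg.contDiff hh.contDiff]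
    exact (hg.memLp L).add (hh.memLp L)

lemma const_mul {g : E → ℂ} (hg : SmoothLTwo g) (c : ℂ) : SmoothLTwo (fun x => c * g x) where
  contDiff := contDiff_const.mul hg.contDiff
  memLp L := by
    rw [wordDeriv_const_mul hg.contDiff]
    exact (hg.memLp L).const_mul c

end SmoothLTwo

/-- The operator `1 + (2π)⁻¹ ∂_i`, whose symbol is `1 + i ξ_i`. -/
def shiftDeriv (i : Fin d) (g : E → ℂ) : E → ℂ :=
  fun x => g x + ((2 * Real.pi)⁻¹ : ℝ) * partialDeriv i g x

/-- The operator with symbol `∏ (1 + i ξ_j) ^ N`. -/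
def liftOp (N : ℕ) (g : E → ℂ) : E → ℂ :=
  (List.finRange d).foldr (fun i h => (shiftDeriv i)^[N] h) g

/-- The symbol `∏ (1 + i ξ_j) ^ (-N)`. -/
def liftWeight (N : ℕ) (ξ : E) : ℂ := ∏ i, ((1 + Complex.I * (ξ i : ℝ)) ^ N)⁻¹

lemma one_add_I_mul_ne_zero (t : ℝ) : (1 + Complex.I * (t : ℂ)) ≠ 0 := by
  intro h0
  have := congrArg Complex.re h0
  simp at this

lemma one_le_norm_one_add_I_mul (t : ℝ) : 1 ≤ ‖1 + Complex.I * (t : ℂ)‖ := by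
  refine le_trans ?_ (Complex.abs_re_le_norm _)
  simp

lemma SmoothLTwo.shiftDeriv {g : E → ℂ} (hg : SmoothLTwo g) (i : Fin d) :
    SmoothLTwo (shiftDeriv i g) := hg.add ((hg.partialDeriv i).const_mul _)

lemma ltwoFourier_shiftDeriv {g : E → ℂ} (hg : SmoothLTwo g) (i : Fin d) :
    ltwoFourier (shiftDeriv i g) =ᵐ[volume]
      fun ξ => (1 + Complex.I * (ξ i : ℝ)) * ltwoFourier g ξ := by
  have h1 := ltwoFourier_add hg.memLp_self ((hg.partialDeriv i).const_mul
    (((2 * Real.pi)⁻¹ : ℝ) : ℂ)).memLp_self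
  have h2 := ltwoFourier_const_mul (hg.partialDeriv i).memLp_self (((2 * Real.pi)⁻¹ : ℝ) : ℂ)
  have h3 := ltwoFourier_lineDeriv hg.memLp_self (hg.partialDeriv i).memLp_self
    (hasLineDerivAt_partialDeriv (hg.contDiff.differentiable (by simp)) i)
  filter_upwards [h1, h2, h3] with ξ h1 h2 h3
  refine h1.trans ?_
  rw [Pi.add_apply, h2, h3, EuclideanSpace.inner_single_right]
  have hpi : (Real.pi : ℂ) ≠ 0 := Complex.ofReal_ne_zero.2 Real.pi_ne_zero
  push_cast
  simp only [one_mul, conj_trivial]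
  field_simp

lemma SmoothLTwo.iterate_shiftDeriv {g : E → ℂ} (hg : SmoothLTwo g) (i : Fin d) (N : ℕ) :
    SmoothLTwo ((PseudoDiffCauchy.shiftDeriv i)^[N] g) ∧
    ltwoFourier ((PseudoDiffCauchy.shiftDeriv i)^[N] g) =ᵐ[volume]
      fun ξ => (1 + Complex.I * (ξ i : ℝ)) ^ N * ltwoFourier g ξ := by
  induction N with
  | zero => exact ⟨hg, by simp⟩
  | succ N ih =>
    rw [Function.iterate_succ_apply']
    refine ⟨ih.1.shiftDeriv i, ?_⟩
    filter_upwards [ltwoFourier_shiftDeriv ih.1 i, ih.2] with ξ h1 h2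
    rw [h1, h2, pow_succ]; ring

lemma SmoothLTwo.liftOp_aux {g : E → ℂ} (hg : SmoothLTwo g) (N : ℕ) :
    SmoothLTwo (liftOp N g) ∧ ltwoFourier (liftOp N g) =ᵐ[volume]
      fun ξ => (∏ i, (1 + Complex.I * (ξ i : ℝ)) ^ N) * ltwoFourier g ξ := by
  simp_rw [Fin.prod_univ_def]
  unfold PseudoDiffCauchy.liftOp
  induction List.finRange d with
  | nil => exact ⟨hg, by simp⟩
  | cons i l ih =>
    rw [List.foldr_cons]
    obtain ⟨h1, h2⟩ := ih.1.iterate_shiftDeriv i N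
    refine ⟨h1, ?_⟩
    filter_upwards [h2, ih.2] with ξ h3 h4
    rw [h3, h4, List.map_cons, List.prod_cons, mul_assoc]

lemma SmoothLTwo.liftOp {g : E → ℂ} (hg : SmoothLTwo g) (N : ℕ) : SmoothLTwo (liftOp N g) :=
  (hg.liftOp_aux N).1

lemma liftWeight_mul_ltwoFourier_liftOp {g : E → ℂ} (hg : SmoothLTwo g) (N : ℕ) :
    (fun ξ => liftWeight N ξ * ltwoFourier (liftOp N g) ξ) =ᵐ[volume] ltwoFourier g := by
  filter_upwards [(hg.liftOp_aux N).2] with ξ h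
  rw [h, liftWeight, ← mul_assoc, ← Finset.prod_mul_distrib, Finset.prod_eq_one, one_mul]
  intro i _
  exact inv_mul_cancel₀ (pow_ne_zero N (one_add_I_mul_ne_zero _))

lemma continuous_liftWeight (N : ℕ) : Continuous (liftWeight N : E → ℂ) := by
  unfold liftWeight
  refine continuous_finsetProd _ fun i _ => Continuous.inv₀ (by fun_prop)
    fun ξ => pow_ne_zero N (one_add_I_mul_ne_zero _)

/-- Every factor `|1 + iξ_j|` is at least one, so the product dominates the factor of the largest
coordinate, which is comparable to `1 + ‖ξ‖`. -/
lemma norm_liftWeight_le (hd : 0 < d) (N : ℕ) (ξ : E) :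
    ‖liftWeight N ξ‖ ≤ (2 * √d) ^ N * ((1 + ‖ξ‖) ^ N)⁻¹ := by
  obtain ⟨i, hi⟩ := exists_norm_le_sqrt_mul_abs hd ξ
  have h1 : ‖1 + Complex.I * (ξ i : ℂ)‖ ≤ ∏ j, ‖1 + Complex.I * (ξ j : ℂ)‖ := by
    calc _ = ∏ j, if j = i then ‖1 + Complex.I * (ξ i : ℂ)‖ else 1 := by simp
      _ ≤ _ := by
        refine Finset.prod_le_prod (fun j _ => ?_) fun j _ => ?_
        · split_ifs <;> positivity
        · split_ifs with h
          · rw [h]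
          · exact one_le_norm_one_add_I_mul _
  have h2 : |ξ i| ≤ ‖1 + Complex.I * (ξ i : ℂ)‖ := by
    refine le_trans (le_of_eq ?_) (Complex.abs_im_le_norm _)
    simp
  have hd1 : 1 ≤ √d := Real.one_le_sqrt.2 (by exact_mod_cast hd)
  have h3 : 1 + ‖ξ‖ ≤ 2 * √d * ∏ j, ‖1 + Complex.I * (ξ j : ℂ)‖ := by
    have := one_le_norm_one_add_I_mul (ξ i)
    nlinarith
  rw [liftWeight, norm_prod]
  simp_rw [norm_inv, norm_pow]
  rw [Finset.prod_inv_distrib, Finset.prod_pow, ← div_eq_mul_inv, le_div_iff₀ (by positivity),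
    inv_mul_le_iff₀ ?_, mul_comm _ (_ ^ N), ← mul_pow]
  · exact pow_le_pow_left₀ (by positivity) h3 N
  · refine pow_pos (Finset.prod_pos fun j _ => ?_) N
    have := one_le_norm_one_add_I_mul (ξ j)
    linarith

/-- Symbols dominated by `(1 + ‖ξ‖) ^ (-ρ)` with `ρ > d`. -/
lemma integrable_memLp_of_norm_le {m : E → ℂ} (hm : AEStronglyMeasurable m volume) {C ρ : ℝ}
    (hρ : (d : ℝ) < ρ) (h : ∀ ξ, ‖m ξ‖ ≤ C * (1 + ‖ξ‖) ^ (-ρ)) :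
    Integrable m ∧ MemLp m 2 volume := by
  have hρ' : (Module.finrank ℝ E : ℝ) < ρ := by rwa [finrank_euclideanSpace_fin]
  refine ⟨((integrable_one_add_norm hρ').const_mul C).mono' hm (Filter.Eventually.of_forall h),
    ?_⟩
  have h2 := memLp_two_one_add_norm (V := E) (ρ := ρ) (by
    have : (0 : ℝ) ≤ Module.finrank ℝ E := by positivity
    linarith)
  refine h2.of_le_mul (c := C) hm (Filter.Eventually.of_forall fun ξ => ?_)
  rw [Real.norm_of_nonneg (by positivity)]
  exact h ξ

lemma integrable_memLp_liftWeight (hd : 0 < d) {N : ℕ} (hN : d < N) :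
    Integrable (liftWeight N : E → ℂ) ∧ MemLp (liftWeight N : E → ℂ) 2 volume := by
  refine integrable_memLp_of_norm_le (continuous_liftWeight N).aestronglyMeasurable
    (C := (2 * √d) ^ N) (ρ := N) (by exact_mod_cast hN) fun ξ => ?_
  rw [Real.rpow_neg (by positivity), Real.rpow_natCast]
  exact norm_liftWeight_le hd N ξ

/-- The transform is the square integrable weight times the transform of `liftOp (d+1) g`, which is
also in `L²`; a product of two `L²` functions is integrable. -/
lemma integrable_ltwoFourier (hd : 0 < d) {g : E → ℂ} (hg : SmoothLTwo g) :
    Integrable (ltwoFourier g) :=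
  (integrable_mul_ltwoFourier (integrable_memLp_liftWeight hd (Nat.lt_succ_self d)).2 _).congr
    (liftWeight_mul_ltwoFourier_liftOp hg (d + 1))

lemma continuous_fourierInv {h : E → ℂ} (h1 : Integrable h) : Continuous (𝓕⁻ h) := by
  have : 𝓕⁻ h = (𝓕 h) ∘ (fun x => -x) := by
    ext x; exact Real.fourierInv_eq_fourier_neg h x
  rw [this]
  refine Continuous.comp ?_ continuous_neg
  exact VectorFourier.fourierIntegral_continuous Real.continuous_fourierChar
      (by simp only [innerₗ_apply_apply]; fun_prop) h1

lemma SmoothLTwo.eq_fourierInv (hd : 0 < d) {g : E → ℂ} (hg : SmoothLTwo g) (x : E) :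
    g x = 𝓕⁻ (ltwoFourier g) x := by
  have h1 := integrable_ltwoFourier hd hg
  have h2 := fourierInv_ltwoFourier hg.memLp_self h1
  exact (congrFun ((continuous_fourierInv h1).ae_eq_iff_eq volume hg.contDiff.continuous |>.1 h2)
    x).symm

/-- A Sobolev inequality. -/
lemma SmoothLTwo.enorm_le (hd : 0 < d) {g : E → ℂ} (hg : SmoothLTwo g) (x : E) :
    ‖g x‖ₑ ≤ eLpNorm (liftWeight (d + 1) : E → ℂ) 2 volume *
      eLpNorm (PseudoDiffCauchy.liftOp (d + 1) g) 2 volume := by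
  have hw := (integrable_memLp_liftWeight hd (Nat.lt_succ_self d)).2
  rw [hg.eq_fourierInv hd x, Real.fourierInv_eq]
  refine (enorm_integral_le_lintegral_enorm _).trans ?_
  rw [← eLpNorm_ltwoFourier (hg.liftOp (d + 1)).memLp_self]
  have h1 := eLpNorm_le_eLpNorm_mul_eLpNorm_of_nnnorm (p := 2) (q := 2) (r := 1)
    hw.1 (memLp_ltwoFourier (PseudoDiffCauchy.liftOp (d + 1) g)).1 (fun a b => a * b) 1
    (Filter.Eventually.of_forall fun ξ => by simp)
  rw [eLpNorm_one_eq_lintegral_enorm] at h1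
  simp only [ENNReal.coe_one, one_mul] at h1
  refine le_trans (le_of_eq ?_) h1
  refine lintegral_congr_ae ?_
  filter_upwards [liftWeight_mul_ltwoFourier_liftOp hg (d + 1)] with ξ hξ
  rw [Circle.smul_def, hξ, smul_eq_mul, ← ofReal_norm, norm_fourierChar_mul, ofReal_norm]

/-! ### Measurable families of smooth functions with uniform `L² ∩ L^p` bounds. -/

/-- Jointly measurable families of smooth functions all of whose derivatives are bounded in
`L² ∩ L^p`, uniformly in the parameter. -/
structure SmoothField {Z : Type*} [MeasurableSpace Z] (p : ℝ) (F : Z → E → ℂ) : Prop where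
  measurable : Measurable (Function.uncurry F)
  contDiff : ∀ z, ContDiff ℝ ∞ (F z)
  bound : ∀ L, ∃ C : ℝ≥0, ∀ z, eLpNorm (wordDeriv L (F z)) 2 volume ≤ C ∧
    eLpNorm (wordDeriv L (F z)) (ENNReal.ofReal p) volume ≤ C

lemma measurable_partialDeriv {Z : Type*} [MeasurableSpace Z] {F : Z → E → ℂ}
    (hF : Measurable (Function.uncurry F)) (hd : ∀ z, Differentiable ℝ (F z)) (i : Fin d) :
    Measurable (Function.uncurry fun z => partialDeriv i (F z)) := by
  let e : E := EuclideanSpace.single i 1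
  refine measurable_of_tendsto_metrizable
    (f := fun (k : ℕ) (q : Z × E) =>
      ((1 : ℝ) / (k + 1))⁻¹ • (F q.1 (q.2 + ((1 : ℝ) / (k + 1)) • e) - F q.1 q.2))
    (fun k => ?_) (tendsto_pi_nhds.2 fun q => ?_)
  · have h1 : Measurable fun q : Z × E =>
        F q.1 (q.2 + ((1 : ℝ) / (k + 1)) • e) - Function.uncurry F q :=
      (hF.comp (measurable_fst.prodMk (measurable_snd.add_const _))).sub hF
    exact h1.const_smul ((1 : ℝ) / (k + 1))⁻¹
  · have h1 := hasDerivAt_iff_tendsto_slope_zero.1 (hasLineDerivAt_partialDeriv (hd q.1) i q.2)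
    simp only [zero_add, zero_smul, add_zero] at h1
    refine h1.comp (tendsto_nhdsWithin_iff.2
      ⟨tendsto_one_div_add_atTop_nhds_zero_nat, Filter.Eventually.of_forall fun k => ?_⟩)
    simp only [mem_compl_iff, mem_singleton_iff]
    positivity

namespace SmoothField

section

variable {Z Z' : Type*} [MeasurableSpace Z] [MeasurableSpace Z'] {p : ℝ}

lemma smoothLTwo {F : Z → E → ℂ} (hF : SmoothField p F) (z : Z) : SmoothLTwo (F z) where
  contDiff := hF.contDiff z
  memLp L := by
    obtain ⟨C, hC⟩ := hF.bound L
    exact ⟨(contDiff_wordDeriv (hF.contDiff z) L).continuous.aestronglyMeasurable,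
      (hC z).1.trans_lt ENNReal.coe_lt_top⟩

lemma differentiable {F : Z → E → ℂ} (hF : SmoothField p F) (z : Z) : Differentiable ℝ (F z) :=
  (hF.contDiff z).differentiable (by simp)

lemma partialDeriv {F : Z → E → ℂ} (hF : SmoothField p F) (i : Fin d) :
    SmoothField p (fun z => partialDeriv i (F z)) where
  measurable := measurable_partialDeriv hF.measurable hF.differentiable i
  contDiff z := contDiff_partialDeriv (hF.contDiff z) i
  bound L := by
    obtain ⟨C, hC⟩ := hF.bound (L ++ [i])
    refine ⟨C, fun z => ?_⟩
    have := hC z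
    rwa [wordDeriv_append] at this

lemma wordDeriv {F : Z → E → ℂ} (hF : SmoothField p F) (L : List (Fin d)) :
    SmoothField p (fun z => wordDeriv L (F z)) := by
  induction L with
  | nil => exact hF
  | cons i L ih => exact ih.partialDeriv i

lemma add {F G : Z → E → ℂ} (hp : 1 ≤ p) (hF : SmoothField p F) (hG : SmoothField p G) :
    SmoothField p (fun z x => F z x + G z x) where
  measurable := hF.measurable.add hG.measurable
  contDiff z := (hF.contDiff z).add (hG.contDiff z)
  bound L := by
    obtain ⟨C, hC⟩ := hF.bound L
    obtain ⟨D, hD⟩ := hG.bound L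
    refine ⟨C + D, fun z => ?_⟩
    have h1 := (contDiff_wordDeriv (hF.contDiff z) L).continuous.aestronglyMeasurable
      (μ := (volume : Measure E))
    have h2 := (contDiff_wordDeriv (hG.contDiff z) L).continuous.aestronglyMeasurable
      (μ := (volume : Measure E))
    rw [wordDeriv_add (hF.contDiff z) (hG.contDiff z), ENNReal.coe_add]
    exact ⟨(eLpNorm_add_le h1 h2 (by norm_num)).trans (add_le_add (hC z).1 (hD z).1),
      (eLpNorm_add_le h1 h2 (by simpa using ENNReal.ofReal_le_ofReal hp)).trans
        (add_le_add (hC z).2 (hD z).2)⟩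

lemma const_mul {F : Z → E → ℂ} (hF : SmoothField p F) (c : ℂ) :
    SmoothField p (fun z x => c * F z x) where
  measurable := hF.measurable.const_mul c
  contDiff z := contDiff_const.mul (hF.contDiff z)
  bound L := by
    obtain ⟨C, hC⟩ := hF.bound L
    refine ⟨‖c‖₊ * C, fun z => ?_⟩
    have h : ∀ q : ℝ≥0∞, eLpNorm (fun x => c * PseudoDiffCauchy.wordDeriv L (F z) x) q volume =
        ‖c‖ₑ * eLpNorm (PseudoDiffCauchy.wordDeriv L (F z)) q volume := fun q =>
      eLpNorm_const_smul c _ q _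
    rw [wordDeriv_const_mul (hF.contDiff z), h, h, ENNReal.coe_mul]
    exact ⟨mul_le_mul' le_rfl (hC z).1, mul_le_mul' le_rfl (hC z).2⟩

lemma iterate_shiftDeriv (hp : 1 ≤ p) {F : Z → E → ℂ} (hF : SmoothField p F) (i : Fin d) (N : ℕ) :
    SmoothField p (fun z => (shiftDeriv i)^[N] (F z)) := by
  induction N with
  | zero => exact hF
  | succ N ih =>
    simp only [Function.iterate_succ_apply']
    exact ih.add hp ((ih.partialDeriv i).const_mul _)

lemma liftOp (hp : 1 ≤ p) {F : Z → E → ℂ} (hF : SmoothField p F) (N : ℕ) :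
    SmoothField p (fun z => liftOp N (F z)) := by
  unfold PseudoDiffCauchy.liftOp
  induction List.finRange d with
  | nil => exact hF
  | cons i l ih =>
    simp only [List.foldr_cons]
    exact ih.iterate_shiftDeriv hp i N

lemma comp {F : Z → E → ℂ} (hF : SmoothField p F) {φ : Z' → Z} (hφ : Measurable φ) :
    SmoothField p (fun z => F (φ z)) where
  measurable := hF.measurable.comp ((hφ.comp measurable_fst).prodMk measurable_snd)
  contDiff z := hF.contDiff _
  bound L := by
    obtain ⟨C, hC⟩ := hF.bound L
    exact ⟨C, fun z => hC _⟩

lemma translate {F : Z → E → ℂ} (hF : SmoothField p F) :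
    SmoothField p (fun (q : Z × E) x => F q.1 (x - q.2)) where
  measurable := hF.measurable.comp (measurable_fst.fst.prodMk
    (measurable_snd.sub measurable_fst.snd))
  contDiff q := (hF.contDiff q.1).comp (contDiff_id.sub contDiff_const)
  bound L := by
    obtain ⟨C, hC⟩ := hF.bound L
    refine ⟨C, fun q => ?_⟩
    rw [wordDeriv_comp_sub]
    have h := fun r : ℝ≥0∞ => eLpNorm_comp_measurePreserving (p := r)
      (contDiff_wordDeriv (hF.contDiff q.1) L).continuous.aestronglyMeasurable
      (measurePreserving_sub_right (volume : Measure E) q.2)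
    have h2 := h 2
    have hp := h (ENNReal.ofReal p)
    simp only [Function.comp_def] at h2 hp
    rw [h2, hp]
    exact hC q.1

lemma indicator {F : Z → E → ℂ} {S : Set Z} (hS : MeasurableSet S) [DecidablePred (· ∈ S)]
    (hF : Measurable (Function.uncurry F)) (hd : ∀ z ∈ S, ContDiff ℝ ∞ (F z))
    (hb : ∀ L, ∃ C : ℝ≥0, ∀ z ∈ S, eLpNorm (PseudoDiffCauchy.wordDeriv L (F z)) 2 volume ≤ C ∧
      eLpNorm (PseudoDiffCauchy.wordDeriv L (F z)) (ENNReal.ofReal p) volume ≤ C) :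
    SmoothField p (fun z x => if z ∈ S then F z x else 0) where
  measurable := Measurable.ite (measurable_fst hS) hF measurable_const
  contDiff z := by
    by_cases h : z ∈ S
    · simpa [h] using hd z h
    · simpa [h] using contDiff_const
  bound L := by
    obtain ⟨C, hC⟩ := hb L
    refine ⟨C, fun z => ?_⟩
    by_cases h : z ∈ S
    · simpa [h] using hC z h
    · have h0 : PseudoDiffCauchy.wordDeriv L (fun _ : E => (0 : ℂ)) = fun _ => 0 := by
        have := wordDeriv_const_mul (g := fun _ : E => (0 : ℂ)) contDiff_const 0 L
        simpa using this
      simp [h, h0]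

/-- The Sobolev inequality applied to the whole family at once. Uniform boundedness supplies the
dominating functions for differentiation under the integral and for Fubini below. -/
lemma exists_norm_le (hd : 0 < d) (hp : 1 ≤ p) {F : Z → E → ℂ} (hF : SmoothField p F) :
    ∃ C : ℝ, 0 ≤ C ∧ ∀ z x, ‖F z x‖ ≤ C := by
  obtain ⟨C, hC⟩ := (hF.liftOp hp (d + 1)).bound []
  set B := eLpNorm (liftWeight (d + 1) : E → ℂ) 2 volume * C
  have hB : B ≠ ⊤ := ENNReal.mul_ne_top
    (integrable_memLp_liftWeight hd (Nat.lt_succ_self d)).2.2.ne ENNReal.coe_ne_top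
  refine ⟨B.toReal, ENNReal.toReal_nonneg, fun z x => ?_⟩
  have h1 := ((hF.smoothLTwo z).enorm_le hd x).trans (mul_le_mul' le_rfl (hC z).1)
  rw [← toReal_enorm]
  exact ENNReal.toReal_mono hB h1

end

end SmoothField

/-- Minkowski's integral inequality, for a superposition of functions bounded in `L^q`. -/
lemma eLpNorm_superposition_le {Z : Type*} [MeasurableSpace Z] {μ : Measure Z} [SFinite μ]
    {K : Z → ℂ} (hK : Measurable K) {H : Z → E → ℂ} (hH : Measurable (Function.uncurry H))
    {q : ℝ≥0∞} (hq : 1 ≤ q) (hq' : q ≠ ⊤) {C D : ℝ≥0} (hC : ∫⁻ z, ‖K z‖ₑ ∂μ ≤ C)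
    (hD : ∀ z, eLpNorm (H z) q volume ≤ D) :
    eLpNorm (fun x => ∫ z, K z * H z x ∂μ) q volume ≤ (C * D : ℝ≥0) := by
  -- Against the finite measure `|K| μ`, of mass at most `C`, Hölder's inequality gives `|∫ K H|^q ≤
  -- C^{q-1} ∫ |H|^q dν` pointwise in `x`. Tonelli then finishes.
  set ν := μ.withDensity fun z => ‖K z‖ₑ
  have hν : ν univ ≤ C := by
    simpa [ν] using hC
  have : IsFiniteMeasure ν := ⟨hν.trans_lt ENNReal.coe_lt_top⟩
  have hq0 : q ≠ 0 := (zero_lt_one.trans_le hq).ne'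
  have hqr : 0 < q.toReal := ENNReal.toReal_pos hq0 hq'
  have hq1 : 1 ≤ q.toReal := by
    simpa using (ENNReal.toReal_le_toReal ENNReal.one_ne_top hq').2 hq
  have hpt : ∀ x, ‖∫ z, K z * H z x ∂μ‖ₑ ^ q.toReal ≤
      (∫⁻ z, ‖H z x‖ₑ ^ q.toReal ∂ν) * (C : ℝ≥0∞) ^ (q.toReal - 1) := by
    intro x
    have hm : Measurable fun z => H z x := hH.comp (measurable_id.prodMk measurable_const)
    have h1 : ‖∫ z, K z * H z x ∂μ‖ₑ ≤ eLpNorm (fun z => H z x) 1 ν := by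
      refine (enorm_integral_le_lintegral_enorm _).trans (le_of_eq ?_)
      rw [eLpNorm_one_eq_lintegral_enorm, lintegral_withDensity_eq_lintegral_mul _ hK.enorm
        hm.enorm]
      simp [enorm_mul]
    have h2 := eLpNorm_le_eLpNorm_mul_rpow_measure_univ (μ := ν) hq hm.aestronglyMeasurable
    have h3 := ENNReal.rpow_le_rpow (h1.trans h2) hqr.le
    refine h3.trans ?_
    rw [ENNReal.mul_rpow_of_nonneg _ _ hqr.le, eLpNorm_eq_lintegral_rpow_enorm_toReal hq0 hq',
      ← ENNReal.rpow_mul, ← ENNReal.rpow_mul, one_div q.toReal, inv_mul_cancel₀ hqr.ne',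
      ENNReal.rpow_one]
    gcongr
    have e : (1 / (1 : ℝ≥0∞).toReal - q.toReal⁻¹) * q.toReal = q.toReal - 1 := by
      rw [ENNReal.toReal_one, sub_mul, inv_mul_cancel₀ hqr.ne']; ring
    rw [e]
    exact ENNReal.rpow_le_rpow hν (by linarith)
  rw [eLpNorm_eq_lintegral_rpow_enorm_toReal hq0 hq', one_div,
    ENNReal.rpow_inv_le_iff hqr]
  have hmeas : Measurable fun w : E × Z => ‖H w.2 w.1‖ₑ ^ q.toReal :=
    ((hH.comp measurable_swap).enorm).pow_const _
  calc ∫⁻ x, ‖∫ z, K z * H z x ∂μ‖ₑ ^ q.toReal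
      ≤ ∫⁻ x, (∫⁻ z, ‖H z x‖ₑ ^ q.toReal ∂ν) * (C : ℝ≥0∞) ^ (q.toReal - 1) := lintegral_mono hpt
    _ = (∫⁻ z, (∫⁻ x, ‖H z x‖ₑ ^ q.toReal) ∂ν) * (C : ℝ≥0∞) ^ (q.toReal - 1) := by
        rw [lintegral_mul_const _ hmeas.lintegral_prod_right', lintegral_lintegral_swap
          hmeas.aemeasurable]
    _ ≤ (∫⁻ _, (D : ℝ≥0∞) ^ q.toReal ∂ν) * (C : ℝ≥0∞) ^ (q.toReal - 1) := by
        gcongr with z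
        have := ENNReal.rpow_le_rpow (hD z) hqr.le
        rwa [eLpNorm_eq_lintegral_rpow_enorm_toReal hq0 hq', one_div, ← ENNReal.rpow_mul,
          inv_mul_cancel₀ hqr.ne', ENNReal.rpow_one] at this
    _ ≤ ((D : ℝ≥0∞) ^ q.toReal * C) * (C : ℝ≥0∞) ^ (q.toReal - 1) := by
        rw [lintegral_const]
        gcongr
    _ = _ := by
        have e : (C : ℝ≥0∞) * (C : ℝ≥0∞) ^ (q.toReal - 1) = (C : ℝ≥0∞) ^ q.toReal := by
          calc (C : ℝ≥0∞) * (C : ℝ≥0∞) ^ (q.toReal - 1)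
              = (C : ℝ≥0∞) ^ (1 : ℝ) * (C : ℝ≥0∞) ^ (q.toReal - 1) := by rw [ENNReal.rpow_one]
            _ = _ := by
              rw [← ENNReal.rpow_add_of_nonneg _ _ (by norm_num) (by linarith)]
              congr 1; ring
        rw [mul_assoc, e, ENNReal.coe_mul, ENNReal.mul_rpow_of_nonneg _ _ hqr.le, mul_comm]

/-! ### Superpositions of smooth fields and differentiation under the integral sign. -/

section Superposition

variable {Z : Type*} [MeasurableSpace Z] {μ : Measure Z} {p : ℝ}

lemma integrable_mul_field (hd : 0 < d) (hp : 1 ≤ p) {K : Z → ℂ} (hK : Integrable K μ)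
    {H : Z → E → ℂ} (hH : SmoothField p H) (x : E) : Integrable (fun z => K z * H z x) μ := by
  obtain ⟨C, -, hC⟩ := hH.exists_norm_le hd hp
  refine hK.mul_bdd (c := C) ?_ (Filter.Eventually.of_forall fun z => hC z x)
  exact (hH.measurable.comp (measurable_id.prodMk measurable_const)).aestronglyMeasurable

/-- The linear form `v ↦ v_i c`, as a function of `c`. -/
def coordSMul (i : Fin d) : ℂ →L[ℝ] (E →L[ℝ] ℂ) :=
  ContinuousLinearMap.smulRightL ℝ E ℂ (EuclideanSpace.proj i)

lemma coordSMul_apply (i : Fin d) (c : ℂ) (v : E) : coordSMul i c v = v i • c := rfl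

lemma norm_coordSMul_le (i : Fin d) (c : ℂ) : ‖coordSMul i c‖ ≤ ‖c‖ := by
  refine ContinuousLinearMap.opNorm_le_bound _ (norm_nonneg c) fun v => ?_
  rw [coordSMul_apply, norm_smul, mul_comm]
  exact mul_le_mul_of_nonneg_left (PiLp.norm_apply_le v i) (norm_nonneg c)

lemma fderiv_eq_sum_partialDeriv {g : E → ℂ} (hg : Differentiable ℝ g) (x : E) :
    fderiv ℝ g x = ∑ i, coordSMul i (partialDeriv i g x) := by
  ext v
  rw [_root_.sum_apply]
  simp only [coordSMul_apply, partialDeriv_eq_fderiv hg]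
  conv_lhs => rw [← (EuclideanSpace.basisFun (Fin d) ℝ).sum_repr v]
  simp

/-- The first derivatives of the field are bounded uniformly in the parameter, so a multiple of
`|K|` dominates and the derivative passes under the integral. -/
lemma hasFDerivAt_superposition (hd : 0 < d) (hp : 1 ≤ p) {K : Z → ℂ} (hK : Integrable K μ)
    {H : Z → E → ℂ} (hH : SmoothField p H) (x : E) :
    HasFDerivAt (fun x => ∫ z, K z * H z x ∂μ)
      (∑ i, coordSMul i (∫ z, K z * partialDeriv i (H z) x ∂μ)) x := by
  choose C hC0 hC using fun i => (hH.partialDeriv i).exists_norm_le hd hp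
  have hform : ∀ z y, HasFDerivAt (fun y => K z * H z y)
      (∑ i, coordSMul i (K z * partialDeriv i (H z) y)) y := by
    intro z y
    refine (((hH.differentiable z y).hasFDerivAt).const_mul (K z)).congr_fderiv ?_
    rw [fderiv_eq_sum_partialDeriv (hH.differentiable z), Finset.smul_sum]
    refine Finset.sum_congr rfl fun i _ => ContinuousLinearMap.ext fun v => ?_
    rw [coordSMul_apply, _root_.smul_apply, coordSMul_apply, smul_eq_mul, mul_smul_comm]
  have hint : ∀ i, Integrable (fun z => coordSMul i (K z * partialDeriv i (H z) x)) μ := fun i =>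
    (coordSMul i).integrable_comp (integrable_mul_field hd hp hK (hH.partialDeriv i) x)
  have hbd : ∀ z y, ‖∑ i, coordSMul i (K z * partialDeriv i (H z) y)‖ ≤ ‖K z‖ * ∑ i, C i := by
    intro z y
    rw [Finset.mul_sum]
    refine (norm_sum_le _ _).trans (Finset.sum_le_sum fun i _ => ?_)
    refine (norm_coordSMul_le _ _).trans ?_
    rw [norm_mul]
    exact mul_le_mul_of_nonneg_left (hC i z y) (norm_nonneg _)
  have hm' : AEStronglyMeasurable (fun z => ∑ i, coordSMul i (K z * partialDeriv i (H z) x)) μ :=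
    Finset.aestronglyMeasurable_fun_sum _ fun i _ => (hint i).1
  have h := hasFDerivAt_integral_of_dominated_of_fderiv_le (𝕜 := ℝ) (x₀ := x) (μ := μ)
    (F := fun y z => K z * H z y) (F' := fun y z => ∑ i, coordSMul i (K z * partialDeriv i (H z) y))
    (bound := fun z => ‖K z‖ * ∑ i, C i) (s := univ) Filter.univ_mem
    (Filter.Eventually.of_forall fun y => (integrable_mul_field hd hp hK hH y).1)
    (integrable_mul_field hd hp hK hH x) hm'
    (Filter.Eventually.of_forall fun z y _ => hbd z y)
    (hK.norm.mul_const _) (Filter.Eventually.of_forall fun z y _ => hform z y)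
  refine h.congr_fderiv ?_
  rw [integral_finsetSum _ fun i _ => hint i]
  exact Finset.sum_congr rfl fun i _ => (coordSMul i).integral_comp_comm
      (integrable_mul_field hd hp hK (hH.partialDeriv i) x)

lemma partialDeriv_superposition (hd : 0 < d) (hp : 1 ≤ p) {K : Z → ℂ} (hK : Integrable K μ)
    {H : Z → E → ℂ} (hH : SmoothField p H) (i : Fin d) :
    partialDeriv i (fun x => ∫ z, K z * H z x ∂μ) =
      fun x => ∫ z, K z * partialDeriv i (H z) x ∂μ := by
  ext x
  have h := hasFDerivAt_superposition hd hp hK hH x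
  rw [partialDeriv, (h.hasLineDerivAt _).lineDeriv, _root_.sum_apply]
  simp [coordSMul_apply]

lemma wordDeriv_superposition (hd : 0 < d) (hp : 1 ≤ p) {K : Z → ℂ} (hK : Integrable K μ)
    {H : Z → E → ℂ} (hH : SmoothField p H) (L : List (Fin d)) :
    wordDeriv L (fun x => ∫ z, K z * H z x ∂μ) = fun x => ∫ z, K z * wordDeriv L (H z) x ∂μ := by
  induction L with
  | nil => rfl
  | cons i L ih =>
    rw [wordDeriv_cons, ih, partialDeriv_superposition hd hp hK (hH.wordDeriv L)]
    rfl

lemma contDiff_superposition (hd : 0 < d) (hp : 1 ≤ p) {K : Z → ℂ} (hK : Integrable K μ)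
    {H : Z → E → ℂ} (hH : SmoothField p H) :
    ContDiff ℝ ∞ (fun x => ∫ z, K z * H z x ∂μ) := by
  rw [contDiff_infty]
  intro n
  induction n generalizing H with
  | zero =>
    rw [Nat.cast_zero, contDiff_zero, continuous_iff_continuousAt]
    exact fun x => (hasFDerivAt_superposition hd hp hK hH x).continuousAt
  | succ n ih =>
    have h := hasFDerivAt_superposition hd hp hK hH
    rw [Nat.cast_succ, contDiff_succ_iff_fderiv]
    refine ⟨fun x => (h x).differentiableAt, fun h => absurd h (by simp), ?_⟩
    have e : fderiv ℝ (fun x => ∫ z, K z * H z x ∂μ) = fun x =>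
      (∑ i, coordSMul i (∫ z, K z * partialDeriv i (H z) x ∂μ)) := by
      ext1 x; exact (h x).fderiv
    rw [e]
    refine ContDiff.sum fun i _ => ?_
    exact (coordSMul i).contDiff.comp (ih (hH.partialDeriv i))

lemma iterate_shiftDeriv_superposition (hd : 0 < d) (hp : 1 ≤ p) {K : Z → ℂ}
    (hK : Integrable K μ) {H : Z → E → ℂ} (hH : SmoothField p H) (i : Fin d) (N : ℕ) :
    (shiftDeriv i)^[N] (fun x => ∫ z, K z * H z x ∂μ) =
      fun x => ∫ z, K z * (shiftDeriv i)^[N] (H z) x ∂μ := by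
  induction N with
  | zero => rfl
  | succ N ih =>
    have h1 := hH.iterate_shiftDeriv hp i N
    simp only [Function.iterate_succ_apply', ih]
    ext x
    rw [shiftDeriv, partialDeriv_superposition hd hp hK h1, ← integral_const_mul,
      ← integral_add (integrable_mul_field hd hp hK h1 x)
        ((integrable_mul_field hd hp hK (h1.partialDeriv i) x).const_mul _)]
    refine integral_congr_ae (Filter.Eventually.of_forall fun z => ?_)
    simp only [shiftDeriv]
    ring

lemma liftOp_superposition (hd : 0 < d) (hp : 1 ≤ p) {K : Z → ℂ}
    (hK : Integrable K μ) {H : Z → E → ℂ} (hH : SmoothField p H) (N : ℕ) :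
    liftOp N (fun x => ∫ z, K z * H z x ∂μ) = fun x => ∫ z, K z * liftOp N (H z) x ∂μ := by
  suffices h : ∀ l : List (Fin d),
      SmoothField p (fun z => l.foldr (fun i h => (shiftDeriv i)^[N] h) (H z)) ∧
      l.foldr (fun i h => (shiftDeriv i)^[N] h) (fun x => ∫ z, K z * H z x ∂μ) =
      fun x => ∫ z, K z * l.foldr (fun i h => (shiftDeriv i)^[N] h) (H z) x ∂μ from
    (h (List.finRange d)).2
  intro l
  induction l with
  | nil => exact ⟨hH, rfl⟩
  | cons i l ih =>
    simp only [List.foldr_cons]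
    refine ⟨ih.1.iterate_shiftDeriv hp i N, ?_⟩
    rw [ih.2, iterate_shiftDeriv_superposition hd hp hK ih.1]

/-- Superpositions of a smooth field with kernels of uniformly bounded mass. -/
lemma SmoothField.superposition (hd : 0 < d) (hp : 1 ≤ p) [SFinite μ] {W : Type*}
    [MeasurableSpace W] {K : W → Z → ℂ} (hK : Measurable (Function.uncurry K)) {C : ℝ≥0}
    (hC : ∀ w, ∫⁻ z, ‖K w z‖ₑ ∂μ ≤ C) {H : W × Z → E → ℂ} (hH : SmoothField p H) :
    SmoothField p (fun w x => ∫ z, K w z * H (w, z) x ∂μ) := by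
  have hKw : ∀ w, Measurable (K w) := fun w => hK.comp measurable_prodMk_left
  have hKi : ∀ w, Integrable (K w) μ := fun w =>
    ⟨(hKw w).aestronglyMeasurable, (hC w).trans_lt ENNReal.coe_lt_top⟩
  have hHw : ∀ w, SmoothField p (fun z => H (w, z)) := fun w => hH.comp measurable_prodMk_left
  refine ⟨?_, fun w => contDiff_superposition hd hp (hKi w) (hHw w), fun L => ?_⟩
  · have h1 : Measurable fun q : (W × E) × Z => K q.1.1 q.2 * H (q.1.1, q.2) q.1.2 :=
      (hK.comp (measurable_fst.fst.prodMk measurable_snd)).mul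
        (hH.measurable.comp ((measurable_fst.fst.prodMk measurable_snd).prodMk measurable_fst.snd))
    exact (h1.stronglyMeasurable.integral_prod_right').measurable
  · obtain ⟨D, hD⟩ := hH.bound L
    refine ⟨C * D, fun w => ?_⟩
    rw [wordDeriv_superposition hd hp (hKi w) (hHw w)]
    exact ⟨eLpNorm_superposition_le (hKw w) ((hHw w).wordDeriv L).measurable (by norm_num)
        (by norm_num) (hC w) fun z => (hD _).1,
      eLpNorm_superposition_le (hKw w) ((hHw w).wordDeriv L).measurable
        (by simpa using ENNReal.ofReal_le_ofReal hp) ENNReal.ofReal_ne_top (hC w)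
        fun z => (hD _).2⟩

end Superposition

/-! ### The `L¹` criterion for symbols that are Hölder continuous at the origin. -/

section Symbol

lemma iterate_diffOp_line (m : E → ℂ) (ζ e : E) (h : ℝ) (n : ℕ) (s : ℝ) :
    (diffOp h)^[n] (fun s : ℝ => m (ζ + s • e)) s = (diffOp (h • e))^[n] m (ζ + s • e) := by
  induction n generalizing m with
  | zero => rfl
  | succ n ih =>
    rw [Function.iterate_succ_apply, Function.iterate_succ_apply, ← ih (diffOp (h • e) m)]
    refine congrFun (congrArg _ (funext fun s => ?_)) s
    simp only [diffOp, sub_smul, add_sub_assoc]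

lemma iterate_diffOp_sub_const (m : E → ℂ) (c : ℂ) (v : E) {n : ℕ} (hn : 0 < n) :
    (diffOp v)^[n] (fun ξ => m ξ - c) = (diffOp v)^[n] m := by
  obtain ⟨k, rfl⟩ : ∃ k, n = k + 1 := ⟨n - 1, by omega⟩
  rw [Function.iterate_succ_apply, Function.iterate_succ_apply]
  congr 1
  funext ξ
  simp [diffOp]

lemma norm_iterate_diffOp_le_sup (g : E → ℂ) (v : E) {B : ℝ} (n : ℕ) (ξ : E)
    (h : ∀ x, ‖x‖ ≤ ‖ξ‖ + n * ‖v‖ → ‖g x‖ ≤ B) : ‖(diffOp v)^[n] g ξ‖ ≤ 2 ^ n * B := by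
  induction n generalizing ξ with
  | zero => simpa using h ξ (by simp)
  | succ n ih =>
    rw [Function.iterate_succ_apply']
    have h1 := ih (ξ - v) fun x hx => h x (hx.trans (by
      have := norm_sub_le ξ v
      push_cast; linarith))
    have h2 := ih ξ fun x hx => h x (hx.trans (by
      have := norm_nonneg v
      push_cast; linarith))
    calc _ ≤ ‖(diffOp v)^[n] g (ξ - v)‖ + ‖(diffOp v)^[n] g ξ‖ := norm_sub_le _ _
      _ ≤ 2 ^ n * B + 2 ^ n * B := add_le_add h1 h2
      _ = _ := by ring

/-- The line segment around `0` on which `s ↦ ζ + s e_i` stays away from `0`. -/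
def halfBall (ζ : E) : Set ℝ := Ioo (-(‖ζ‖ / 2)) (‖ζ‖ / 2)

lemma zero_mem_halfBall {ζ : E} (hζ : ζ ≠ 0) : (0 : ℝ) ∈ halfBall ζ := by
  have := norm_pos_iff.2 hζ
  constructor <;> linarith

lemma norm_add_smul_single_bounds (ζ : E) (i : Fin d) {s : ℝ} (hs : s ∈ halfBall ζ) :
    ‖ζ‖ / 2 ≤ ‖ζ + s • EuclideanSpace.single i (1 : ℝ)‖ := by
  have h1 : ‖s • EuclideanSpace.single i (1 : ℝ)‖ ≤ ‖ζ‖ / 2 := by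
    rw [norm_smul, PiLp.norm_single, norm_one, mul_one, Real.norm_eq_abs]
    exact (abs_lt.2 hs).le
  have h2 := norm_sub_le (ζ + s • EuclideanSpace.single i (1 : ℝ))
    (s • EuclideanSpace.single i (1 : ℝ))
  rw [add_sub_cancel_right] at h2
  linarith

/-- Differences of a symbol which is Hölder continuous at the origin. -/
lemma norm_iterate_diffOp_symbol_le {n : ℕ} (hn : 0 < n) {ε : ℝ} (hε : 0 < ε) (hεn : ε < n)
    {A : ℝ} (hA : 0 ≤ A) {m : E → ℂ} {c : ℂ} (h0 : ∀ ξ, ‖m ξ - c‖ ≤ A * ‖ξ‖ ^ ε)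
    (h1 : ∀ (i : Fin d) (ζ : E), ζ ≠ 0 → SymbolBound n ‖ζ‖ (A * ‖ζ‖ ^ ε) (halfBall ζ)
      (fun s => m (ζ + s • EuclideanSpace.single i (1 : ℝ)) - c))
    {h : ℝ} (hh : 0 < h) (i : Fin d) (ξ : E) :
    ‖(diffOp (h • EuclideanSpace.single i (1 : ℝ)))^[n] m ξ‖ ≤
      ((2 ^ ((n : ℝ) - ε) + 2 ^ n * (3 * n) ^ ε * (1 + 2 * n) ^ ((n : ℝ) - ε)) * A) *
        h ^ ε * (1 + ‖ξ‖ / h) ^ (-((n : ℝ) - ε)) := by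
  set e : E := EuclideanSpace.single i (1 : ℝ) with he
  have hne : ‖e‖ = 1 := by rw [he, PiLp.norm_single, norm_one]
  have hn1 : (1 : ℝ) ≤ n := by exact_mod_cast hn
  set y : ℝ := ‖ξ‖ / h with hy
  have hy0 : 0 ≤ y := by positivity
  have hξ : ‖ξ‖ = y * h := by rw [hy]; field_simp
  set q : ℝ := (n : ℝ) - ε with hq
  have hq0 : 0 < q := by linarith
  -- At least one difference is taken, so subtracting the constant `c` changes nothing.
  rw [← iterate_diffOp_sub_const m c _ hn]
  have hpos : 0 ≤ A * h ^ ε := by positivity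
  have hy1 : 0 < (1 + y) ^ (-q) := by positivity
  -- If `‖ξ‖ > 2nh`, the points of the difference stay in the half ball of `ξ`, and `n` derivatives
  -- give `A ‖ξ‖^ε (h/‖ξ‖)^n`. Otherwise all points have norm at most `3nh`, and the Hölder bound at
  -- the origin suffices.
  rcases lt_or_ge (2 * (n : ℝ)) y with hlt | hge
  · have hypos : 0 < y := by linarith
    have hξ0 : ξ ≠ 0 := by
      rw [← norm_pos_iff, hξ]; positivity
    have h2 := (h1 i ξ hξ0).norm_iterate_diffOp_le (norm_pos_iff.2 hξ0) (convex_Ioo _ _) hh.le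
      (zero_mem_halfBall hξ0) (by
        constructor
        · rw [hξ]; nlinarith
        · rw [hξ]
          have : 0 < (n : ℝ) * h := by positivity
          have : 0 < y * h := by positivity
          linarith)
    rw [iterate_diffOp_line (fun ξ => m ξ - c) ξ e h n 0, zero_smul, add_zero] at h2
    refine h2.trans ?_
    have e1 : A * ‖ξ‖ ^ ε * (h / ‖ξ‖) ^ n = A * h ^ ε * y ^ (-q) := by
      have : h / ‖ξ‖ = y⁻¹ := by rw [hy]; field_simp
      rw [this, hξ, Real.mul_rpow hy0 hh.le, hq, neg_sub, Real.rpow_sub hypos, Real.rpow_natCast,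
        inv_pow]
      ring
    have e2 : y ^ (-q) ≤ 2 ^ q * (1 + y) ^ (-q) := by
      have h3 : y ^ (-q) ≤ ((1 + y) / 2) ^ (-q) :=
        Real.rpow_le_rpow_of_nonpos (by positivity) (by linarith) (by linarith)
      refine h3.trans_eq ?_
      rw [Real.div_rpow (by positivity) (by norm_num), Real.rpow_neg (by norm_num : (0:ℝ) ≤ 2)]
      field_simp
    rw [e1]
    calc A * h ^ ε * y ^ (-q) ≤ A * h ^ ε * (2 ^ q * (1 + y) ^ (-q)) := by gcongr
      _ = 2 ^ q * A * h ^ ε * (1 + y) ^ (-q) := by ring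
      _ ≤ _ := by
        gcongr
        exact le_add_of_nonneg_right (by positivity)
  · have h2 := norm_iterate_diffOp_le_sup (fun ξ => m ξ - c) (h • e) (B := A * (3 * n * h) ^ ε)
      n ξ (fun x hx => by
        refine (h0 x).trans ?_
        gcongr
        refine hx.trans ?_
        rw [norm_smul, hne, mul_one, Real.norm_eq_abs, abs_of_pos hh, hξ]
        nlinarith)
    refine h2.trans ?_
    have e1 : 1 ≤ (1 + 2 * (n : ℝ)) ^ q * (1 + y) ^ (-q) := by
      rw [Real.rpow_neg (by positivity), ← div_eq_mul_inv, one_le_div (by positivity)]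
      gcongr
    calc 2 ^ n * (A * (3 * n * h) ^ ε) = 2 ^ n * (3 * n) ^ ε * A * h ^ ε * 1 := by
          rw [Real.mul_rpow (by positivity) hh.le]; ring
      _ ≤ 2 ^ n * (3 * n) ^ ε * A * h ^ ε * ((1 + 2 * (n : ℝ)) ^ q * (1 + y) ^ (-q)) := by gcongr
      _ = 2 ^ n * (3 * n) ^ ε * (1 + 2 * n) ^ q * A * h ^ ε * (1 + y) ^ (-q) := by ring
      _ ≤ _ := by
        gcongr
        exact le_add_of_nonneg_left (by positivity)

/-- The multiplier theorem for `L_1`. -/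
lemma exists_lintegral_fourierInv_symbol_le (hd : 0 < d) {ε : ℝ} (hε : 0 < ε) (hε' : ε < 1 / 2) :
    ∃ C : ℝ≥0∞, C ≠ ⊤ ∧ ∀ (A R : ℝ) (m : E → ℂ) (c : ℂ), 0 ≤ A → 0 < R →
      Integrable m → MemLp m 2 volume → (∀ ξ, ‖m ξ - c‖ ≤ A * ‖ξ‖ ^ ε) →
      (∀ (i : Fin d) (ζ : E), ζ ≠ 0 → SymbolBound (d / 2 + 1) ‖ζ‖ (A * ‖ζ‖ ^ ε) (halfBall ζ)
        (fun s => m (ζ + s • EuclideanSpace.single i (1 : ℝ)) - c)) →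
      ∫⁻ x, ‖𝓕⁻ m x‖ₑ ≤ C * (ENNReal.ofReal (R ^ ((d : ℝ) / 2)) * eLpNorm m 2 volume +
        ENNReal.ofReal (A * R ^ (-ε))) := by
  set n := d / 2 + 1 with hn
  have hn2 : (d : ℝ) + 1 ≤ 2 * n := by
    have : d + 1 ≤ 2 * n := by omega
    exact_mod_cast this
  have hn1 : (1 : ℝ) ≤ n := by
    have : 1 ≤ n := by omega
    exact_mod_cast this
  -- Square integrability requires `n - ε > d/2`, which holds because `n ≥ (d+1)/2` and `ε < 1/2`.
  obtain ⟨C, hC, H⟩ := exists_lintegral_fourierInv_le hd n hε (ρ := (n : ℝ) - ε) (by linarith)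
  set K : ℝ := 2 ^ ((n : ℝ) - ε) + 2 ^ n * (3 * n) ^ ε * (1 + 2 * n) ^ ((n : ℝ) - ε) with hK
  have hK0 : 0 ≤ K := by positivity
  refine ⟨C * (1 + ENNReal.ofReal K), ENNReal.mul_ne_top hC (by simp), ?_⟩
  intro A R m c hA hR h1 h2 h3 h4
  refine (H (K * A) R m (by positivity) hR h1 h2 fun h hh i ξ =>
    norm_iterate_diffOp_symbol_le (by omega) hε (by linarith) hA h3 h4 hh i ξ).trans ?_
  rw [mul_assoc C, mul_assoc K, ENNReal.ofReal_mul hK0, mul_add (1 + ENNReal.ofReal K)]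
  refine mul_le_mul_right (add_le_add ?_ (mul_le_mul_left ?_ _)) _
  · exact le_mul_of_one_le_left bot_le le_self_add
  · exact le_add_self

end Symbol

/-! ### Elementary estimates for exponentials. -/

section Estimates

lemma norm_exp_sub_one_le_of_re_nonpos {z : ℂ} (hz : z.re ≤ 0) : ‖Complex.exp z - 1‖ ≤ ‖z‖ := by
  have h := (convex_halfSpace_re_le 0).norm_image_sub_le_of_norm_hasDerivWithin_le
    (f := Complex.exp) (f' := Complex.exp) (C := 1) (x := 0) (y := z)
    (fun w _ => (Complex.hasDerivAt_exp w).hasDerivWithinAt)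
    (fun w hw => by
      rw [Complex.norm_exp]
      exact Real.exp_le_one_iff.2 hw) (by simp) hz
  simpa using h

lemma norm_exp_le_one_of_re_nonpos {z : ℂ} (hz : z.re ≤ 0) : ‖Complex.exp z‖ ≤ 1 := by
  rw [Complex.norm_exp]
  exact Real.exp_le_one_iff.2 hz

/-- A bound that is linear for small `x` and constant for large `x` interpolates to any power `x^θ`
with `0 < θ ≤ 1`. -/
lemma le_rpow_of_bounds {x θ a b v : ℝ} (hx : 0 ≤ x) (hθ : 0 < θ) (hθ1 : θ ≤ 1) (ha : 0 ≤ a)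
    (hb : 0 ≤ b) (h1 : x ≤ 1 → v ≤ a * x) (h2 : 1 ≤ x → v ≤ b) : v ≤ (a + b) * x ^ θ := by
  rcases le_total x 1 with h | h
  · have h3 : x ≤ x ^ θ := by
      simpa using Real.rpow_le_rpow_of_exponent_ge' hx h hθ.le hθ1
    have h4 : 0 ≤ x ^ θ := by positivity
    nlinarith [h1 h]
  · have h3 : 1 ≤ x ^ θ := Real.one_le_rpow h hθ.le
    nlinarith [h2 h]

lemma pow_mul_exp_neg_le {b x : ℝ} (hb : 0 < b) (hx : 0 ≤ x) (k : ℕ) :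
    x ^ k * Real.exp (-(b * x)) ≤ k.factorial / b ^ k := by
  have h := Real.pow_div_factorial_le_exp (b * x) (by positivity) k
  rw [div_le_iff₀ (by positivity)] at h
  rw [Real.exp_neg, ← div_eq_mul_inv, div_le_div_iff₀ (Real.exp_pos _) (by positivity)]
  rw [mul_pow] at h
  linarith

lemma exists_exp_neg_rpow_le {κ γ : ℝ} (hκ : 0 < κ) (hγ : 0 < γ) (N : ℕ) : ∃ C : ℝ, 0 ≤ C ∧
    ∀ y : ℝ, 0 ≤ y → Real.exp (-(κ * y ^ γ)) ≤ C * (1 + y) ^ (-(N : ℝ)) := by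
  -- With `z = y^γ`, `1 + y` is at most `2(1+z)^{1/γ}`, so `k` powers of `1 + z` dominate `(1 +
  -- y)^N` up to `2^N`. The factor `e^κ` below pays for passing from `z` to `1 + z`.
  set k := ⌈(N : ℝ) / γ⌉₊ with hk
  refine ⟨2 ^ N * (k.factorial / κ ^ k * Real.exp κ), by positivity, fun y hy => ?_⟩
  set z := y ^ γ with hz
  have hz0 : 0 ≤ z := by positivity
  have h1 : 1 + y ≤ 2 * (1 + z) ^ (1 / γ) := by
    have h2 : y ≤ (1 + z) ^ (1 / γ) := by
      calc y = z ^ (1 / γ) := by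
            rw [hz, ← Real.rpow_mul hy, mul_one_div_cancel hγ.ne', Real.rpow_one]
        _ ≤ _ := Real.rpow_le_rpow hz0 (by linarith) (by positivity)
    have h3 : 1 ≤ (1 + z) ^ (1 / γ) := Real.one_le_rpow (by linarith) (by positivity)
    linarith
  have h2 : (1 + y) ^ N ≤ 2 ^ N * (1 + z) ^ k := by
    calc (1 + y) ^ N ≤ (2 * (1 + z) ^ (1 / γ)) ^ N := by gcongr
      _ = 2 ^ N * (1 + z) ^ ((N : ℝ) / γ) := by
        rw [mul_pow, ← Real.rpow_natCast ((1 + z) ^ (1 / γ)), ← Real.rpow_mul (by positivity)]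
        congr 2
        ring
      _ ≤ 2 ^ N * (1 + z) ^ (k : ℝ) := by
        gcongr
        · linarith
        · exact Nat.le_ceil _
      _ = _ := by rw [Real.rpow_natCast]
  have h3 := pow_mul_exp_neg_le hκ (x := 1 + z) (by positivity) k
  have h4 : Real.exp (-(κ * (1 + z))) = Real.exp (-(κ * z)) * (Real.exp κ)⁻¹ := by
    rw [← Real.exp_neg, ← Real.exp_add]; congr 1; ring
  rw [h4] at h3
  rw [Real.rpow_neg (by positivity), Real.rpow_natCast, ← div_eq_mul_inv,
    le_div_iff₀ (by positivity)]
  calc Real.exp (-(κ * z)) * (1 + y) ^ N ≤ Real.exp (-(κ * z)) * (2 ^ N * (1 + z) ^ k) := by gcongr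
    _ = 2 ^ N * ((1 + z) ^ k * (Real.exp (-(κ * z)) * (Real.exp κ)⁻¹) * Real.exp κ) := by
      field_simp
    _ ≤ _ := by gcongr

end Estimates

/-! ### Normalized elliptic symbols and the `L¹` bound for the fundamental solution. -/

/-- Symbols jointly measurable, elliptic and regular, with the frequency scale of `𝓕`. -/
structure SymbolHyp (γ κ M : ℝ) (χ : ℝ → E → ℂ) : Prop where
  γ_pos : 0 < γ
  κ_pos : 0 < κ
  M_nonneg : 0 ≤ M
  measurable : Measurable (Function.uncurry χ)
  zero : ∀ r, χ r 0 = 0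
  re_le : ∀ r η, (χ r η).re ≤ -(κ * ‖η‖ ^ γ)
  line : ∀ r (i : Fin d) (ζ : E), ζ ≠ 0 → SymbolBound (d / 2 + 1) ‖ζ‖ (M * ‖ζ‖ ^ γ) (halfBall ζ)
    (fun s => χ r (ζ + s • EuclideanSpace.single i (1 : ℝ)))

/-- The exponential `exp ∫_s^t χ(r, η) dr`. -/
def phase (χ : ℝ → E → ℂ) (t s : ℝ) (η : E) : ℂ := Complex.exp (∫ r in s..t, χ r η)

namespace SymbolHyp

variable {γ κ M : ℝ} {χ : ℝ → EuclideanSpace ℝ (Fin d) → ℂ}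

lemma measurable_left (hχ : SymbolHyp γ κ M χ) (η : E) : Measurable (fun r => χ r η) :=
  hχ.measurable.comp (measurable_id.prodMk measurable_const)

lemma measurable_right (hχ : SymbolHyp γ κ M χ) (r : ℝ) : Measurable (χ r) :=
  hχ.measurable.comp (measurable_const.prodMk measurable_id)

lemma norm_le (hd : 0 < d) (hχ : SymbolHyp γ κ M χ) (r : ℝ) (η : E) :
    ‖χ r η‖ ≤ M * ‖η‖ ^ γ := by
  by_cases h : η = 0
  · rw [h, hχ.zero, norm_zero, norm_zero, Real.zero_rpow hχ.γ_pos.ne', mul_zero]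
  · simpa using (hχ.line r ⟨0, hd⟩ η h).norm_le (zero_mem_halfBall h)

lemma intervalIntegrable (hd : 0 < d) (hχ : SymbolHyp γ κ M χ) (η : E) (s t : ℝ) :
    IntervalIntegrable (fun r => χ r η) volume s t :=
  (intervalIntegrable_const (c := M * ‖η‖ ^ γ)).mono_fun
    (hχ.measurable_left η).aestronglyMeasurable (Filter.Eventually.of_forall fun r =>
      (hχ.norm_le hd r η).trans (le_abs_self _))

lemma norm_integral_le (hd : 0 < d) (hχ : SymbolHyp γ κ M χ) (η : E) (s t : ℝ) :
    ‖∫ r in s..t, χ r η‖ ≤ M * ‖η‖ ^ γ * |t - s| :=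
  intervalIntegral.norm_integral_le_of_norm_le_const fun r _ => hχ.norm_le hd r η

lemma re_integral_le (hd : 0 < d) (hχ : SymbolHyp γ κ M χ) (η : E) {s t : ℝ} (hst : s ≤ t) :
    (∫ r in s..t, χ r η).re ≤ -(κ * (t - s) * ‖η‖ ^ γ) := by
  have h1 : (∫ r in s..t, χ r η).re = ∫ r in s..t, (χ r η).re :=
    (Complex.reCLM.intervalIntegral_comp_comm (hχ.intervalIntegrable hd η s t)).symm
  have h2 : IntervalIntegrable (fun r => (χ r η).re) volume s t :=
    ⟨(hχ.intervalIntegrable hd η s t).1.re, (hχ.intervalIntegrable hd η s t).2.re⟩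
  have h3 := intervalIntegral.integral_mono_on hst h2 (intervalIntegrable_const (c := -(κ * ‖η‖ ^ γ)))
    fun r _ => hχ.re_le r η
  rw [h1]
  refine h3.trans_eq ?_
  rw [intervalIntegral.integral_const, smul_eq_mul]; ring

lemma re_integral_nonpos (hd : 0 < d) (hχ : SymbolHyp γ κ M χ) (η : E) {s t : ℝ} (hst : s ≤ t) :
    (∫ r in s..t, χ r η).re ≤ 0 := by
  refine (hχ.re_integral_le hd η hst).trans ?_
  have := hχ.κ_pos
  have : 0 ≤ t - s := by linarith
  have : 0 ≤ κ * (t - s) * ‖η‖ ^ γ := by positivity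
  linarith

/-- With its two endpoints as parameters, the interval integral is a difference of integrals over
the whole line of jointly measurable indicator functions. -/
lemma measurable_integral (hχ : SymbolHyp γ κ M χ) :
    Measurable (fun q : (ℝ × ℝ) × E => ∫ r in q.1.2..q.1.1, χ r q.2) := by
  have key : ∀ a b : (ℝ × ℝ) × E → ℝ, Measurable a → Measurable b →
      Measurable (fun q : (ℝ × ℝ) × E => ∫ r in Ioc (a q) (b q), χ r q.2) := by
    intro a b ha hb
    have h1 : (fun q : (ℝ × ℝ) × E => ∫ r in Ioc (a q) (b q), χ r q.2) =
        fun q => ∫ r, ({z : ((ℝ × ℝ) × E) × ℝ | a z.1 < z.2 ∧ z.2 ≤ b z.1}.indicator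
          (fun z => χ z.2 z.1.2)) (q, r) := by
      funext q
      rw [← integral_indicator measurableSet_Ioc]
      rfl
    rw [h1]
    refine (StronglyMeasurable.integral_prod_right (Measurable.stronglyMeasurable ?_)).measurable
    refine Measurable.indicator (hχ.measurable.comp
      (measurable_snd.prodMk (measurable_snd.comp measurable_fst))) ?_
    exact (measurableSet_lt (ha.comp measurable_fst) measurable_snd).inter
      (measurableSet_le measurable_snd (hb.comp measurable_fst))
  simp only [intervalIntegral]
  exact (key _ _ (measurable_snd.comp measurable_fst) (measurable_fst.comp measurable_fst)).sub
    (key _ _ (measurable_fst.comp measurable_fst) (measurable_snd.comp measurable_fst))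

lemma measurable_phase (hχ : SymbolHyp γ κ M χ) :
    Measurable (fun q : (ℝ × ℝ) × E => phase χ q.1.1 q.1.2 q.2) :=
  Complex.measurable_exp.comp hχ.measurable_integral

lemma measurable_phase_right (hχ : SymbolHyp γ κ M χ) (t s : ℝ) : Measurable (phase χ t s) :=
  hχ.measurable_phase.comp
    ((measurable_const (a := (t, s))).prodMk measurable_id : Measurable fun η : E => ((t, s), η))

lemma norm_phase_le (hd : 0 < d) (hχ : SymbolHyp γ κ M χ) {s t : ℝ} (hst : s ≤ t) (η : E) :
    ‖phase χ t s η‖ ≤ Real.exp (-(κ * (t - s) * ‖η‖ ^ γ)) := by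
  rw [phase, Complex.norm_exp]
  exact Real.exp_le_exp.2 (hχ.re_integral_le hd η hst)

lemma norm_phase_le_one (hd : 0 < d) (hχ : SymbolHyp γ κ M χ) {s t : ℝ} (hst : s ≤ t) (η : E) :
    ‖phase χ t s η‖ ≤ 1 :=
  norm_exp_le_one_of_re_nonpos (hχ.re_integral_nonpos hd η hst)

lemma integrable_memLp_phase (hd : 0 < d) (hχ : SymbolHyp γ κ M χ) {s t : ℝ} (hst : s < t) :
    Integrable (phase χ t s) ∧ MemLp (phase χ t s) 2 volume := by
  obtain ⟨C, -, hC⟩ := exists_exp_neg_rpow_le (κ := κ * (t - s)) (mul_pos hχ.κ_pos (by linarith))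
    hχ.γ_pos (d + 1)
  refine integrable_memLp_of_norm_le (hχ.measurable_phase_right t s).aestronglyMeasurable
    (ρ := ((d + 1 : ℕ) : ℝ)) (C := C) (by push_cast; linarith) fun ξ => ?_
  exact (hχ.norm_phase_le hd hst.le ξ).trans (hC _ (norm_nonneg _))

end SymbolHyp

namespace SymbolHyp

variable {γ κ M : ℝ} {χ : ℝ → EuclideanSpace ℝ (Fin d) → ℂ}

lemma symbolBound_integral (hχ : SymbolHyp γ κ M χ) {s t : ℝ} (hst : s ≤ t)
    (i : Fin d) {ζ : E} (hζ : ζ ≠ 0) :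
    SymbolBound (d / 2 + 1) ‖ζ‖ (M * ((t - s) * ‖ζ‖ ^ γ)) (halfBall ζ)
      (fun σ => ∫ r in s..t, χ r (ζ + σ • EuclideanSpace.single i (1 : ℝ))) := by
  have h := SymbolBound.integral (μ := volume.restrict (Ioc s t)) (J := halfBall ζ)
    (G := fun r σ => χ r (ζ + σ • EuclideanSpace.single i (1 : ℝ))) isOpen_Ioo
    (fun σ _ => (hχ.measurable_left _).aestronglyMeasurable) (fun r => hχ.line r i ζ hζ)
  simp only [intervalIntegral.integral_of_le hst]
  refine h.mono (norm_pos_iff.2 hζ) (le_of_eq ?_) le_rfl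
  simp only [Measure.real, Measure.restrict_apply_univ, Real.volume_Ioc]
  rw [ENNReal.toReal_ofReal (by linarith)]
  ring

/-- Here `x` stands for `(t-s)‖ζ‖^γ`. The first estimate serves the value of the phase minus one,
the second its derivatives. The factor `(2⁻¹)^γ` reflects that on the half ball of `ζ` frequencies
may be as small as `‖ζ‖/2`. -/
lemma exists_exp_sub_one_bound (hκ : 0 < κ) (hM : 0 ≤ M) (n : ℕ) {θ : ℝ}
    (hθ : 0 < θ) (hθ1 : θ ≤ 1) : ∃ C : ℝ, 0 ≤ C ∧ ∀ x : ℝ, 0 ≤ x →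
      min 2 (M * x) ≤ C * x ^ θ ∧
      2 ^ n * (M * x) * (1 + 2 ^ n * (M * x)) ^ n * Real.exp (-(κ * x * (2⁻¹) ^ γ)) ≤
        C * x ^ θ := by
  set b : ℝ := κ * (2⁻¹) ^ γ with hb
  have hb0 : 0 < b := by positivity
  set a₁ : ℝ := 2 ^ n * M * (1 + 2 ^ n * M) ^ n with ha1
  -- `a₁` serves `x ≤ 1`, where the exponential is at most one. `a₂` serves `x ≥ 1`, where the
  -- polynomial is at most a multiple of `x^{n+1}` and the exponential absorbs it.
  set a₂ : ℝ := 2 ^ n * M * (1 + 2 ^ n * M) ^ n * ((n + 1).factorial / b ^ (n + 1)) with ha2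
  refine ⟨(M + 2) + (a₁ + a₂), by positivity, fun x hx => ⟨?_, ?_⟩⟩
  · refine (le_rpow_of_bounds hx hθ hθ1 hM zero_le_two (fun _ => min_le_right _ _)
      (fun _ => min_le_left _ _)).trans ?_
    exact mul_le_mul_of_nonneg_right (le_add_of_nonneg_right (by positivity)) (by positivity)
  · refine (le_rpow_of_bounds (a := a₁) (b := a₂) hx hθ hθ1 (by positivity) (by positivity)
      (fun h => ?_) fun h => ?_).trans ?_
    · have h1 : Real.exp (-(κ * x * (2⁻¹) ^ γ)) ≤ 1 :=
        Real.exp_le_one_iff.2 (neg_nonpos.2 (by positivity))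
      calc _ ≤ 2 ^ n * (M * x) * (1 + 2 ^ n * (M * 1)) ^ n * 1 := by gcongr
        _ = a₁ * x := by rw [ha1]; ring
    · have h1 := pow_mul_exp_neg_le hb0 hx (n + 1)
      calc 2 ^ n * (M * x) * (1 + 2 ^ n * (M * x)) ^ n * Real.exp (-(κ * x * (2⁻¹) ^ γ))
          ≤ 2 ^ n * (M * x) * (x + 2 ^ n * (M * x)) ^ n * Real.exp (-(κ * x * (2⁻¹) ^ γ)) := by
            gcongr
        _ = 2 ^ n * M * (1 + 2 ^ n * M) ^ n * (x ^ (n + 1) * Real.exp (-(b * x))) := by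
            rw [show x + 2 ^ n * (M * x) = (1 + 2 ^ n * M) * x by ring, mul_pow, pow_succ x, hb,
              show κ * x * (2⁻¹) ^ γ = κ * (2⁻¹) ^ γ * x by ring]
            ring
        _ ≤ _ := mul_le_mul_of_nonneg_left h1 (by positivity)
    · exact mul_le_mul_of_nonneg_right (le_add_of_nonneg_left (by positivity)) (by positivity)

/-- The phases are symbols. -/
lemma exists_phase_symbol (hd : 0 < d) (hγ : 0 < γ) (hκ : 0 < κ) (hM : 0 ≤ M) {ε : ℝ}
    (hε : 0 < ε) (hεγ : ε ≤ γ) : ∃ C : ℝ, 0 ≤ C ∧ ∀ χ : ℝ → E → ℂ, SymbolHyp γ κ M χ →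
      ∀ s t : ℝ, s < t → (∀ ξ, ‖phase χ t s ξ - 1‖ ≤ C * (t - s) ^ (ε / γ) * ‖ξ‖ ^ ε) ∧
      ∀ (i : Fin d) (ζ : E), ζ ≠ 0 →
        SymbolBound (d / 2 + 1) ‖ζ‖ (C * (t - s) ^ (ε / γ) * ‖ζ‖ ^ ε) (halfBall ζ)
        (fun σ => phase χ t s (ζ + σ • EuclideanSpace.single i (1 : ℝ)) - 1) := by
  -- With exponent `ε/γ`, the power `((t-s)‖ξ‖^γ)^{ε/γ}` equals `(t-s)^{ε/γ} ‖ξ‖^ε`.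
  obtain ⟨C, hC, H⟩ := exists_exp_sub_one_bound hκ hM (d / 2 + 1) (θ := ε / γ) (by positivity)
    ((div_le_one hγ).2 hεγ)
  refine ⟨C, hC, fun χ hχ s t hst => ?_⟩
  have hτ : 0 < t - s := by linarith
  have hx : ∀ ξ : E, ((t - s) * ‖ξ‖ ^ γ) ^ (ε / γ) = (t - s) ^ (ε / γ) * ‖ξ‖ ^ ε := by
    intro ξ
    rw [Real.mul_rpow hτ.le (by positivity), ← Real.rpow_mul (norm_nonneg _),
      mul_div_cancel₀ _ hγ.ne']
  have key : ∀ (z : ℂ) (ξ : E), z.re ≤ 0 → ‖z‖ ≤ M * ((t - s) * ‖ξ‖ ^ γ) →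
      ‖Complex.exp z - 1‖ ≤ C * (t - s) ^ (ε / γ) * ‖ξ‖ ^ ε := by
    intro z ξ hz hz'
    rw [mul_assoc, ← hx]
    refine le_trans (le_min ?_ ?_) (H _ (by positivity)).1
    · refine (norm_sub_le _ _).trans ?_
      rw [norm_one]
      linarith [norm_exp_le_one_of_re_nonpos hz]
    · exact (norm_exp_sub_one_le_of_re_nonpos hz).trans hz'
  refine ⟨fun ξ => key _ ξ (hχ.re_integral_nonpos hd ξ hst.le) ?_, fun i ζ hζ => ?_⟩
  · refine (hχ.norm_integral_le hd ξ s t).trans_eq ?_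
    rw [abs_of_pos hτ]; ring
  · have hζ' := norm_pos_iff.2 hζ
    have hL := hχ.symbolBound_integral hst.le i hζ
    refine SymbolBound.exp_sub_one (L := M * ((t - s) * ‖ζ‖ ^ γ))
      (E₀ := Real.exp (-(κ * ((t - s) * ‖ζ‖ ^ γ) * (2⁻¹) ^ γ))) hζ' (by positivity)
      (Real.exp_pos _).le hL (fun σ hσ => ?_) (fun σ hσ => ?_) ?_
    · refine (hχ.norm_phase_le hd hst.le _).trans (Real.exp_le_exp.2 (neg_le_neg ?_))
      have h1 := norm_add_smul_single_bounds ζ i hσ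
      calc κ * ((t - s) * ‖ζ‖ ^ γ) * (2⁻¹) ^ γ = κ * (t - s) * (‖ζ‖ / 2) ^ γ := by
            rw [div_eq_mul_inv, Real.mul_rpow hζ'.le (by norm_num)]; ring
        _ ≤ _ := by gcongr
    · exact key _ ζ (hχ.re_integral_nonpos hd _ hst.le) (hL.norm_le hσ)
    · rw [mul_assoc C, ← hx]
      exact (H _ (by positivity)).2

/-- The phase is dominated by `exp(-κ‖·‖^γ)` dilated by `(t-s)^{1/γ}`. The dilation changes the `L²`
norm by exactly the inverse of the prefactor. -/
lemma exists_eLpNorm_phase_le (hd : 0 < d) (hγ : 0 < γ) (hκ : 0 < κ) : ∃ C : ℝ≥0∞, C ≠ ⊤ ∧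
    ∀ χ : ℝ → E → ℂ, SymbolHyp γ κ M χ → ∀ s t : ℝ, s < t →
      ENNReal.ofReal (((t - s) ^ (1 / γ)) ^ ((d : ℝ) / 2)) * eLpNorm (phase χ t s) 2 volume ≤
        C := by
  set G : E → ℂ := fun η => (Real.exp (-(κ * ‖η‖ ^ γ)) : ℂ) with hG
  have hGn : ∀ η, ‖G η‖ = Real.exp (-(κ * ‖η‖ ^ γ)) := fun η => by
    rw [hG]
    simp only
    rw [Complex.norm_real, Real.norm_eq_abs, abs_of_pos (Real.exp_pos _)]
  have hG2 : MemLp G 2 volume := by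
    obtain ⟨C, -, hC⟩ := exists_exp_neg_rpow_le hκ hγ (d + 1)
    refine (integrable_memLp_of_norm_le (Continuous.aestronglyMeasurable ?_)
      (ρ := ((d + 1 : ℕ) : ℝ)) (C := C) (by push_cast; linarith) fun ξ => ?_).2
    · have : Continuous fun η : E => ‖η‖ ^ γ :=
        continuous_norm.rpow_const fun _ => Or.inr hγ.le
      fun_prop
    · rw [hGn]; exact hC _ (norm_nonneg _)
  refine ⟨eLpNorm G 2 volume, hG2.2.ne, fun χ hχ s t hst => ?_⟩
  have hτ : 0 < t - s := by linarith
  set h : ℝ := ((t - s) ^ (1 / γ))⁻¹ with hh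
  have hh0 : 0 < h := by positivity
  have h1 : eLpNorm (phase χ t s) 2 volume ≤ eLpNorm (fun ξ => G (h⁻¹ • ξ)) 2 volume := by
    refine eLpNorm_mono fun ξ => (hχ.norm_phase_le hd hst.le ξ).trans_eq ?_
    rw [hGn, norm_smul, hh, inv_inv, Real.norm_eq_abs, abs_of_pos (by positivity),
      Real.mul_rpow (by positivity) (norm_nonneg _), ← Real.rpow_mul hτ.le,
      one_div_mul_cancel hγ.ne', Real.rpow_one, mul_assoc]
  calc _ ≤ ENNReal.ofReal (((t - s) ^ (1 / γ)) ^ ((d : ℝ) / 2)) *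
        eLpNorm (fun ξ => G (h⁻¹ • ξ)) 2 volume := by gcongr
    _ = _ := by
      rw [eLpNorm_two_comp_smul G hh0, finrank_euclideanSpace_fin, ← mul_assoc,
        ← ENNReal.ofReal_mul (by positivity), ← Real.mul_rpow (by positivity) hh0.le, hh,
        mul_inv_cancel₀ (by positivity), Real.one_rpow, ENNReal.ofReal_one, one_mul]

/-- The fundamental solutions are bounded in `L_1`. -/
lemma exists_lintegral_fourierInv_phase_le (hd : 0 < d) (hχ : SymbolHyp γ κ M χ) :
    ∃ C : ℝ≥0, ∀ s t : ℝ, s < t → ∫⁻ x, ‖𝓕⁻ (phase χ t s) x‖ₑ ≤ C := by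
  have hγ := hχ.γ_pos
  -- The Hölder exponent must not exceed `γ`, the order of `χ` at the origin, and must stay below
  -- `1/2` for the `L¹` criterion.
  have hε : 0 < min γ (1 / 4) := lt_min hγ (by norm_num)
  obtain ⟨C₁, hC₁, H₁⟩ := exists_lintegral_fourierInv_symbol_le hd hε
    ((min_le_right γ (1 / 4)).trans_lt (by norm_num))
  obtain ⟨C₂, hC₂, H₂⟩ := exists_phase_symbol hd hγ hχ.κ_pos hχ.M_nonneg hε (min_le_left _ _)
  obtain ⟨C₃, hC₃, H₃⟩ := exists_eLpNorm_phase_le (M := M) hd hγ hχ.κ_pos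
  have hfin : C₁ * (C₃ + ENNReal.ofReal C₂) ≠ ⊤ :=
    ENNReal.mul_ne_top hC₁ (ENNReal.add_ne_top.2 ⟨hC₃, ENNReal.ofReal_ne_top⟩)
  refine ⟨(C₁ * (C₃ + ENNReal.ofReal C₂)).toNNReal, fun s t hst => ?_⟩
  rw [ENNReal.coe_toNNReal hfin]
  have hτ : 0 < t - s := by linarith
  obtain ⟨i1, i2⟩ := hχ.integrable_memLp_phase hd hst
  obtain ⟨h1, h2⟩ := H₂ χ hχ s t hst
  -- The splitting radius `(t-s)^{1/γ}` is the natural parabolic scale: both terms become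
  -- independent of `t - s`.
  refine (H₁ _ ((t - s) ^ (1 / γ)) _ 1 (by positivity) (by positivity) i1 i2 h1 h2).trans ?_
  gcongr
  · exact H₃ χ hχ s t hst
  · rw [← Real.rpow_mul hτ.le, mul_assoc, ← Real.rpow_add hτ,
      show min γ (1 / 4) / γ + 1 / γ * -min γ (1 / 4) = 0 by ring, Real.rpow_zero, mul_one]

/-! ### The operator with symbol `χ`, made bounded by the lifting weight. -/

/-- The number of derivatives that makes `χ` times the lifting weight integrable and regular. -/
def liftOrder (d : ℕ) (γ : ℝ) : ℕ := ⌈γ⌉₊ + (d / 2 + 1) + d + 1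

/-- The symbol `χ_r` composed with the inverse of the lifting operator. -/
def lifted (γ : ℝ) (χ : ℝ → E → ℂ) (r : ℝ) (η : E) : ℂ :=
  χ r η * liftWeight (liftOrder d γ) η

lemma le_liftOrder (d : ℕ) (γ : ℝ) :
    γ + ((d / 2 + 1 : ℕ) : ℝ) + d + 1 ≤ (liftOrder d γ : ℝ) := by
  have := Nat.le_ceil γ
  simp only [liftOrder]
  push_cast
  linarith

lemma norm_lifted_le (hd : 0 < d) (hχ : SymbolHyp γ κ M χ) (r : ℝ) (η : E) :
    ‖lifted γ χ r η‖ ≤ M * (2 * √d) ^ liftOrder d γ * (1 + ‖η‖) ^ (-((d : ℝ) + 1)) := by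
  set N := liftOrder d γ with hN
  have hN' := le_liftOrder d γ
  have h1 : (1 : ℝ) ≤ 1 + ‖η‖ := by linarith [norm_nonneg η]
  have hM := hχ.M_nonneg
  have hγ := hχ.γ_pos
  rw [lifted, norm_mul]
  calc ‖χ r η‖ * ‖liftWeight N η‖
      ≤ (M * (1 + ‖η‖) ^ γ) * ((2 * √d) ^ N * ((1 + ‖η‖) ^ N)⁻¹) := by
        refine mul_le_mul ((hχ.norm_le hd r η).trans ?_) (norm_liftWeight_le hd N η)
          (norm_nonneg _) (by positivity)
        gcongr
        linarith
    _ = M * (2 * √d) ^ N * (1 + ‖η‖) ^ (γ - N) := by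
        rw [Real.rpow_sub (by positivity), Real.rpow_natCast]; ring
    _ ≤ _ := by
        gcongr
        · have : (0 : ℝ) ≤ ((d / 2 + 1 : ℕ) : ℝ) := Nat.cast_nonneg _
          linarith

lemma measurable_lifted (hχ : SymbolHyp γ κ M χ) : Measurable (Function.uncurry (lifted γ χ)) :=
  hχ.measurable.mul ((continuous_liftWeight _).measurable.comp measurable_snd)

lemma integrable_memLp_lifted (hd : 0 < d) (hχ : SymbolHyp γ κ M χ) (r : ℝ) :
    Integrable (lifted γ χ r) ∧ MemLp (lifted γ χ r) 2 volume :=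
  integrable_memLp_of_norm_le
    (hχ.measurable_lifted.comp (measurable_const.prodMk measurable_id)).aestronglyMeasurable
    (ρ := (d : ℝ) + 1) (by linarith) (hχ.norm_lifted_le hd r)

lemma liftWeight_line (N : ℕ) (ζ : E) (i : Fin d) (σ : ℝ) :
    liftWeight N (ζ + σ • EuclideanSpace.single i (1 : ℝ)) =
      (∏ j ∈ Finset.univ.erase i, ((1 + Complex.I * (ζ j : ℝ)) ^ N)⁻¹) *
        ((1 + Complex.I * (ζ i + σ : ℝ)) ^ N)⁻¹ := by
  rw [liftWeight, ← Finset.prod_erase_mul _ _ (Finset.mem_univ i)]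
  congr 1
  · refine Finset.prod_congr rfl fun j hj => ?_
    simp [Finset.ne_of_mem_erase hj]
  · simp

/-- Along a coordinate line only one factor of the weight varies. Its derivatives are controlled at
unit scale, and the change to scale `‖ζ‖` costs `(1+‖ζ‖)^n`. -/
lemma exists_symbolBound_liftWeight (hd : 0 < d) (n N : ℕ) : ∃ C : ℝ, 0 ≤ C ∧
    ∀ (i : Fin d) (ζ : E), ζ ≠ 0 →
      SymbolBound n ‖ζ‖ (C * ((1 + ‖ζ‖) ^ N)⁻¹ * (1 + ‖ζ‖) ^ n) (halfBall ζ)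
      (fun σ => liftWeight N (ζ + σ • EuclideanSpace.single i (1 : ℝ))) := by
  obtain ⟨C, hC, H⟩ := SymbolBound.exists_inv_pow n N
  refine ⟨C * ((2 * √d) ^ N * 2 ^ N), by positivity, fun i ζ hζ => ?_⟩
  set c : ℂ := ∏ j ∈ Finset.univ.erase i, ((1 + Complex.I * (ζ j : ℝ)) ^ N)⁻¹ with hc
  have hc0 : c ≠ 0 := Finset.prod_ne_zero_iff.2 fun j _ =>
    inv_ne_zero (pow_ne_zero _ (one_add_I_mul_ne_zero _))
  have hcn := norm_pos_iff.2 hc0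
  -- The factor `2^N` appears because `1 + ‖ξ‖ ≥ (1 + ‖ζ‖)/2` on the half ball. Dividing by the norm
  -- of the constant factor `c` isolates the varying factor, and `c` is multiplied back at the end.
  set W : ℝ := (2 * √d) ^ N * 2 ^ N * ((1 + ‖ζ‖) ^ N)⁻¹ with hW
  have h1 : ∀ σ ∈ halfBall ζ, ‖((1 + Complex.I * (ζ i + σ : ℝ)) ^ N)⁻¹‖ ≤ W / ‖c‖ := by
    intro σ hσ
    rw [le_div_iff₀ hcn, mul_comm, ← norm_mul, hc, ← liftWeight_line]
    refine (norm_liftWeight_le hd N _).trans ?_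
    rw [hW, mul_assoc]
    gcongr
    rw [← inv_inv ((2 : ℝ) ^ N), ← mul_inv]
    refine inv_anti₀ (by positivity) ?_
    rw [← inv_pow, ← mul_pow]
    gcongr
    have := norm_add_smul_single_bounds ζ i hσ
    linarith
  have h2 := ((H (ζ i) (halfBall ζ) (W / ‖c‖) (by positivity) h1).of_one (norm_pos_iff.2 hζ)
    (by positivity)).const_mul c
  simp only [liftWeight_line, ← hc]
  refine h2.mono (norm_pos_iff.2 hζ) (le_of_eq ?_) le_rfl
  rw [hW]
  field_simp

/-- The `L¹` criterion with `c = 0` and `R = 1`. The lifting order leaves enough decay at infinity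
after `γ` powers from `χ` and `n` from the scale change, while `‖ζ‖^γ` gives the Hölder bound at the
origin. -/
lemma exists_lintegral_fourierInv_lifted_le (hd : 0 < d) (hχ : SymbolHyp γ κ M χ) :
    ∃ C : ℝ≥0, ∀ r : ℝ, ∫⁻ x, ‖𝓕⁻ (lifted γ χ r) x‖ₑ ≤ C := by
  have hγ := hχ.γ_pos
  have hM := hχ.M_nonneg
  set ε := min γ (1 / 4) with hεdef
  have hε : 0 < ε := lt_min hγ (by norm_num)
  set n := d / 2 + 1 with hn
  set N := liftOrder d γ with hN
  have hN' : γ + (n : ℝ) + d + 1 ≤ (N : ℝ) := le_liftOrder d γ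
  obtain ⟨C₁, hC₁, H₁⟩ := exists_lintegral_fourierInv_symbol_le hd hε
    ((min_le_right γ (1 / 4)).trans_lt (by norm_num))
  obtain ⟨C₂, hC₂, H₂⟩ := exists_symbolBound_liftWeight hd n N
  set B : E → ℝ := fun η => M * (2 * √d) ^ N * (1 + ‖η‖) ^ (-((d : ℝ) + 1)) with hB
  have hB2 : MemLp B 2 volume := by
    refine (memLp_two_one_add_norm (V := E) (ρ := (d : ℝ) + 1) ?_).const_mul _
    rw [finrank_euclideanSpace_fin]
    have : (0 : ℝ) ≤ d := Nat.cast_nonneg d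
    linarith
  set A : ℝ := 2 ^ n * (M * C₂) with hA
  have hfin : C₁ * (eLpNorm B 2 volume + ENNReal.ofReal A) ≠ ⊤ :=
    ENNReal.mul_ne_top hC₁ (ENNReal.add_ne_top.2 ⟨hB2.2.ne, ENNReal.ofReal_ne_top⟩)
  refine ⟨(C₁ * (eLpNorm B 2 volume + ENNReal.ofReal A)).toNNReal, fun r => ?_⟩
  rw [ENNReal.coe_toNNReal hfin]
  obtain ⟨i1, i2⟩ := hχ.integrable_memLp_lifted hd r
  have hS : ∀ (i : Fin d) (ζ : E), ζ ≠ 0 → SymbolBound n ‖ζ‖ (A * ‖ζ‖ ^ ε) (halfBall ζ)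
      (fun s => lifted γ χ r (ζ + s • EuclideanSpace.single i (1 : ℝ)) - 0) := by
    intro i ζ hζ
    have hζ' := norm_pos_iff.2 hζ
    simp only [sub_zero]
    refine (SymbolBound.mul hζ' (by positivity) (by positivity) (hχ.line r i ζ hζ)
      (H₂ i ζ hζ)).mono hζ' ?_ le_rfl
    have h1 : ‖ζ‖ ^ γ * (((1 + ‖ζ‖) ^ N)⁻¹ * (1 + ‖ζ‖) ^ n) ≤ ‖ζ‖ ^ ε := by
      calc _ = ‖ζ‖ ^ ε * ‖ζ‖ ^ (γ - ε) * (1 + ‖ζ‖) ^ ((n : ℝ) - N) := by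
            rw [← Real.rpow_add hζ', Real.rpow_sub (by positivity), Real.rpow_natCast,
              Real.rpow_natCast, add_sub_cancel]
            ring
        _ ≤ ‖ζ‖ ^ ε * (1 + ‖ζ‖) ^ (γ - ε) * (1 + ‖ζ‖) ^ ((n : ℝ) - N) := by
            gcongr
            · exact sub_nonneg.2 (min_le_left _ _)
            · linarith
        _ = ‖ζ‖ ^ ε * (1 + ‖ζ‖) ^ (γ - ε + ((n : ℝ) - N)) := by
            rw [mul_assoc, ← Real.rpow_add (by positivity)]
        _ ≤ ‖ζ‖ ^ ε * 1 := by
            gcongr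
            refine Real.rpow_le_one_of_one_le_of_nonpos (by linarith) ?_
            have : (0 : ℝ) ≤ d := Nat.cast_nonneg d
            linarith
        _ = _ := mul_one _
    calc _ = A * (‖ζ‖ ^ γ * (((1 + ‖ζ‖) ^ N)⁻¹ * (1 + ‖ζ‖) ^ n)) := by rw [hA]; ring
      _ ≤ _ := by gcongr
  have h0 : ∀ ξ, ‖lifted γ χ r ξ - 0‖ ≤ A * ‖ξ‖ ^ ε := by
    intro ξ
    by_cases hξ : ξ = 0
    · rw [hξ, lifted, hχ.zero]
      simp only [zero_mul, sub_zero, norm_zero]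
      positivity
    · simpa using (hS ⟨0, hd⟩ ξ hξ).norm_le (zero_mem_halfBall hξ)
  refine (H₁ A 1 _ 0 (by positivity) one_pos i1 i2 h0 hS).trans ?_
  rw [Real.one_rpow, Real.one_rpow, mul_one, ENNReal.ofReal_one, one_mul]
  gcongr
  exact eLpNorm_mono_real (hχ.norm_lifted_le hd r)

end SymbolHyp

/-! ### The fundamental theorem of calculus for absolutely continuous complex functions. -/

section AbsolutelyContinuous

lemma absolutelyContinuousOnInterval_comp_of_dist_le {X Y : Type*} [PseudoMetricSpace X]
    [PseudoMetricSpace Y] {f : ℝ → X} {φ : X → Y} {a b : ℝ}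
    (hf : AbsolutelyContinuousOnInterval f a b) (hφ : ∀ x y, dist (φ x) (φ y) ≤ dist x y) :
    AbsolutelyContinuousOnInterval (fun t => φ (f t)) a b := by
  rw [absolutelyContinuousOnInterval_iff] at hf ⊢
  intro ε hε
  obtain ⟨δ, hδ, H⟩ := hf ε hε
  exact ⟨δ, hδ, fun D h1 h2 => (Finset.sum_le_sum fun i _ => hφ _ _).trans_lt (H D h1 h2)⟩

lemma absolutelyContinuousOnInterval_re {f : ℝ → ℂ} {a b : ℝ}
    (hf : AbsolutelyContinuousOnInterval f a b) :
    AbsolutelyContinuousOnInterval (fun t => (f t).re) a b :=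
  absolutelyContinuousOnInterval_comp_of_dist_le hf fun x y => by
    rw [Real.dist_eq, dist_eq_norm, ← Complex.sub_re]
    exact Complex.abs_re_le_norm _

lemma absolutelyContinuousOnInterval_im {f : ℝ → ℂ} {a b : ℝ}
    (hf : AbsolutelyContinuousOnInterval f a b) :
    AbsolutelyContinuousOnInterval (fun t => (f t).im) a b :=
  absolutelyContinuousOnInterval_comp_of_dist_le hf fun x y => by
    rw [Real.dist_eq, dist_eq_norm, ← Complex.sub_im]
    exact Complex.abs_im_le_norm _

lemma integral_eq_sub_of_ae_hasDerivAt_real {f g : ℝ → ℝ} {a b : ℝ}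
    (hf : AbsolutelyContinuousOnInterval f a b)
    (h : ∀ᵐ t, t ∈ uIcc a b → HasDerivAt f (g t) t) :
    IntervalIntegrable g volume a b ∧ ∫ t in a..b, g t = f b - f a := by
  have h1 : ∀ᵐ t, t ∈ uIoc a b → deriv f t = g t := by
    filter_upwards [h] with t ht htm using (ht (uIoc_subset_uIcc htm)).deriv
  refine ⟨hf.intervalIntegrable_deriv.congr_ae ?_, ?_⟩
  · exact (ae_restrict_iff' measurableSet_uIoc).2 h1
  · rw [← hf.integral_deriv_eq_sub]
    exact (intervalIntegral.integral_congr_ae h1).symm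

/-- Real and imaginary parts are contractions, hence preserve absolute continuity, so the real
theorem applies to each. -/
lemma integral_eq_sub_of_ae_hasDerivAt {f g : ℝ → ℂ} {a b : ℝ}
    (hf : AbsolutelyContinuousOnInterval f a b)
    (h : ∀ᵐ t, t ∈ uIcc a b → HasDerivAt f (g t) t) :
    ∫ t in a..b, g t = f b - f a := by
  obtain ⟨i1, h1⟩ := integral_eq_sub_of_ae_hasDerivAt_real
    (absolutelyContinuousOnInterval_re hf) (g := fun t => (g t).re) (by
      filter_upwards [h] with t ht htm
      exact (Complex.reCLM.hasFDerivAt.comp_hasDerivAt t (ht htm)))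
  obtain ⟨i2, h2⟩ := integral_eq_sub_of_ae_hasDerivAt_real
    (absolutelyContinuousOnInterval_im hf) (g := fun t => (g t).im) (by
      filter_upwards [h] with t ht htm
      exact (Complex.imCLM.hasFDerivAt.comp_hasDerivAt t (ht htm)))
  have i1' : IntervalIntegrable (fun t => ((g t).re : ℂ)) volume a b := ⟨i1.1.ofReal, i1.2.ofReal⟩
  have i2' : IntervalIntegrable (fun t => ((g t).im : ℂ)) volume a b := ⟨i2.1.ofReal, i2.2.ofReal⟩
  have e : ∫ t in a..b, g t = ∫ t in a..b, ((g t).re : ℂ) + ((g t).im : ℂ) * Complex.I := by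
    simp only [Complex.re_add_im]
  rw [e, intervalIntegral.integral_add i1' (i2'.mul_const _),
    intervalIntegral.integral_mul_const, intervalIntegral.integral_ofReal,
    intervalIntegral.integral_ofReal, h1, h2]
  apply Complex.ext <;> simp

end AbsolutelyContinuous

lemma fourierInv_congr_ae {g h : E → ℂ} (hgh : g =ᵐ[volume] h) (x : E) : 𝓕⁻ g x = 𝓕⁻ h x := by
  rw [Real.fourierInv_eq, Real.fourierInv_eq]
  refine integral_congr_ae ?_
  filter_upwards [hgh] with ξ hξ
  rw [hξ]

lemma SmoothField.measurable_apply {Z : Type*} [MeasurableSpace Z] {p : ℝ} {F : Z → E → ℂ}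
    (hF : SmoothField p F) (x : E) : Measurable (fun z => F z x) :=
  hF.measurable.comp (measurable_id.prodMk measurable_const)

lemma SmoothField.integrable_apply (hd : 0 < d) {Z : Type*} [MeasurableSpace Z] {p : ℝ}
    (hp : 1 ≤ p) {F : Z → E → ℂ} (hF : SmoothField p F) (μ : Measure Z) [IsFiniteMeasure μ]
    (x : E) : Integrable (fun z => F z x) μ := by
  obtain ⟨C, -, hC⟩ := hF.exists_norm_le hd hp
  exact (integrable_const C).mono' (hF.measurable_apply x).aestronglyMeasurable
    (Filter.Eventually.of_forall fun z => hC z x)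

/-- Averages of smooth fields over a finite measure. -/
lemma SmoothField.integral (hd : 0 < d) {Z W : Type*} [MeasurableSpace Z] [MeasurableSpace W]
    {p : ℝ} (hp : 1 ≤ p) {μ : Measure Z} [IsFiniteMeasure μ] {H : W × Z → E → ℂ}
    (hH : SmoothField p H) : SmoothField p (fun w x => ∫ z, H (w, z) x ∂μ) := by
  have h := SmoothField.superposition hd hp (μ := μ) (K := fun (_ : W) (_ : Z) => (1 : ℂ))
    measurable_const (C := (μ univ).toNNReal) (fun w => by
      simp [ENNReal.coe_toNNReal (measure_ne_top μ univ)]) hH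
  simpa only [one_mul] using h

lemma shiftDeriv_comp_sub (g : E → ℂ) (i : Fin d) (y : E) :
    shiftDeriv i (fun x => g (x - y)) = fun x => shiftDeriv i g (x - y) := by
  have h := wordDeriv_comp_sub g y [i]
  funext x
  exact congrArg (fun c => g (x - y) + ((2 * Real.pi)⁻¹ : ℝ) * c) (congrFun h x)

lemma liftOp_comp_sub (g : E → ℂ) (N : ℕ) (y : E) :
    liftOp N (fun x => g (x - y)) = fun x => liftOp N g (x - y) := by
  have h1 : ∀ (i : Fin d) (N : ℕ) (g : E → ℂ),
      (shiftDeriv i)^[N] (fun x => g (x - y)) = fun x => (shiftDeriv i)^[N] g (x - y) := by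
    intro i N g
    induction N generalizing g with
    | zero => rfl
    | succ N ih => rw [Function.iterate_succ_apply, shiftDeriv_comp_sub, ih]; rfl
  unfold liftOp
  induction List.finRange d with
  | nil => rfl
  | cons i l ih => rw [List.foldr_cons, ih, h1]; rfl

lemma measurable_fourierInv_param {Z : Type*} [MeasurableSpace Z] {m : Z → E → ℂ}
    (hm : Measurable (Function.uncurry m)) : Measurable (fun q : Z × E => 𝓕⁻ (m q.1) q.2) := by
  simp only [Real.fourierInv_eq, Circle.smul_def, smul_eq_mul]
  refine (StronglyMeasurable.integral_prod_right (f := fun (q : Z × E) ξ =>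
    ((𝐞 (inner ℝ ξ q.2) : Circle) : ℂ) * m q.1 ξ) (Measurable.stronglyMeasurable ?_)).measurable
  refine Measurable.mul ?_ (hm.comp (measurable_fst.fst.prodMk measurable_snd))
  have h1 : Continuous fun t : ℝ => ((𝐞 t : Circle) : ℂ) :=
    continuous_subtype_val.comp Real.continuous_fourierChar
  exact h1.measurable.comp (measurable_snd.inner measurable_fst.snd)

lemma SmoothField.convolution (hd : 0 < d) {p : ℝ} (hp : 1 ≤ p) {W Z : Type*} [MeasurableSpace W]
    [MeasurableSpace Z] {k : W → E → ℂ} (hk : Measurable (Function.uncurry k)) {C : ℝ≥0}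
    (hC : ∀ w, ∫⁻ y, ‖k w y‖ₑ ≤ C) {φ : Z → W} (hφ : Measurable φ) {G : Z → E → ℂ}
    (hG : SmoothField p G) : SmoothField p (fun z x => ∫ y, k (φ z) y * G z (x - y)) :=
  SmoothField.superposition hd hp (K := fun z y => k (φ z) y)
    (hk.comp ((hφ.comp measurable_fst).prodMk measurable_snd)) (fun z => hC (φ z))
    (H := fun (q : Z × E) x => G q.1 (x - q.2)) hG.translate

/-! ### Propagators, Duhamel's integral and their action on smooth fields. -/

/-- The fundamental solution, with the frequency scale of `𝓕`. -/
def fundSol (χ : ℝ → E → ℂ) (w : ℝ × ℝ) (y : E) : ℂ :=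
  if 0 < w.2 ∧ w.2 < w.1 then 𝓕⁻ (phase χ w.1 w.2) y else 0

/-- The solution at time `t` of the homogeneous equation with datum `F s` at time `s`. -/
def evol (χ F : ℝ → E → ℂ) (w : ℝ × ℝ) (x : E) : ℂ := ∫ y, fundSol χ w y * F w.2 (x - y)

/-- Duhamel's integral. -/
def duhamel (T : ℝ) (χ F : ℝ → E → ℂ) (t : ℝ) (x : E) : ℂ := ∫ s in Ioo 0 T, evol χ F (t, s) x

/-- The multiplier `lifted γ χ r`. -/
def liftedConv (γ : ℝ) (χ : ℝ → E → ℂ) (r : ℝ) (g : E → ℂ) (x : E) : ℂ :=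
  ∫ y, 𝓕⁻ (SymbolHyp.lifted γ χ r) y * g (x - y)

namespace SymbolHyp

variable {γ κ M p : ℝ} {χ F : ℝ → EuclideanSpace ℝ (Fin d) → ℂ}

lemma measurable_fundSol (hχ : SymbolHyp γ κ M χ) : Measurable (Function.uncurry (fundSol χ)) := by
  refine Measurable.ite ?_ (measurable_fourierInv_param
    (m := fun (w : ℝ × ℝ) => phase χ w.1 w.2) hχ.measurable_phase) measurable_const
  exact (measurableSet_lt measurable_const measurable_fst.snd).inter
    (measurableSet_lt measurable_fst.snd measurable_fst.fst)

lemma exists_lintegral_fundSol_le (hd : 0 < d) (hχ : SymbolHyp γ κ M χ) :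
    ∃ C : ℝ≥0, ∀ w, ∫⁻ y, ‖fundSol χ w y‖ₑ ≤ C := by
  obtain ⟨C, hC⟩ := hχ.exists_lintegral_fourierInv_phase_le hd
  refine ⟨C, fun w => ?_⟩
  by_cases h : 0 < w.2 ∧ w.2 < w.1
  · simp only [fundSol, if_pos h]; exact hC _ _ h.2
  · simp [fundSol, if_neg h]

lemma integrable_fundSol (hd : 0 < d) (hχ : SymbolHyp γ κ M χ) (w : ℝ × ℝ) :
    Integrable (fundSol χ w) := by
  obtain ⟨C, hC⟩ := hχ.exists_lintegral_fundSol_le hd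
  exact ⟨(hχ.measurable_fundSol.comp measurable_prodMk_left).aestronglyMeasurable,
    (hC w).trans_lt ENNReal.coe_lt_top⟩

lemma smoothField_evol (hd : 0 < d) (hp : 1 ≤ p) (hχ : SymbolHyp γ κ M χ)
    (hF : SmoothField p F) : SmoothField p (evol χ F) := by
  obtain ⟨C, hC⟩ := hχ.exists_lintegral_fundSol_le hd
  exact SmoothField.superposition hd hp hχ.measurable_fundSol hC
    (H := fun (q : (ℝ × ℝ) × E) x => F q.1.2 (x - q.2))
    (hF.translate.comp (measurable_fst.snd.prodMk measurable_snd))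

lemma smoothField_duhamel (hd : 0 < d) (hp : 1 ≤ p) (hχ : SymbolHyp γ κ M χ)
    (hF : SmoothField p F) (T : ℝ) : SmoothField p (duhamel T χ F) :=
  SmoothField.integral hd hp (μ := volume.restrict (Ioo 0 T)) (H := evol χ F)
    (hχ.smoothField_evol hd hp hF)

lemma measurable_fourierInv_lifted (hχ : SymbolHyp γ κ M χ) :
    Measurable (Function.uncurry fun r => 𝓕⁻ (lifted γ χ r)) :=
  measurable_fourierInv_param (m := lifted γ χ) hχ.measurable_lifted

lemma smoothField_liftedConv (hd : 0 < d) (hp : 1 ≤ p) (hχ : SymbolHyp γ κ M χ) {Z : Type*}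
    [MeasurableSpace Z] {φ : Z → ℝ} (hφ : Measurable φ) {G : Z → E → ℂ} (hG : SmoothField p G) :
    SmoothField p (fun z => liftedConv γ χ (φ z) (G z)) := by
  obtain ⟨C, hC⟩ := hχ.exists_lintegral_fourierInv_lifted_le hd
  exact SmoothField.convolution hd hp hχ.measurable_fourierInv_lifted hC hφ hG

lemma liftOp_evol (hd : 0 < d) (hp : 1 ≤ p) (hχ : SymbolHyp γ κ M χ) (hF : SmoothField p F)
    (N : ℕ) (w : ℝ × ℝ) : liftOp N (evol χ F w) = evol χ (fun s => liftOp N (F s)) w := by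
  have h := liftOp_superposition hd hp (hχ.integrable_fundSol hd w)
    (H := fun y x => F w.2 (x - y)) (hF.translate.comp (measurable_const.prodMk measurable_id)) N
  refine h.trans ?_
  funext x
  refine integral_congr_ae (Filter.Eventually.of_forall fun y => ?_)
  simp only
  congr 1
  exact congrFun (liftOp_comp_sub (F w.2) N y) x

lemma liftOp_duhamel (hd : 0 < d) (hp : 1 ≤ p) (hχ : SymbolHyp γ κ M χ) (hF : SmoothField p F)
    (N : ℕ) (T t : ℝ) : liftOp N (duhamel T χ F t) = duhamel T χ (fun s => liftOp N (F s)) t := by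
  have h := liftOp_superposition hd hp (μ := volume.restrict (Ioo 0 T)) (K := fun _ : ℝ => (1 : ℂ))
    (integrable_const _) (H := fun s => evol χ F (t, s))
    ((hχ.smoothField_evol hd hp hF).comp (measurable_const.prodMk measurable_id)) N
  simp only [one_mul] at h
  refine h.trans ?_
  funext x
  simp only [hχ.liftOp_evol hd hp hF]
  rfl

end SymbolHyp

/-! ### The integrated evolution equation. -/

namespace SymbolHyp

variable {γ κ M p : ℝ} {χ F : ℝ → EuclideanSpace ℝ (Fin d) → ℂ}

lemma lipschitz_integral (hd : 0 < d) (hχ : SymbolHyp γ κ M χ) (η : E) (s : ℝ) :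
    LipschitzWith (M * ‖η‖ ^ γ).toNNReal (fun t => ∫ r in s..t, χ r η) := by
  refine LipschitzWith.of_dist_le_mul fun a b => ?_
  have hM := hχ.M_nonneg
  rw [dist_eq_norm, intervalIntegral.integral_interval_sub_left
    (hχ.intervalIntegrable hd η s a) (hχ.intervalIntegrable hd η s b),
    Real.coe_toNNReal _ (by positivity), Real.dist_eq]
  exact hχ.norm_integral_le hd η b a

/-- The ordinary differential equation satisfied by the phase. -/
lemma phase_sub_one (hd : 0 < d) (hχ : SymbolHyp γ κ M χ) (η : E) {s t : ℝ} (hst : s ≤ t) :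
    ∫ r in s..t, χ r η * phase χ r s η = phase χ t s η - 1 := by
  have hL := hχ.lipschitz_integral hd η s
  have hac : AbsolutelyContinuousOnInterval (fun t => phase χ t s η) s t := by
    refine LipschitzOnWith.absolutelyContinuousOnInterval (K := (M * ‖η‖ ^ γ).toNNReal) ?_
    refine LipschitzOnWith.of_dist_le_mul fun a ha b hb => ?_
    rw [uIcc_of_le hst] at ha hb
    -- The exponential is a contraction on the left half plane, where the exponents lie. The phase
    -- is therefore Lipschitz in time.
    have h1 := (convex_halfSpace_re_le 0).norm_image_sub_le_of_norm_hasDerivWithin_le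
      (f := Complex.exp) (f' := Complex.exp) (C := 1) (x := ∫ r in s..b, χ r η)
      (y := ∫ r in s..a, χ r η)
      (fun w _ => (Complex.hasDerivAt_exp w).hasDerivWithinAt)
      (fun w hw => norm_exp_le_one_of_re_nonpos hw)
      (hχ.re_integral_nonpos hd η hb.1) (hχ.re_integral_nonpos hd η ha.1)
    rw [one_mul] at h1
    rw [dist_eq_norm]
    refine h1.trans ?_
    rw [← dist_eq_norm]
    exact hL.dist_le_mul a b
  have hder : ∀ᵐ r, r ∈ uIcc s t →
      HasDerivAt (fun t => phase χ t s η) (χ r η * phase χ r s η) r := by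
    filter_upwards [(hχ.intervalIntegrable hd η s t).ae_hasDerivAt_integral] with r hr hrm
    rw [mul_comm]
    exact (hr hrm s left_mem_uIcc).cexp
  rw [integral_eq_sub_of_ae_hasDerivAt hac hder]
  simp [phase]

lemma rpow_mul_norm_liftWeight_le (hd : 0 < d) (hγ : 0 < γ) (η : E) :
    ‖η‖ ^ γ * ‖liftWeight (liftOrder d γ) η‖ ≤
      (2 * √d) ^ liftOrder d γ * (1 + ‖η‖) ^ (-((d : ℝ) + 1)) := by
  set N := liftOrder d γ with hN
  have hN' := le_liftOrder d γ
  have h1 : (1 : ℝ) ≤ 1 + ‖η‖ := by linarith [norm_nonneg η]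
  calc ‖η‖ ^ γ * ‖liftWeight N η‖
      ≤ (1 + ‖η‖) ^ γ * ((2 * √d) ^ N * ((1 + ‖η‖) ^ N)⁻¹) := by
        refine mul_le_mul ?_ (norm_liftWeight_le hd N η) (norm_nonneg _) (by positivity)
        gcongr
        linarith
    _ = (2 * √d) ^ N * (1 + ‖η‖) ^ (γ - N) := by
        rw [Real.rpow_sub (by positivity), Real.rpow_natCast]; ring
    _ ≤ _ := by
        gcongr
        · have : (0 : ℝ) ≤ ((d / 2 + 1 : ℕ) : ℝ) := Nat.cast_nonneg _
          linarith

/-- The growth of `‖ξ‖^γ` is absorbed by the lifting weight. The remaining factor is the transform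
of a derivative combination of `g`, still in `L²`. -/
lemma integrable_rpow_mul_ltwoFourier (hd : 0 < d) (hγ : 0 < γ) {g : E → ℂ}
    (hg : SmoothLTwo g) : Integrable (fun ξ => ‖ξ‖ ^ γ * ‖ltwoFourier g ξ‖) ∧
      MemLp (fun ξ => ‖ξ‖ ^ γ * ‖ltwoFourier g ξ‖) 2 volume := by
  set N := liftOrder d γ
  have hc : Continuous fun ξ : E => ‖ξ‖ ^ γ := continuous_norm.rpow_const fun _ => Or.inr hγ.le
  set b : E → ℂ := fun ξ => ((‖ξ‖ ^ γ : ℝ) : ℂ) * liftWeight N ξ with hb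
  have hbn : ∀ ξ, ‖b ξ‖ = ‖ξ‖ ^ γ * ‖liftWeight N ξ‖ := fun ξ => by
    rw [hb, norm_mul, Complex.norm_real, Real.norm_eq_abs, abs_of_nonneg (by positivity)]
  have hbc : Continuous b := (Complex.continuous_ofReal.comp hc).mul (continuous_liftWeight N)
  have hb1 : ∀ ξ, ‖b ξ‖ ≤ (2 * √d) ^ N * (1 + ‖ξ‖) ^ (-((d : ℝ) + 1)) := fun ξ => by
    rw [hbn]; exact rpow_mul_norm_liftWeight_le hd hγ ξ
  have hb2 : ∀ ξ, ‖b ξ‖ ≤ (2 * √d) ^ N := fun ξ => (hb1 ξ).trans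
    (mul_le_of_le_one_right (by positivity)
      (Real.rpow_le_one_of_one_le_of_nonpos (by linarith [norm_nonneg ξ])
        (by have : (0 : ℝ) ≤ d := Nat.cast_nonneg d
            linarith)))
  have hbi := integrable_memLp_of_norm_le hbc.aestronglyMeasurable
    (ρ := (d : ℝ) + 1) (by linarith) hb1
  have h : (fun ξ => ‖b ξ * ltwoFourier (liftOp N g) ξ‖) =ᵐ[volume]
      fun ξ => ‖ξ‖ ^ γ * ‖ltwoFourier g ξ‖ := by
    filter_upwards [liftWeight_mul_ltwoFourier_liftOp hg N] with ξ hξ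
    rw [← hξ, norm_mul, hbn, norm_mul, mul_assoc]
  exact ⟨(integrable_mul_ltwoFourier hbi.2 _).norm.congr h,
    ((memLp_mul_ltwoFourier hbc.aestronglyMeasurable hb2 _).norm).ae_eq h⟩

lemma integrable_mul_ltwoFourier (hd : 0 < d) (hχ : SymbolHyp γ κ M χ) {g : E → ℂ}
    (hg : SmoothLTwo g) (r : ℝ) : Integrable (fun ξ => χ r ξ * ltwoFourier g ξ) ∧
      MemLp (fun ξ => χ r ξ * ltwoFourier g ξ) 2 volume := by
  have hm : AEStronglyMeasurable (fun ξ => χ r ξ * ltwoFourier g ξ) volume :=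
    (hχ.measurable_right r).aestronglyMeasurable.mul (memLp_ltwoFourier g).1
  have hb : ∀ ξ, ‖χ r ξ * ltwoFourier g ξ‖ ≤ M * (‖ξ‖ ^ γ * ‖ltwoFourier g ξ‖) := fun ξ => by
    rw [norm_mul, ← mul_assoc]
    exact mul_le_mul_of_nonneg_right (hχ.norm_le hd r ξ) (norm_nonneg _)
  obtain ⟨h1, h2⟩ := integrable_rpow_mul_ltwoFourier hd hχ.γ_pos hg
  exact ⟨(h1.const_mul M).mono' hm (Filter.Eventually.of_forall hb),
    (h2.const_mul M).mono' hm (Filter.Eventually.of_forall hb)⟩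

/-- On smooth functions, the operator with symbol `χ_r` factors through the lifting operator. -/
lemma liftedConv_liftOp (hd : 0 < d) (hχ : SymbolHyp γ κ M χ) {g : E → ℂ}
    (hg : SmoothLTwo g) (r : ℝ) (x : E) :
    liftedConv γ χ r (liftOp (liftOrder d γ) g) x = 𝓕⁻ (fun ξ => χ r ξ * ltwoFourier g ξ) x := by
  obtain ⟨h1, h2⟩ := hχ.integrable_memLp_lifted hd r
  rw [liftedConv, integral_fourierInv_mul h1 h2 (hg.liftOp _).memLp_self x]
  refine fourierInv_congr_ae ?_ x
  filter_upwards [liftWeight_mul_ltwoFourier_liftOp hg (liftOrder d γ)] with ξ hξ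
  rw [lifted, mul_assoc, hξ]

lemma evol_eq_fourierInv (hd : 0 < d) (hχ : SymbolHyp γ κ M χ) {s t : ℝ} (hs : 0 < s)
    (hst : s < t) (hF : MemLp (F s) 2 volume) (x : E) :
    evol χ F (t, s) x = 𝓕⁻ (fun ξ => phase χ t s ξ * ltwoFourier (F s) ξ) x := by
  obtain ⟨h1, h2⟩ := hχ.integrable_memLp_phase hd hst
  simp only [evol, fundSol, if_pos (And.intro hs hst)]
  exact integral_fourierInv_mul h1 h2 hF x

lemma ltwoFourier_evol (hd : 0 < d) (hχ : SymbolHyp γ κ M χ) {s t : ℝ} (hs : 0 < s)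
    (hst : s < t) (hF : MemLp (F s) 2 volume) :
    ltwoFourier (evol χ F (t, s)) =ᵐ[volume] fun ξ => phase χ t s ξ * ltwoFourier (F s) ξ := by
  obtain ⟨h1, h2⟩ := hχ.integrable_memLp_phase hd hst
  have e : evol χ F (t, s) = 𝓕⁻ (fun ξ => phase χ t s ξ * ltwoFourier (F s) ξ) :=
    funext (hχ.evol_eq_fourierInv hd hs hst hF)
  rw [e]
  exact ltwoFourier_fourierInv (PseudoDiffCauchy.integrable_mul_ltwoFourier h2 _)
    (memLp_mul_ltwoFourier h1.1 (hχ.norm_phase_le_one hd hst.le) _)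

lemma liftedConv_evol (hd : 0 < d) (hp : 1 ≤ p) (hχ : SymbolHyp γ κ M χ) (hF : SmoothField p F)
    {s r : ℝ} (hs : 0 < s) (hsr : s < r) (x : E) :
    liftedConv γ χ r (evol χ (fun s => liftOp (liftOrder d γ) (F s)) (r, s)) x =
      𝓕⁻ (fun ξ => χ r ξ * phase χ r s ξ * ltwoFourier (F s) ξ) x := by
  rw [← hχ.liftOp_evol hd hp hF, hχ.liftedConv_liftOp hd
    ((hχ.smoothField_evol hd hp hF).smoothLTwo _)]
  refine fourierInv_congr_ae ?_ x
  filter_upwards [hχ.ltwoFourier_evol hd hs hsr (hF.smoothLTwo s).memLp_self] with ξ hξ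
  rw [hξ, mul_assoc]

/-- Integration in time of the equation satisfied by `evol`. -/
lemma evol_eq_add_integral (hd : 0 < d) (hp : 1 ≤ p) (hχ : SymbolHyp γ κ M χ)
    (hF : SmoothField p F) {s t : ℝ} (hs : 0 < s) (hst : s < t) (x : E) :
    evol χ F (t, s) x = F s x + ∫ r in Ioo s t,
      liftedConv γ χ r (evol χ (fun s => liftOp (liftOrder d γ) (F s)) (r, s)) x := by
  have hg := hF.smoothLTwo s
  set ĝ := ltwoFourier (F s) with hgdef
  have hgi : Integrable ĝ := integrable_ltwoFourier hd hg
  have hM := hχ.M_nonneg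
  let W : ℝ → E → ℂ := fun r ξ =>
    ((𝐞 (inner ℝ ξ x) : Circle) : ℂ) * (χ r ξ * phase χ r s ξ * ĝ ξ)
  have hchar : Measurable fun ξ : E => ((𝐞 (inner ℝ ξ x) : Circle) : ℂ) := by
    apply Continuous.measurable
    have := Real.continuous_fourierChar
    fun_prop
  have hWm : AEStronglyMeasurable (Function.uncurry W)
      ((volume.restrict (Ioo s t)).prod volume) := by
    have h1 : Measurable fun q : ℝ × E => phase χ q.1 s q.2 :=
      hχ.measurable_phase.comp ((measurable_fst.prodMk measurable_const).prodMk measurable_snd)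
    exact (hchar.comp measurable_snd).aestronglyMeasurable.mul
      ((hχ.measurable.aestronglyMeasurable.mul h1.aestronglyMeasurable).mul
        hgi.aestronglyMeasurable.comp_snd)
  -- The phase has norm at most one, so `M ‖ξ‖^γ |ĝ(ξ)|` dominates the integrand uniformly in time
  -- and Fubini is justified.
  have hWi : Integrable (Function.uncurry W) ((volume.restrict (Ioo s t)).prod volume) := by
    have h1 := ((integrable_rpow_mul_ltwoFourier hd hχ.γ_pos hg).1.const_mul M).comp_snd
      (volume.restrict (Ioo s t))
    refine h1.mono' hWm ?_
    have h2 : ∀ᵐ q ∂((volume.restrict (Ioo s t)).prod (volume : Measure E)), q.1 ∈ Ioo s t :=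
      Measure.quasiMeasurePreserving_fst.ae (ae_restrict_mem measurableSet_Ioo)
    filter_upwards [h2] with q hq
    simp only [Function.uncurry, W]
    rw [norm_fourierChar_mul, norm_mul, norm_mul, ← mul_assoc]
    refine mul_le_mul_of_nonneg_right ?_ (norm_nonneg _)
    exact (mul_le_of_le_one_right (norm_nonneg _)
      (hχ.norm_phase_le_one hd hq.1.le _)).trans (hχ.norm_le hd _ _)
  have hswap : ∫ r in Ioo s t, ∫ ξ, W r ξ = ∫ ξ, ∫ r in Ioo s t, W r ξ :=
    integral_integral_swap hWi
  have hL : ∫ r in Ioo s t,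
      liftedConv γ χ r (evol χ (fun s => liftOp (liftOrder d γ) (F s)) (r, s)) x =
      ∫ r in Ioo s t, ∫ ξ, W r ξ := by
    refine setIntegral_congr_fun measurableSet_Ioo fun r hr => ?_
    rw [hχ.liftedConv_evol hd hp hF hs hr.1, Real.fourierInv_eq]
    simp only [Circle.smul_def, smul_eq_mul, W, hgdef]
  have hR : ∀ ξ, ∫ r in Ioo s t, W r ξ =
      ((𝐞 (inner ℝ ξ x) : Circle) : ℂ) * (phase χ t s ξ * ĝ ξ) -
        ((𝐞 (inner ℝ ξ x) : Circle) : ℂ) * ĝ ξ := by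
    intro ξ
    have h1 := hχ.phase_sub_one hd ξ hst.le
    rw [intervalIntegral.integral_of_le hst.le, integral_Ioc_eq_integral_Ioo] at h1
    simp only [W]
    rw [integral_const_mul, integral_mul_const, h1]
    ring
  have hi : ∀ {h : E → ℂ}, Integrable h →
      Integrable (fun ξ : E => ((𝐞 (inner ℝ ξ x) : Circle) : ℂ) * h ξ) := fun hh =>
    hh.mono (hchar.aestronglyMeasurable.mul hh.1)
      (Filter.Eventually.of_forall fun ξ => (norm_fourierChar_mul _ _).le)
  have h2 := hχ.integrable_memLp_phase hd hst
  rw [hL, hswap, integral_congr_ae (Filter.Eventually.of_forall hR),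
    integral_sub (hi (PseudoDiffCauchy.integrable_mul_ltwoFourier h2.2 _)) (hi hgi),
    hχ.evol_eq_fourierInv hd hs hst hg.memLp_self, hg.eq_fourierInv hd x, Real.fourierInv_eq,
    Real.fourierInv_eq]
  simp only [Circle.smul_def, smul_eq_mul, hgdef]
  ring

lemma evol_of_le {s t : ℝ} (h : t ≤ s) : evol χ F (t, s) = 0 := by
  funext x
  simp [evol, fundSol, h.not_gt]

lemma liftedConv_zero (r : ℝ) : liftedConv γ χ r 0 = 0 := by
  funext x
  simp [liftedConv]

/-- The right hand side of the equation satisfied by Duhamel's integral. -/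
def duhamelDeriv (T : ℝ) (χ F : ℝ → E → ℂ) (t : ℝ) (x : E) : ℂ :=
  𝓕⁻ (fun ξ => χ t ξ * ltwoFourier (duhamel T χ F t) ξ) x + F t x

lemma duhamelDeriv_eq (hd : 0 < d) (hp : 1 ≤ p) (hχ : SymbolHyp γ κ M χ)
    (hF : SmoothField p F) (T r : ℝ) (x : E) :
    duhamelDeriv T χ F r x =
      liftedConv γ χ r (duhamel T χ (fun s => liftOp (liftOrder d γ) (F s)) r) x + F r x := by
  rw [duhamelDeriv, ← hχ.liftOp_duhamel hd hp hF, hχ.liftedConv_liftOp hd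
    ((hχ.smoothField_duhamel hd hp hF T).smoothLTwo r)]

lemma smoothField_duhamelDeriv (hd : 0 < d) (hp : 1 ≤ p) (hχ : SymbolHyp γ κ M χ)
    (hF : SmoothField p F) (T : ℝ) : SmoothField p (duhamelDeriv T χ F) := by
  have h := (hχ.smoothField_liftedConv hd hp measurable_id
    (hχ.smoothField_duhamel hd hp (hF.liftOp hp (liftOrder d γ)) T)).add hp hF
  have e : duhamelDeriv T χ F = fun r x =>
      liftedConv γ χ r (duhamel T χ (fun s => liftOp (liftOrder d γ) (F s)) r) x + F r x := by
    funext r x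
    exact hχ.duhamelDeriv_eq hd hp hF T r x
  rw [e]
  exact h

/-- Fubini: the convolution kernel is integrable, the time interval is finite and the evolved field
is bounded. -/
lemma liftedConv_duhamel (hd : 0 < d) (hp : 1 ≤ p) (hχ : SymbolHyp γ κ M χ)
    (hF : SmoothField p F) (T r : ℝ) (x : E) :
    liftedConv γ χ r (duhamel T χ F r) x =
      ∫ s in Ioo 0 T, liftedConv γ χ r (evol χ F (r, s)) x := by
  have hV := hχ.smoothField_evol hd hp hF
  obtain ⟨C, -, hC⟩ := hV.exists_norm_le hd hp
  obtain ⟨D, hD⟩ := hχ.exists_lintegral_fourierInv_lifted_le hd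
  have hk : Integrable (𝓕⁻ (lifted γ χ r)) :=
    ⟨(hχ.measurable_fourierInv_lifted.comp measurable_prodMk_left).aestronglyMeasurable,
      (hD r).trans_lt ENNReal.coe_lt_top⟩
  have hm : Measurable fun q : ℝ × E => evol χ F (r, q.1) (x - q.2) :=
    hV.measurable.comp ((measurable_const.prodMk measurable_fst).prodMk
      (measurable_const.sub measurable_snd))
  have hi : Integrable (Function.uncurry fun (s : ℝ) (y : E) =>
      𝓕⁻ (lifted γ χ r) y * evol χ F (r, s) (x - y))
      ((volume.restrict (Ioo 0 T)).prod volume) :=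
    (hk.comp_snd (volume.restrict (Ioo 0 T))).mul_bdd (c := C) hm.aestronglyMeasurable
      (Filter.Eventually.of_forall fun q => hC _ _)
  simp only [liftedConv, duhamel]
  rw [integral_integral_swap hi]
  simp only [integral_const_mul]

/-- Duhamel's integral is the time integral of `duhamelDeriv`. -/
lemma duhamel_eq_integral (hd : 0 < d) (hp : 1 ≤ p) (hχ : SymbolHyp γ κ M χ)
    (hF : SmoothField p F) {T t : ℝ} (ht : t ∈ Icc 0 T) (x : E) :
    duhamel T χ F t x = ∫ r in (0 : ℝ)..t, duhamelDeriv T χ F r x := by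
  set L : ℝ → E → ℂ := fun s => liftOp (liftOrder d γ) (F s) with hLdef
  have hL : SmoothField p L := hF.liftOp hp _
  let B : ℝ × ℝ → E → ℂ := fun w => liftedConv γ χ w.1 (evol χ L w)
  have hB : SmoothField p B :=
    hχ.smoothField_liftedConv hd hp measurable_fst (hχ.smoothField_evol hd hp hL)
  have hB0 : ∀ r s, r ≤ s → B (r, s) = 0 := fun r s h => by
    simp only [B, evol_of_le h, liftedConv_zero]
  -- The propagator vanishes for `r ≤ s`, so the time integral over `(s,t)` extends to `(0,t)`. The
  -- domain no longer depends on `s`, and the integrals can be exchanged.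
  have h1 : ∀ s ∈ Ioo 0 T, evol χ F (t, s) x =
      (Iio t).indicator (fun s => F s x) s + ∫ r in Ioo 0 t, B (r, s) x := by
    intro s hs
    rcases lt_or_ge s t with hst | hst
    · rw [hχ.evol_eq_add_integral hd hp hF hs.1 hst, indicator_of_mem (mem_Iio.2 hst)]
      congr 1
      refine (setIntegral_eq_of_subset_of_forall_sdiff_eq_zero measurableSet_Ioo
        (Ioo_subset_Ioo_left hs.1.le) fun r hr => ?_).symm
      have : r ≤ s := by
        by_contra hcon
        exact hr.2 ⟨not_le.1 hcon, hr.1.2⟩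
      exact congrFun (hB0 r s this) x
    · rw [evol_of_le hst, indicator_of_notMem (by simpa using hst), zero_add]
      refine (setIntegral_eq_zero_of_forall_eq_zero fun r hr => ?_).symm
      exact congrFun (hB0 r s (hr.2.le.trans hst)) x
  have hBi : Integrable (fun q : ℝ × ℝ => B q x)
      ((volume.restrict (Ioo 0 t)).prod (volume.restrict (Ioo 0 T))) :=
    hB.integrable_apply hd hp _ x
  have hFi := hF.integrable_apply hd hp (volume.restrict (Ioo 0 T)) x
  have hsub : Ioo 0 T ∩ Iio t = Ioo 0 t := by
    ext s
    simp only [mem_inter_iff, mem_Ioo, mem_Iio]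
    constructor
    · rintro ⟨⟨h1, h2⟩, h3⟩; exact ⟨h1, h3⟩
    · rintro ⟨h1, h2⟩; exact ⟨⟨h1, h2.trans_le ht.2⟩, h2⟩
  have h3 : ∫ s in Ioo 0 T, ∫ r in Ioo 0 t, B (r, s) x =
      ∫ r in Ioo 0 t, ∫ s in Ioo 0 T, B (r, s) x :=
    (integral_integral_swap (f := fun r s => B (r, s) x) hBi).symm
  have h4 : ∀ r, ∫ s in Ioo 0 T, B (r, s) x = liftedConv γ χ r (duhamel T χ L r) x := fun r =>
    (hχ.liftedConv_duhamel hd hp hL T r x).symm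
  have h5 : Integrable (fun r => liftedConv γ χ r (duhamel T χ L r) x)
      (volume.restrict (Ioo 0 t)) :=
    (hχ.smoothField_liftedConv hd hp measurable_id
      (hχ.smoothField_duhamel hd hp hL T)).integrable_apply hd hp _ x
  rw [duhamel, setIntegral_congr_fun measurableSet_Ioo h1,
    integral_add (hFi.indicator measurableSet_Iio) hBi.integral_prod_right,
    setIntegral_indicator measurableSet_Iio, hsub, h3, intervalIntegral.integral_of_le ht.1,
    integral_Ioc_eq_integral_Ioo]
  simp only [h4]
  rw [add_comm, ← integral_add h5 (hF.integrable_apply hd hp _ x)]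
  simp only [hχ.duhamelDeriv_eq hd hp hF]
  rfl

end SymbolHyp

/-! ### Regularity of Duhamel's integral in time and space. -/

lemma SmoothField.isCpInf {p : ℝ} {F : ℝ → E → ℂ} (hF : SmoothField p F) (T : ℝ) :
    IsCpInf T p F where
  measurable := hF.measurable.comp
    ((measurable_subtype_coe.comp measurable_fst).prodMk measurable_snd)
  contDiff := Filter.Eventually.of_forall hF.contDiff
  bound α := by
    obtain ⟨C, hC⟩ := hF.bound (multiWord α)
    refine ⟨C, Filter.Eventually.of_forall fun t => ?_⟩
    rw [multiDeriv_eq_wordDeriv]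
    exact hC t

/-- Uniform Lipschitz bound in space. -/
lemma SmoothField.exists_norm_sub_le (hd : 0 < d) {Z : Type*} [MeasurableSpace Z] {p : ℝ}
    (hp : 1 ≤ p) {F : Z → E → ℂ} (hF : SmoothField p F) :
    ∃ C : ℝ, 0 ≤ C ∧ ∀ z x y, ‖F z x - F z y‖ ≤ C * ‖x - y‖ := by
  choose C hC0 hC using fun i => (hF.partialDeriv i).exists_norm_le hd hp
  refine ⟨∑ i, C i, Finset.sum_nonneg fun i _ => hC0 i, fun z x y => ?_⟩
  refine convex_univ.norm_image_sub_le_of_norm_fderiv_le (𝕜 := ℝ)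
    (fun x _ => hF.differentiable z x) (fun x _ => ?_) (mem_univ y) (mem_univ x)
  rw [fderiv_eq_sum_partialDeriv (hF.differentiable z)]
  exact (norm_sum_le _ _).trans (Finset.sum_le_sum fun i _ =>
    (norm_coordSMul_le i _).trans (hC i z x))

/-- Time integrals of smooth fields are differentiable in time, simultaneously for all points. -/
lemma SmoothField.ae_hasDerivAt_integral (hd : 0 < d) {p : ℝ} (hp : 1 ≤ p) {G : ℝ → E → ℂ}
    (hG : SmoothField p G) :
    ∀ᵐ t, ∀ x, HasDerivAt (fun t => ∫ r in (0 : ℝ)..t, G r x) (G t x) t := by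
  obtain ⟨C, -, hC⟩ := hG.exists_norm_le hd hp
  obtain ⟨D, hD0, hD⟩ := hG.exists_norm_sub_le hd hp
  have hint : ∀ x a b, IntervalIntegrable (fun r => G r x) volume a b := fun x a b =>
    (intervalIntegrable_const (c := C)).mono_fun (hG.measurable_apply x).aestronglyMeasurable
      (Filter.Eventually.of_forall fun r => (hC r x).trans (le_abs_self C))
  have hloc : ∀ x, LocallyIntegrable (fun r => G r x) volume := fun x =>
    (locallyIntegrable_const C).mono (hG.measurable_apply x).aestronglyMeasurable
      (Filter.Eventually.of_forall fun r => (hC r x).trans (le_abs_self C))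
  -- Lebesgue differentiation gives a null set of times for each point. Taking a countable dense set
  -- of points keeps the union null, and the uniform Lipschitz bound in space then reaches every
  -- `x`.
  have hdense : ∀ᵐ t, ∀ k : ℕ, HasDerivAt
      (fun t => ∫ r in (0 : ℝ)..t, G r (TopologicalSpace.denseSeq E k))
      (G t (TopologicalSpace.denseSeq E k)) t := by
    rw [ae_all_iff]
    intro k
    filter_upwards [LocallyIntegrable.ae_hasDerivAt_integral (hloc (TopologicalSpace.denseSeq E k))] with t ht
    exact ht 0
  filter_upwards [hdense] with t ht x
  rw [hasDerivAt_iff_isLittleO, Asymptotics.isLittleO_iff]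
  intro c hc
  obtain ⟨k, hk⟩ : ∃ k, ‖x - TopologicalSpace.denseSeq E k‖ < c / (4 * (D + 1)) := by
    obtain ⟨k, hk⟩ := (TopologicalSpace.denseRange_denseSeq E).exists_dist_lt x
      (ε := c / (4 * (D + 1))) (by positivity)
    exact ⟨k, by rwa [dist_eq_norm] at hk⟩
  set y := TopologicalSpace.denseSeq E k
  have h1 := hasDerivAt_iff_isLittleO.1 (ht k)
  rw [Asymptotics.isLittleO_iff] at h1
  filter_upwards [h1 (half_pos hc)] with t' h2
  have e : ∀ z : E, (∫ r in (0 : ℝ)..t', G r z) - ∫ r in (0 : ℝ)..t, G r z =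
      ∫ r in t..t', G r z := fun z =>
    intervalIntegral.integral_interval_sub_left (hint z _ _) (hint z _ _)
  rw [e] at h2 ⊢
  have h3 : ‖(∫ r in t..t', G r x) - ∫ r in t..t', G r y‖ ≤ D * ‖x - y‖ * |t' - t| := by
    rw [← intervalIntegral.integral_sub (hint x _ _) (hint y _ _)]
    exact intervalIntegral.norm_integral_le_of_norm_le_const fun r _ => hD r x y
  have h4 : ‖(t' - t) • G t x - (t' - t) • G t y‖ ≤ D * ‖x - y‖ * |t' - t| := by
    rw [← smul_sub, norm_smul, Real.norm_eq_abs, mul_comm]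
    exact mul_le_mul_of_nonneg_right (hD t x y) (abs_nonneg _)
  have h5 : D * ‖x - y‖ ≤ c / 4 := by
    calc D * ‖x - y‖ ≤ (D + 1) * (c / (4 * (D + 1))) := by gcongr; linarith
      _ = c / 4 := by field_simp
  calc ‖(∫ r in t..t', G r x) - (t' - t) • G t x‖
      = ‖((∫ r in t..t', G r y) - (t' - t) • G t y) +
          (((∫ r in t..t', G r x) - ∫ r in t..t', G r y) -
            ((t' - t) • G t x - (t' - t) • G t y))‖ := by congr 1; abel
    _ ≤ c / 2 * ‖t' - t‖ + (D * ‖x - y‖ * |t' - t| + D * ‖x - y‖ * |t' - t|) := by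
        refine (norm_add_le _ _).trans (add_le_add h2 ((norm_sub_le _ _).trans ?_))
        exact add_le_add h3 h4
    _ ≤ c / 2 * ‖t' - t‖ + (c / 4 * |t' - t| + c / 4 * |t' - t|) := by gcongr
    _ = c * ‖t' - t‖ := by rw [Real.norm_eq_abs]; ring

namespace SymbolHyp

variable {γ κ M p : ℝ} {χ F : ℝ → EuclideanSpace ℝ (Fin d) → ℂ}

lemma wordDeriv_duhamel (hd : 0 < d) (hp : 1 ≤ p) (hχ : SymbolHyp γ κ M χ)
    (hF : SmoothField p F) (L : List (Fin d)) (T t : ℝ) :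
    wordDeriv L (duhamel T χ F t) = duhamel T χ (fun s => wordDeriv L (F s)) t := by
  have h := wordDeriv_superposition hd hp (μ := volume.restrict (Ioo 0 T))
    (K := fun _ : ℝ => (1 : ℂ)) (integrable_const _) (H := fun s => evol χ F (t, s))
    ((hχ.smoothField_evol hd hp hF).comp (measurable_const.prodMk measurable_id)) L
  simp only [one_mul] at h
  refine h.trans ?_
  have h2 : ∀ s, wordDeriv L (evol χ F (t, s)) = evol χ (fun s => wordDeriv L (F s)) (t, s) := by
    intro s
    have h3 := wordDeriv_superposition hd hp (hχ.integrable_fundSol hd (t, s))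
      (H := fun y x => F s (x - y)) (hF.translate.comp (measurable_const.prodMk measurable_id)) L
    simp only [wordDeriv_comp_sub] at h3
    exact h3
  simp only [h2]
  rfl

/-- The time derivative is a smooth field, hence uniformly bounded. The resulting Lipschitz bound
gives both joint continuity and absolute continuity. -/
lemma exists_norm_duhamel_sub_le (hd : 0 < d) (hp : 1 ≤ p) (hχ : SymbolHyp γ κ M χ)
    (hF : SmoothField p F) (T : ℝ) : ∃ C : ℝ≥0, ∀ t ∈ Icc 0 T, ∀ t' ∈ Icc 0 T, ∀ x,
      ‖duhamel T χ F t x - duhamel T χ F t' x‖ ≤ C * |t - t'| := by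
  have hG := hχ.smoothField_duhamelDeriv hd hp hF T
  obtain ⟨C, hC0, hC⟩ := hG.exists_norm_le hd hp
  refine ⟨NNReal.mk C hC0, fun t ht t' ht' x => ?_⟩
  have hint : ∀ a b, IntervalIntegrable (fun r => duhamelDeriv T χ F r x) volume a b := fun a b =>
    (intervalIntegrable_const (c := C)).mono_fun (hG.measurable_apply x).aestronglyMeasurable
      (Filter.Eventually.of_forall fun r => (hC r x).trans (le_abs_self C))
  rw [hχ.duhamel_eq_integral hd hp hF ht, hχ.duhamel_eq_integral hd hp hF ht',
    intervalIntegral.integral_interval_sub_left (hint _ _) (hint _ _)]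
  exact intervalIntegral.norm_integral_le_of_norm_le_const fun r _ => hC r x

lemma continuousOn_duhamel (hd : 0 < d) (hp : 1 ≤ p) (hχ : SymbolHyp γ κ M χ)
    (hF : SmoothField p F) (T : ℝ) :
    ContinuousOn (fun z : ℝ × E => duhamel T χ F z.1 z.2) (Icc 0 T ×ˢ univ) := by
  obtain ⟨C, hC⟩ := hχ.exists_norm_duhamel_sub_le hd hp hF T
  obtain ⟨D, hD0, hD⟩ := (hχ.smoothField_duhamel hd hp hF T).exists_norm_sub_le hd hp
  refine LipschitzOnWith.continuousOn (K := C + NNReal.mk D hD0)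
    (LipschitzOnWith.of_dist_le_mul fun a ha b hb => ?_)
  have h1 := hC a.1 ha.1 b.1 hb.1 a.2
  have h2 := hD b.1 a.2 b.2
  have h3 : |a.1 - b.1| ≤ dist a b := le_max_left _ _
  have h4 : ‖a.2 - b.2‖ ≤ dist a b := by
    rw [← dist_eq_norm]; exact le_max_right _ _
  calc dist (duhamel T χ F a.1 a.2) (duhamel T χ F b.1 b.2)
      ≤ ‖duhamel T χ F a.1 a.2 - duhamel T χ F b.1 a.2‖ +
        ‖duhamel T χ F b.1 a.2 - duhamel T χ F b.1 b.2‖ := by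
        rw [dist_eq_norm]; exact norm_sub_le_norm_sub_add_norm_sub _ _ _
    _ ≤ C * dist a b + D * dist a b :=
        add_le_add (h1.trans (by gcongr)) (h2.trans (by gcongr))
    _ = _ := (add_mul _ _ _).symm

lemma ae_hasDerivAt_duhamel (hd : 0 < d) (hp : 1 ≤ p) (hχ : SymbolHyp γ κ M χ)
    (hF : SmoothField p F) (T : ℝ) : ∀ᵐ t ∂(volume.restrict (Ioo 0 T)), ∀ x,
      HasDerivAt (fun s => duhamel T χ F s x) (duhamelDeriv T χ F t x) t := by
  rw [ae_restrict_iff' measurableSet_Ioo]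
  filter_upwards [(hχ.smoothField_duhamelDeriv hd hp hF T).ae_hasDerivAt_integral hd hp]
    with t ht htm x
  refine (ht x).congr_of_eventuallyEq ?_
  filter_upwards [Ioo_mem_nhds htm.1 htm.2] with s hs
  exact hχ.duhamel_eq_integral hd hp hF (Ioo_subset_Icc_self hs) x

lemma isCpOneInf_duhamel (hd : 0 < d) (hp : 1 ≤ p) (hχ : SymbolHyp γ κ M χ)
    (hF : SmoothField p F) {T : ℝ} (hT : 0 < T) : IsCpOneInf T p (duhamel T χ F) where
  isCpInf := (hχ.smoothField_duhamel hd hp hF T).isCpInf T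
  contDiff t _ := (hχ.smoothField_duhamel hd hp hF T).contDiff t
  continuousOn α := by
    simp only [multiDeriv_eq_wordDeriv, hχ.wordDeriv_duhamel hd hp hF]
    exact hχ.continuousOn_duhamel hd hp (hF.wordDeriv _) T
  bounded α := by
    obtain ⟨C, -, hC⟩ := ((hχ.smoothField_duhamel hd hp hF T).wordDeriv
      (multiWord α)).exists_norm_le hd hp
    refine ⟨C, fun t _ x => ?_⟩
    rw [multiDeriv_eq_wordDeriv]
    exact hC t x
  absolutelyContinuous x := by
    obtain ⟨C, hC⟩ := hχ.exists_norm_duhamel_sub_le hd hp hF T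
    refine LipschitzOnWith.absolutelyContinuousOnInterval (K := C)
      (LipschitzOnWith.of_dist_le_mul fun a ha b hb => ?_)
    rw [uIcc_of_le hT.le] at ha hb
    rw [dist_eq_norm]
    exact hC a ha b hb x
  timeDeriv := ⟨duhamelDeriv T χ F, (hχ.smoothField_duhamelDeriv hd hp hF T).isCpInf T, by
    rw [← restrict_Ioo_eq_restrict_Icc]
    exact hχ.ae_hasDerivAt_duhamel hd hp hF T⟩

end SymbolHyp

/-! ### Reduction of the data and of the symbol to their normalized forms. -/

/-- A function of class `C_p^∞` agrees with a smooth field at almost every time. -/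
lemma IsCpInf.exists_smoothField {T p : ℝ} (hT : 0 < T) {f : ℝ → E → ℂ} (hf : IsCpInf T p f) :
    ∃ F : ℝ → E → ℂ, SmoothField p F ∧ (∀ᵐ t ∂(volume.restrict (Ioo 0 T)), F t = f t) ∧
      ∀ t ∉ Ioo 0 T, F t = 0 := by
  classical
  choose C hC using hf.bound
  have hae : ∀ᵐ t ∂(volume.restrict (Ioo 0 T)), ContDiff ℝ ∞ (f t) ∧ ∀ α : Fin d → ℕ,
      eLpNorm (multiDeriv α (f t)) 2 volume ≤ C α ∧
      eLpNorm (multiDeriv α (f t)) (ENNReal.ofReal p) volume ≤ C α := by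
    rw [restrict_Ioo_eq_restrict_Icc]
    exact hf.contDiff.and (ae_all_iff.2 hC)
  -- There are countably many multi-indices, so a single measurable null set contains all bad times.
  -- The field is set to zero there.
  obtain ⟨S₀, hS₀, hS₀m, hS₀n⟩ := exists_measurable_superset_of_null (ae_iff.1 hae)
  set S : Set ℝ := Ioo 0 T \ S₀ with hS
  have hSm : MeasurableSet S := measurableSet_Ioo.diff hS₀m
  -- Measurability of `f` is known only on `[0,T]`, so time is first projected onto that interval.
  let f₀ : ℝ → E → ℂ := fun t => f (projIcc 0 T hT.le t)
  have hf₀ : ∀ t ∈ S, f₀ t = f t := fun t ht => by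
    simp only [f₀, projIcc_of_mem hT.le (Ioo_subset_Icc_self ht.1)]
  have hgood : ∀ t ∈ S, ContDiff ℝ ∞ (f t) ∧ ∀ α : Fin d → ℕ,
      eLpNorm (multiDeriv α (f t)) 2 volume ≤ C α ∧
      eLpNorm (multiDeriv α (f t)) (ENNReal.ofReal p) volume ≤ C α := fun t ht => by
    by_contra h
    exact ht.2 (hS₀ h)
  have hf₀m : Measurable (Function.uncurry f₀) :=
    hf.measurable.comp (((continuous_projIcc (h := hT.le)).measurable.comp
      measurable_fst).prodMk measurable_snd)
  refine ⟨fun t x => if t ∈ S then f₀ t x else 0, SmoothField.indicator hSm hf₀m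
    (fun t ht => by rw [hf₀ t ht]; exact (hgood t ht).1) (fun L => ⟨C fun i => L.count i,
      fun t ht => ?_⟩), ?_, fun t ht => ?_⟩
  · rw [hf₀ t ht, wordDeriv_eq_multiDeriv L (hgood t ht).1]
    exact (hgood t ht).2 _
  · have h1 : ∀ᵐ t ∂(volume.restrict (Ioo 0 T)), t ∉ S₀ := measure_eq_zero_iff_ae_notMem.1 hS₀n
    filter_upwards [h1, ae_restrict_mem measurableSet_Ioo] with t ht htm
    have hts : t ∈ S := ⟨htm, ht⟩
    funext x
    simp only [if_pos hts, hf₀ t hts]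
  · have hts : t ∉ S := fun h => ht h.1
    funext x
    simp [hts]

lemma SymbolBound.congr_on {n : ℕ} {ρ B : ℝ} {J : Set ℝ} {g h : ℝ → ℂ}
    (hg : SymbolBound n ρ B J g) (hJ : IsOpen J) (hgh : ∀ s ∈ J, h s = g s) :
    SymbolBound n ρ B J h := by
  cases n with
  | zero => exact fun s hs => by rw [hgh s hs]; exact hg s hs
  | succ n =>
    obtain ⟨h0, g', h1, h2⟩ := hg
    refine ⟨fun s hs => by rw [hgh s hs]; exact h0 s hs, g', fun s hs => ?_, h2⟩
    exact (h1 s hs).congr_of_eventuallyEq (Filter.eventually_of_mem (hJ.mem_nhds hs) hgh)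

lemma contDiffOn_partialDeriv {g : E → ℂ} {U : Set E} (hU : IsOpen U) {m : ℕ}
    (hg : ContDiffOn ℝ (m + 1 : ℕ) g U) (i : Fin d) : ContDiffOn ℝ m (partialDeriv i g) U := by
  have h1 : ContDiffOn ℝ m (fun x => fderiv ℝ g x (EuclideanSpace.single i 1)) U :=
    (hg.fderiv_of_isOpen hU (by push_cast; exact le_rfl)).clm_apply contDiffOn_const
  refine h1.congr fun x hx => ?_
  have hd : DifferentiableAt ℝ g x :=
    (hg.contDiffAt (hU.mem_nhds hx)).differentiableAt (by simp)
  exact hd.lineDeriv_eq_fderiv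

lemma contDiffOn_iterate_partialDeriv {g : E → ℂ} {U : Set E} (hU : IsOpen U) (i : Fin d) (m k : ℕ)
    (hg : ContDiffOn ℝ (m + k : ℕ) g U) : ContDiffOn ℝ m ((partialDeriv i)^[k] g) U := by
  induction k generalizing g with
  | zero => exact hg
  | succ k ih =>
    rw [Function.iterate_succ_apply]
    exact ih (contDiffOn_partialDeriv hU hg i)

lemma hasDerivAt_line {g : E → ℂ} {U : Set E} (hU : IsOpen U) {m : ℕ}
    (hg : ContDiffOn ℝ (m + 1 : ℕ) g U) (i : Fin d) (ζ : E) {s : ℝ}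
    (hs : ζ + s • EuclideanSpace.single i (1 : ℝ) ∈ U) :
    HasDerivAt (fun s : ℝ => g (ζ + s • EuclideanSpace.single i (1 : ℝ)))
      (partialDeriv i g (ζ + s • EuclideanSpace.single i (1 : ℝ))) s := by
  have hd : DifferentiableAt ℝ g (ζ + s • EuclideanSpace.single i (1 : ℝ)) :=
    (hg.contDiffAt (hU.mem_nhds hs)).differentiableAt (by simp)
  have h1 : HasDerivAt (fun s : ℝ => ζ + s • EuclideanSpace.single i (1 : ℝ))
      (EuclideanSpace.single i (1 : ℝ)) s := by
    simpa using ((hasDerivAt_id s).smul_const (EuclideanSpace.single i (1 : ℝ))).const_add ζ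
  have h2 := hd.hasFDerivAt.comp_hasDerivAt s h1
  rw [partialDeriv, hd.lineDeriv_eq_fderiv]
  exact h2

/-- Bounds of Mihlin type restrict to lines. -/
lemma symbolBound_of_partialDeriv {n : ℕ} {γ M : ℝ} (hγ : 0 < γ) (hM : 0 ≤ M) {g : E → ℂ}
    (hg : ContDiffOn ℝ n g {0}ᶜ) (i : Fin d)
    (hb : ∀ k ≤ n, ∀ ξ, ξ ≠ 0 → ‖(partialDeriv i)^[k] g ξ‖ ≤ M * ‖ξ‖ ^ (γ - k))
    {ζ : E} (hζ : ζ ≠ 0) :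
    SymbolBound n ‖ζ‖ (M * 2 ^ (γ + n) * ‖ζ‖ ^ γ) (halfBall ζ)
      (fun s => g (ζ + s • EuclideanSpace.single i (1 : ℝ))) := by
  have hζ' := norm_pos_iff.2 hζ
  set e : E := EuclideanSpace.single i (1 : ℝ) with he
  have hne : ∀ s ∈ halfBall ζ, ζ + s • e ≠ 0 := fun s hs => by
    rw [← norm_pos_iff]
    have := norm_add_smul_single_bounds ζ i hs
    linarith
  -- On the half ball `‖ζ‖/2 ≤ ‖ξ‖ ≤ 2‖ζ‖`. The upper bound yields the factor `2^γ`, the lower bound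
  -- at most `2^n`; treating them separately avoids the sign of `γ - k`.
  have hbd : ∀ k ≤ n, ∀ s ∈ halfBall ζ, ‖(partialDeriv i)^[k] g (ζ + s • e)‖ ≤
      M * 2 ^ (γ + n) * ‖ζ‖ ^ γ / ‖ζ‖ ^ k := by
    intro k hk s hs
    have h1 := norm_add_smul_single_bounds ζ i hs
    have h2 : ‖ζ + s • e‖ ≤ 2 * ‖ζ‖ := by
      have h3 : ‖s • e‖ ≤ ‖ζ‖ / 2 := by
        rw [norm_smul, he, PiLp.norm_single, norm_one, mul_one, Real.norm_eq_abs]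
        exact (abs_lt.2 hs).le
      have := norm_add_le ζ (s • e)
      linarith
    have hy : 0 < ‖ζ + s • e‖ := norm_pos_iff.2 (hne s hs)
    refine (hb k hk _ (hne s hs)).trans ?_
    rw [Real.rpow_sub hy, Real.rpow_natCast, mul_assoc, mul_div_assoc]
    refine mul_le_mul_of_nonneg_left ?_ hM
    rw [div_le_div_iff₀ (by positivity) (by positivity)]
    have h4 : ‖ζ‖ ^ k ≤ 2 ^ n * ‖ζ + s • e‖ ^ k := by
      calc ‖ζ‖ ^ k ≤ (2 * ‖ζ + s • e‖) ^ k := by gcongr; linarith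
        _ = 2 ^ k * ‖ζ + s • e‖ ^ k := mul_pow _ _ _
        _ ≤ _ := by gcongr; norm_num
    calc ‖ζ + s • e‖ ^ γ * ‖ζ‖ ^ k ≤ (2 * ‖ζ‖) ^ γ * (2 ^ n * ‖ζ + s • e‖ ^ k) := by gcongr
      _ = _ := by
        rw [Real.mul_rpow (by norm_num) hζ'.le, Real.rpow_add (by norm_num), Real.rpow_natCast]
        ring
  have key : ∀ m k, m + k = n → SymbolBound m ‖ζ‖ (M * 2 ^ (γ + n) * ‖ζ‖ ^ γ / ‖ζ‖ ^ k)
      (halfBall ζ) (fun s => (partialDeriv i)^[k] g (ζ + s • e)) := by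
    intro m
    induction m with
    | zero => exact fun k hk s hs => hbd k (by omega) s hs
    | succ m ih =>
      intro k hk
      refine ⟨fun s hs => hbd k (by omega) s hs,
        fun s => (partialDeriv i)^[k + 1] g (ζ + s • e), fun s hs => ?_, ?_⟩
      · rw [Function.iterate_succ_apply']
        refine hasDerivAt_line isOpen_compl_singleton (m := m)
          (contDiffOn_iterate_partialDeriv isOpen_compl_singleton i (m + 1) k ?_) i ζ (hne s hs)
        rw [hk]; exact hg
      · rw [div_div, ← pow_succ]
        exact ih (k + 1) (by omega)
  simpa using key n 0 rfl

/-- A symbol which is measurable in time for almost every frequency, and continuous in frequency,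
becomes jointly measurable after a change on a null set of times. -/
lemma exists_measurable_modification (hd : 0 < d) {ψ : ℝ → E → ℂ}
    (hψ : AEStronglyMeasurable (Function.uncurry ψ) volume)
    (hc : ∀ t, ContinuousOn (ψ t) {0}ᶜ) :
    ∃ τ : ℝ → ℝ, (∀ᵐ r, τ r = r) ∧
      Measurable (Function.uncurry fun r ξ => if ξ = 0 then 0 else ψ (τ r) ξ) := by
  classical
  have hae : ∀ᵐ ξ : E, AEStronglyMeasurable (fun r => ψ r ξ) volume :=
    AEStronglyMeasurable.prodMk_left (f := fun q : E × ℝ => ψ q.2 q.1)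
      (AEStronglyMeasurable.prod_swap (f := Function.uncurry ψ) hψ)
  -- Almost every frequency has a measurable time section, so a countable dense set `D` of such
  -- frequencies exists. One null set of times serves all of `D`, and `τ` sends it to time `0`;
  -- continuity in frequency then extends measurability to every `ξ ≠ 0`.
  obtain ⟨D, hDs, hDc, hD⟩ := (Measure.dense_of_ae hae).exists_countable_dense_subset
  choose! mk hmk1 hmk2 using fun ξ (hξ : ξ ∈ D) => (hDs hξ)
  have hN : ∀ᵐ r, ∀ ξ ∈ D, ψ r ξ = mk ξ r := (ae_ball_iff hDc).2 hmk2
  obtain ⟨N, hN1, hNm, hN0⟩ := exists_measurable_superset_of_null (ae_iff.1 hN)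
  set τ : ℝ → ℝ := fun r => if r ∈ N then 0 else r with hτ
  have hτD : ∀ ξ ∈ D, Measurable fun r => ψ (τ r) ξ := by
    intro ξ hξ
    have e : (fun r => ψ (τ r) ξ) = fun r => if r ∈ N then ψ 0 ξ else mk ξ r := by
      funext r
      by_cases h : r ∈ N
      · simp [hτ, h]
      · simp only [hτ, if_neg h]
        by_contra hcon
        exact h (hN1 fun hall => hcon (hall ξ hξ))
    rw [e]
    exact Measurable.ite hNm measurable_const (hmk1 ξ hξ).measurable
  have hτall : ∀ ξ : E, ξ ≠ 0 → Measurable fun r => ψ (τ r) ξ := by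
    intro ξ hξ
    obtain ⟨x, hx, hlim⟩ := mem_closure_iff_seq_limit.1 (hD ξ)
    refine measurable_of_tendsto_metrizable (fun k => hτD (x k) (hx k))
      (tendsto_pi_nhds.2 fun r => ?_)
    exact (((hc (τ r)).continuousAt (isOpen_compl_singleton.mem_nhds hξ)).tendsto).comp hlim
  refine ⟨τ, ?_, ?_⟩
  · filter_upwards [measure_eq_zero_iff_ae_notMem.1 hN0] with r hr
    simp [hτ, hr]
  let e : E := EuclideanSpace.single ⟨0, hd⟩ 1
  have he : e ≠ 0 := by simp [e]
  let u : ({0}ᶜ : Set E) → ℝ → ℂ := fun ξ r => ψ (τ r) ξ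
  have hu : Measurable (Function.uncurry u) :=
    measurable_uncurry_of_continuous_of_measurable
      (fun r => continuousOn_iff_continuous_domRestrict.1 (hc (τ r))) fun ξ => hτall ξ ξ.2
  -- A measurable retraction onto the punctured space, where `u` is defined. Its value at the origin
  -- is immaterial, since the symbol is set to zero there.
  let q : E → ({0}ᶜ : Set E) := fun ξ => ⟨if ξ = 0 then e else ξ, by
    by_cases h : ξ = 0 <;> simp [h, he]⟩
  have hq : Measurable q :=
    (Measurable.ite (measurableSet_singleton 0) measurable_const measurable_id).subtype_mk
  have e : (Function.uncurry fun r ξ => if ξ = 0 then 0 else ψ (τ r) ξ) =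
      fun z : ℝ × E => if z.2 = 0 then 0 else Function.uncurry u (q z.2, z.1) := by
    funext z
    by_cases h : z.2 = 0 <;> simp [Function.uncurry, h, u, q]
  rw [e]
  exact Measurable.ite (measurable_snd (measurableSet_singleton 0)) measurable_const
    (hu.comp ((hq.comp measurable_snd).prodMk measurable_fst))

/-- Reduction to jointly measurable symbols. -/
lemma exists_symbolHyp (hd : 0 < d) {γ κ M : ℝ} {ψ : ℝ → E → ℂ}
    (hψ : LocallyIntegrable (Function.uncurry ψ) volume) (hell : IsElliptic ψ γ κ)
    (hreg : HasRegularUpperBound (d / 2 + 1) ψ γ M) :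
    ∃ (κ' M' : ℝ) (χ : ℝ → E → ℂ), SymbolHyp γ κ' M' χ ∧
      ∀ᵐ r, ∀ η, η ≠ 0 → χ r η = ψ r ((2 * Real.pi) • η) := by
  obtain ⟨hγ, hκ, -, hell⟩ := hell
  obtain ⟨-, hM, hcd, hreg⟩ := hreg
  have hpi : 0 < 2 * Real.pi := by positivity
  have hpin : ∀ η : E, ‖(2 * Real.pi) • η‖ = 2 * Real.pi * ‖η‖ := fun η => by
    rw [norm_smul, Real.norm_eq_abs, abs_of_pos hpi]
  obtain ⟨τ, hτ, hm⟩ := exists_measurable_modification hd hψ.aestronglyMeasurable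
    fun t => (hcd t).continuousOn
  set n := d / 2 + 1 with hn
  -- The powers of `2π` come from the frequency rescaling, and `2^{γ+n}` from passing from pointwise
  -- bounds to bounds on half balls. Redefining the symbol at the origin gives it the growth bound
  -- there, which `ψ` need not satisfy.
  refine ⟨κ * (2 * Real.pi) ^ γ, M * 2 ^ (γ + n) * (2 * Real.pi) ^ γ,
    fun r η => if (2 * Real.pi) • η = 0 then 0 else ψ (τ r) ((2 * Real.pi) • η),
    ⟨hγ, by positivity, by positivity, ?_, fun r => by simp, fun r η => ?_, fun r i ζ hζ => ?_⟩, ?_⟩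
  · exact hm.comp (measurable_fst.prodMk (measurable_snd.const_smul (2 * Real.pi)))
  · by_cases h : (2 * Real.pi) • η = 0
    · have h0 : η = 0 := (smul_eq_zero.1 h).resolve_left hpi.ne'
      simp [h0, Real.zero_rpow hγ.ne']
    · simp only [if_neg h]
      have h1 := hell (τ r) ((2 * Real.pi) • η)
      rw [hpin, Real.mul_rpow hpi.le (norm_nonneg _), Complex.neg_re] at h1
      linarith
  · have hζ2 : (2 * Real.pi) • ζ ≠ 0 := smul_ne_zero hpi.ne' hζ
    have h1 := symbolBound_of_partialDeriv hγ hM.le (hcd (τ r)) i (fun k hk ξ hξ => by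
      have h2 := hreg (Pi.single i k) (by simpa using hk) (τ r) ξ hξ
      rw [multiDeriv_single] at h2
      simpa using h2) hζ2
    have h3 := h1.comp_affine (J' := halfBall ζ) (b := 0) hpi.ne' (fun s hs => by
      rw [add_zero]
      simp only [halfBall, hpin, mem_Ioo] at hs ⊢
      constructor <;> nlinarith)
    rw [hpin, abs_of_pos hpi, mul_div_cancel_left₀ _ hpi.ne',
      Real.mul_rpow hpi.le (norm_nonneg _), ← mul_assoc] at h3
    have h4 : (fun s : ℝ => (fun r (η : E) => if (2 * Real.pi) • η = 0 then 0 else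
        ψ (τ r) ((2 * Real.pi) • η)) r (ζ + s • EuclideanSpace.single i (1 : ℝ))) =
        fun s : ℝ => if (2 * Real.pi) • (ζ + s • EuclideanSpace.single i (1 : ℝ)) = 0 then 0 else
          ψ (τ r) ((2 * Real.pi) • ζ + (2 * Real.pi * s + 0) • EuclideanSpace.single i (1 : ℝ)) := by
      funext s
      simp only [smul_add, smul_smul, add_zero]
    rw [h4]
    refine h3.congr_on isOpen_Ioo fun s hs => ?_
    have h5 : ζ + s • EuclideanSpace.single i (1 : ℝ) ≠ 0 := by
      rw [← norm_pos_iff]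
      have := norm_add_smul_single_bounds ζ i hs
      have := norm_pos_iff.2 hζ
      linarith
    rw [if_neg (smul_ne_zero hpi.ne' h5)]
  · filter_upwards [hτ] with r hr η hη
    rw [if_neg (smul_ne_zero hpi.ne' hη), hr]

/-! ### Translation between the two normalizations of the Fourier transform. -/

section Scaling

lemma integral_eq_two_pi_smul (h : E → ℂ) :
    ∫ ξ, h ξ = (((2 * Real.pi) ^ (d : ℝ) : ℝ) : ℂ) * ∫ η, h ((2 * Real.pi) • η) := by
  have hpi : 0 < 2 * Real.pi := by positivity
  rw [Measure.integral_comp_smul, finrank_euclideanSpace_fin, abs_of_pos (by positivity),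
    Complex.real_smul, ← mul_assoc, ← Complex.ofReal_mul, Real.rpow_natCast,
    mul_inv_cancel₀ (by positivity), Complex.ofReal_one, one_mul]

lemma ae_ne_zero (hd : 0 < d) : ∀ᵐ η : E, η ≠ 0 := by
  have : Nontrivial E := by
    refine ⟨EuclideanSpace.single ⟨0, hd⟩ 1, 0, ?_⟩
    simp
  exact Measure.ae_ne volume 0

lemma fourierL2_two_pi_smul (g : E → ℂ) (η : E) :
    fourierL2 g ((2 * Real.pi) • η) =
      (((2 * Real.pi) ^ (-(d : ℝ) / 2) : ℝ) : ℂ) * ltwoFourier g η := by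
  have hpi : (2 * Real.pi) ≠ 0 := by positivity
  by_cases hg : MemLp g 2 volume
  · rw [fourierL2, dif_pos hg, ltwoFourier_of_memLp hg, smul_smul, inv_mul_cancel₀ hpi, one_smul]
  · simp [fourierL2, ltwoFourier, hg]

lemma exp_inner_two_pi_smul (x η : E) :
    Complex.exp (Complex.I * ((inner ℝ x ((2 * Real.pi) • η) : ℝ) : ℂ)) =
      ((𝐞 (inner ℝ η x) : Circle) : ℂ) := by
  rw [Real.fourierChar_apply, inner_smul_right, real_inner_comm]
  congr 1
  push_cast
  ring

variable {ψ χ : ℝ → EuclideanSpace ℝ (Fin d) → ℂ}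

lemma pseudoDiff_eq_fourierInv (hd : 0 < d) {t : ℝ}
    (h : ∀ η, η ≠ 0 → χ t η = ψ t ((2 * Real.pi) • η)) (g : E → ℂ) (x : E) :
    pseudoDiff (ψ t) g x = 𝓕⁻ (fun η => χ t η * ltwoFourier g η) x := by
  have hpi : 0 < 2 * Real.pi := by positivity
  set c : ℝ := (2 * Real.pi) ^ (-(d : ℝ) / 2) with hc
  -- The two prefactors `(2π)^{-d/2}` cancel the Jacobian of `ξ = 2πη`.
  have hcc : c * (2 * Real.pi) ^ (d : ℝ) * c = 1 := by
    rw [hc, ← Real.rpow_add hpi, ← Real.rpow_add hpi]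
    convert Real.rpow_zero _ using 2
    ring
  rw [pseudoDiff, invFourier, integral_eq_two_pi_smul, ← hc, Real.fourierInv_eq, ← mul_assoc,
    ← Complex.ofReal_mul, ← integral_const_mul]
  refine integral_congr_ae ?_
  filter_upwards [ae_ne_zero hd] with η hη
  simp only [fourierL2_two_pi_smul, exp_inner_two_pi_smul, Circle.smul_def, smul_eq_mul, ← hc,
    h η hη]
  calc _ = ((c * (2 * Real.pi) ^ (d : ℝ) * c : ℝ) : ℂ) * (((𝐞 (inner ℝ η x) : Circle) : ℂ) *
        (ψ t ((2 * Real.pi) • η) * ltwoFourier g η)) := by push_cast; ring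
    _ = _ := by rw [hcc, Complex.ofReal_one, one_mul]

lemma exp_integral_eq_phase (h : ∀ᵐ r, ∀ η, η ≠ 0 → χ r η = ψ r ((2 * Real.pi) • η)) (s t : ℝ)
    {η : E} (hη : η ≠ 0) :
    Complex.exp (∫ r in s..t, ψ r ((2 * Real.pi) • η)) = phase χ t s η := by
  rw [phase]
  congr 1
  refine intervalIntegral.integral_congr_ae ?_
  filter_upwards [h] with r hr _
  exact (hr η hη).symm

lemma kernel_eq_fundSol (hd : 0 < d)
    (h : ∀ᵐ r, ∀ η, η ≠ 0 → χ r η = ψ r ((2 * Real.pi) • η)) (t s : ℝ) (x : E) :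
    kernel ψ t s x = fundSol χ (t, s) x := by
  have hpi : 0 < 2 * Real.pi := by positivity
  unfold kernel fundSol
  refine if_congr Iff.rfl ?_ rfl
  rw [integral_eq_two_pi_smul, ← mul_assoc, ← Complex.ofReal_mul, ← Real.rpow_add hpi,
    neg_add_cancel, Real.rpow_zero, Complex.ofReal_one, one_mul, Real.fourierInv_eq]
  refine integral_congr_ae ?_
  filter_upwards [ae_ne_zero hd] with η hη
  simp only [exp_inner_two_pi_smul, Circle.smul_def, smul_eq_mul, exp_integral_eq_phase h s t hη]
  ring

lemma integrable_exp_integral (hd : 0 < d) {γ κ M : ℝ} (hχ : SymbolHyp γ κ M χ)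
    (h : ∀ᵐ r, ∀ η, η ≠ 0 → χ r η = ψ r ((2 * Real.pi) • η)) {s t : ℝ} (hst : s < t) :
    Integrable (fun ξ : E => Complex.exp (∫ r in s..t, ψ r ξ)) volume := by
  have hpi : (2 * Real.pi) ≠ 0 := by positivity
  rw [← integrable_comp_smul_iff volume _ hpi]
  refine (hχ.integrable_memLp_phase hd hst).1.congr ?_
  filter_upwards [ae_ne_zero hd] with η hη
  exact (exp_integral_eq_phase h s t hη).symm

end Scaling

/-! ### Absolute convergence of the kernel formula and its identification with Duhamel's integral.
-/

section KernelOp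

variable {ψ χ f F : ℝ → EuclideanSpace ℝ (Fin d) → ℂ} {T p γ κ M : ℝ}

lemma ae_kernelIntegrand_eq (hd : 0 < d)
    (h : ∀ᵐ r, ∀ η, η ≠ 0 → χ r η = ψ r ((2 * Real.pi) • η))
    (hF : ∀ᵐ t ∂(volume.restrict (Ioo 0 T)), F t = f t) (hF0 : ∀ t ∉ Ioo 0 T, F t = 0)
    (t : ℝ) (x : E) :
    ∀ᵐ s, ∀ y, kernelIntegrand T ψ f t x s y = fundSol χ (t, s) (x - y) * F s y := by
  filter_upwards [(ae_restrict_iff' measurableSet_Ioo).1 hF] with s hs y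
  rw [kernelIntegrand, kernel_eq_fundSol hd h]
  by_cases hsT : 0 < s ∧ s < T
  · rw [if_pos hsT, hs hsT]
  · rw [if_neg hsT, hF0 s hsT, Pi.zero_apply]

lemma kernelOp_eq_duhamel (hd : 0 < d)
    (h : ∀ᵐ r, ∀ η, η ≠ 0 → χ r η = ψ r ((2 * Real.pi) • η))
    (hF : ∀ᵐ t ∂(volume.restrict (Ioo 0 T)), F t = f t) (hF0 : ∀ t ∉ Ioo 0 T, F t = 0)
    (t : ℝ) (x : E) : kernelOp T ψ f t x = duhamel T χ F t x := by
  have h1 : kernelOp T ψ f t x = ∫ s in Iio t, evol χ F (t, s) x := by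
    refine integral_congr_ae (ae_restrict_of_ae ?_)
    filter_upwards [ae_kernelIntegrand_eq hd h hF hF0 t x] with s hs
    simp only [hs, evol]
    rw [← integral_sub_left_eq_self _ volume x]
    simp only [sub_sub_cancel]
  -- Both time integrals equal the integral over the whole line: the propagator vanishes for `s ≥
  -- t`, and the datum outside `(0,T)`.
  rw [h1, duhamel, setIntegral_eq_integral_of_forall_compl_eq_zero fun s hs => ?_,
    setIntegral_eq_integral_of_forall_compl_eq_zero fun s hs => ?_]
  · simp [evol, hF0 s hs]
  · rw [SymbolHyp.evol_of_le (not_lt.1 hs), Pi.zero_apply]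

lemma integrable_kernelIntegrand (hd : 0 < d) (hp : 1 ≤ p) (hχ : SymbolHyp γ κ M χ)
    (h : ∀ᵐ r, ∀ η, η ≠ 0 → χ r η = ψ r ((2 * Real.pi) • η)) (hFs : SmoothField p F)
    (hF : ∀ᵐ t ∂(volume.restrict (Ioo 0 T)), F t = f t) (hF0 : ∀ t ∉ Ioo 0 T, F t = 0)
    (t : ℝ) (x : E) : Integrable (Function.uncurry (kernelIntegrand T ψ f t x))
      ((volume.restrict (Iio t)).prod volume) := by
  obtain ⟨C, -, hC⟩ := hFs.exists_norm_le hd hp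
  obtain ⟨D, hD⟩ := hχ.exists_lintegral_fundSol_le hd
  have hm : Measurable fun q : ℝ × E => fundSol χ (t, q.1) (x - q.2) * F q.1 q.2 := by
    have h1 : Measurable fun q : ℝ × E => fundSol χ (t, q.1) (x - q.2) :=
      hχ.measurable_fundSol.comp ((measurable_const.prodMk measurable_fst).prodMk
        (measurable_const.sub measurable_snd))
    exact h1.mul hFs.measurable
  have hi : Integrable (fun q : ℝ × E => fundSol χ (t, q.1) (x - q.2) * F q.1 q.2)
      ((volume.restrict (Iio t)).prod volume) := by
    refine ⟨hm.aestronglyMeasurable, ?_⟩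
    rw [hasFiniteIntegral_iff_enorm, lintegral_prod _ hm.enorm.aemeasurable]
    have h2 : ∀ s, ∫⁻ y, ‖fundSol χ (t, s) (x - y) * F s y‖ₑ ≤
        (Ioo 0 T).indicator (fun _ => (D : ℝ≥0∞) * ENNReal.ofReal C) s := by
      intro s
      by_cases hs : s ∈ Ioo 0 T
      · rw [indicator_of_mem hs]
        have hmeas : Measurable fun y => ‖fundSol χ (t, s) y‖ₑ :=
          (hχ.measurable_fundSol.comp measurable_prodMk_left).enorm
        calc ∫⁻ y, ‖fundSol χ (t, s) (x - y) * F s y‖ₑ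
            ≤ ∫⁻ y, ‖fundSol χ (t, s) (x - y)‖ₑ * ENNReal.ofReal C := by
              refine lintegral_mono fun y => ?_
              rw [enorm_mul]
              gcongr
              rw [← ofReal_norm]
              exact ENNReal.ofReal_le_ofReal (hC s y)
          _ = (∫⁻ y, ‖fundSol χ (t, s) (x - y)‖ₑ) * ENNReal.ofReal C :=
              lintegral_mul_const _ (hmeas.comp (measurable_const.sub measurable_id))
          _ = (∫⁻ y, ‖fundSol χ (t, s) y‖ₑ) * ENNReal.ofReal C := by
              rw [lintegral_sub_left_eq_self (fun y => ‖fundSol χ (t, s) y‖ₑ) x]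
          _ ≤ _ := by gcongr; exact hD _
      · rw [indicator_of_notMem hs]
        simp [hF0 s hs]
    calc ∫⁻ s in Iio t, ∫⁻ y, ‖fundSol χ (t, s) (x - y) * F s y‖ₑ
        ≤ ∫⁻ s, (Ioo 0 T).indicator (fun _ => (D : ℝ≥0∞) * ENNReal.ofReal C) s :=
          (setLIntegral_le_lintegral _ _).trans (lintegral_mono h2)
      _ = (D : ℝ≥0∞) * ENNReal.ofReal C * volume (Ioo 0 T) := by
          rw [lintegral_indicator measurableSet_Ioo, setLIntegral_const]
      _ < ⊤ := by
          rw [Real.volume_Ioo]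
          exact ENNReal.mul_lt_top (ENNReal.mul_lt_top ENNReal.coe_lt_top ENNReal.ofReal_lt_top)
            ENNReal.ofReal_lt_top
  refine hi.congr ?_
  have h3 := Measure.quasiMeasurePreserving_fst (μ := volume.restrict (Iio t))
    (ν := (volume : Measure E)) |>.ae (ae_restrict_of_ae (ae_kernelIntegrand_eq hd h hF hF0 t x))
  filter_upwards [h3] with q hq
  exact (hq q.2).symm

end KernelOp

/-! ### Dissipativity and the energy method. -/

section Energy

variable {χ : ℝ → EuclideanSpace ℝ (Fin d) → ℂ} {T p γ κ M : ℝ}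

lemma fourierInv_sub {g h : E → ℂ} (hg : Integrable g) (hh : Integrable h) (x : E) :
    𝓕⁻ (fun ξ => g ξ - h ξ) x = 𝓕⁻ g x - 𝓕⁻ h x := by
  have hchar : AEStronglyMeasurable (fun ξ : E => ((𝐞 (inner ℝ ξ x) : Circle) : ℂ)) volume := by
    apply Continuous.aestronglyMeasurable
    have := Real.continuous_fourierChar
    fun_prop
  have hi : ∀ {q : E → ℂ}, Integrable q →
      Integrable (fun ξ : E => ((𝐞 (inner ℝ ξ x) : Circle) : ℂ) * q ξ) := fun hq =>
    hq.mono (hchar.mul hq.1) (Filter.Eventually.of_forall fun ξ => (norm_fourierChar_mul _ _).le)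
  simp only [Real.fourierInv_eq, Circle.smul_def, smul_eq_mul, mul_sub]
  exact integral_sub (hi hg) (hi hh)

/-- The quadratic form of an elliptic operator is dissipative. -/
lemma SymbolHyp.re_integral_mul_conj_nonpos (hd : 0 < d) (hχ : SymbolHyp γ κ M χ) (t : ℝ)
    {u g : E → ℂ} (hu : SmoothLTwo u) (hg : MemLp g 2 volume)
    (h : ∀ x, g x = 𝓕⁻ (fun ξ => χ t ξ * ltwoFourier u ξ) x) :
    (∫ x, g x * (starRingEnd ℂ) (u x)).re ≤ 0 := by
  obtain ⟨i1, i2⟩ := hχ.integrable_mul_ltwoFourier hd hu t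
  have h1 : ltwoFourier g =ᵐ[volume] fun ξ => χ t ξ * ltwoFourier u ξ := by
    rw [funext h]
    exact ltwoFourier_fourierInv i1 i2
  have h2 : ∫ x, g x * (starRingEnd ℂ) (u x) =
      ∫ ξ, χ t ξ * ltwoFourier u ξ * (starRingEnd ℂ) (ltwoFourier u ξ) := by
    rw [← integral_ltwoFourier_mul_conj hu.memLp_self hg]
    refine integral_congr_ae ?_
    filter_upwards [h1] with ξ hξ
    rw [hξ]
  have h3 : Integrable fun ξ => χ t ξ * ltwoFourier u ξ * (starRingEnd ℂ) (ltwoFourier u ξ) :=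
    i2.integrable_mul (memLp_ltwoFourier u).star
  rw [h2, ← RCLike.re_eq_complex_re, ← integral_re h3]
  refine integral_nonpos fun ξ => ?_
  simp only [RCLike.re_eq_complex_re, Pi.zero_apply]
  rw [mul_assoc, Complex.mul_conj, Complex.re_mul_ofReal]
  refine mul_nonpos_of_nonpos_of_nonneg ((hχ.re_le t ξ).trans ?_) (Complex.normSq_nonneg _)
  have := hχ.κ_pos
  have : 0 ≤ κ * ‖ξ‖ ^ γ := by positivity
  linarith

lemma SmoothField.integrable_mul_conj {U G : ℝ → E → ℂ} (hU : SmoothField p U)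
    (hG : SmoothField p G) (μ : Measure ℝ) [IsFiniteMeasure μ] :
    Integrable (fun q : ℝ × E => G q.1 q.2 * (starRingEnd ℂ) (U q.1 q.2)) (μ.prod volume) := by
  have hm : Measurable fun q : ℝ × E => G q.1 q.2 * (starRingEnd ℂ) (U q.1 q.2) :=
    hG.measurable.mul (Complex.continuous_conj.measurable.comp hU.measurable)
  obtain ⟨C, hC⟩ := hU.bound []
  obtain ⟨D, hD⟩ := hG.bound []
  refine ⟨hm.aestronglyMeasurable, ?_⟩
  rw [hasFiniteIntegral_iff_enorm, lintegral_prod _ hm.enorm.aemeasurable]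
  have h1 : ∀ t, ∫⁻ x, ‖G t x * (starRingEnd ℂ) (U t x)‖ₑ ≤ D * C := by
    intro t
    have h2 := eLpNorm_le_eLpNorm_mul_eLpNorm_of_nnnorm (p := 2) (q := 2) (r := 1)
      (hG.smoothLTwo t).memLp_self.1 (hU.smoothLTwo t).memLp_self.1
      (fun a b => a * (starRingEnd ℂ) b) 1 (Filter.Eventually.of_forall fun x => by simp)
    rw [eLpNorm_one_eq_lintegral_enorm, ENNReal.coe_one, one_mul] at h2
    exact h2.trans (mul_le_mul' (hD t).1 (hC t).1)
  calc _ ≤ ∫⁻ _, (D * C : ℝ≥0∞) ∂μ := lintegral_mono h1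
    _ = D * C * μ univ := lintegral_const _
    _ < ⊤ := ENNReal.mul_lt_top (ENNReal.mul_lt_top ENNReal.coe_lt_top ENNReal.coe_lt_top)
      (measure_lt_top μ univ)

/-- The energy method. -/
lemma SymbolHyp.eq_zero_of_energy (hd : 0 < d) (hχ : SymbolHyp γ κ M χ) {U G w : ℝ → E → ℂ}
    (hU : SmoothField p U) (hG : SmoothField p G)
    (hac : ∀ x, AbsolutelyContinuousOnInterval (fun t => w t x) 0 T) (hw0 : ∀ x, w 0 x = 0)
    (hwc : ∀ t ∈ Icc 0 T, Continuous (w t))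
    (hwU : ∀ᵐ t ∂(volume.restrict (Ioo 0 T)), w t = U t)
    (hwG : ∀ᵐ t ∂(volume.restrict (Ioo 0 T)), ∀ x, HasDerivAt (fun s => w s x) (G t x) t)
    (heq : ∀ᵐ t ∂(volume.restrict (Ioo 0 T)), ∀ x,
      G t x = 𝓕⁻ (fun ξ => χ t ξ * ltwoFourier (U t) ξ) x)
    {t₀ : ℝ} (ht₀ : t₀ ∈ Icc 0 T) (x : E) : w t₀ x = 0 := by
  set k : ℝ → E → ℂ := fun t x => G t x * (starRingEnd ℂ) (U t x) with hk
  have hki : Integrable (Function.uncurry k) ((volume.restrict (Ioc 0 t₀)).prod volume) :=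
    hU.integrable_mul_conj hG _
  have hsub : ∀ᵐ t, t ∈ Icc 0 t₀ → t ∈ Ioo 0 T := by
    filter_upwards [Measure.ae_ne volume (0 : ℝ), Measure.ae_ne volume T] with t h1 h2 ht
    exact ⟨lt_of_le_of_ne ht.1 h1.symm, lt_of_le_of_ne (ht.2.trans ht₀.2) h2⟩
  have hall : ∀ᵐ t, t ∈ Icc 0 t₀ → w t = U t ∧ (∀ x, HasDerivAt (fun s => w s x) (G t x) t) ∧
      ∀ x, G t x = 𝓕⁻ (fun ξ => χ t ξ * ltwoFourier (U t) ξ) x := by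
    filter_upwards [hsub, (ae_restrict_iff' measurableSet_Ioo).1 hwU,
      (ae_restrict_iff' measurableSet_Ioo).1 hwG, (ae_restrict_iff' measurableSet_Ioo).1 heq]
      with t h1 h2 h3 h4 ht
    exact ⟨h2 (h1 ht), h3 (h1 ht), h4 (h1 ht)⟩
  -- For fixed `x`, `|w|²` is absolutely continuous in time with derivative `2 Re(∂_t w · conj w)`
  -- almost everywhere, and it starts from zero.
  have hpt : ∀ x, Complex.normSq (w t₀ x) = ∫ t in Ioc 0 t₀, 2 * (k t x).re := by
    intro x
    have hac' : AbsolutelyContinuousOnInterval (fun t => w t x) 0 t₀ := by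
      refine (hac x).mono ?_
      rw [uIcc_of_le ht₀.1, uIcc_of_le (ht₀.1.trans ht₀.2)]
      exact Icc_subset_Icc_right ht₀.2
    have hre := absolutelyContinuousOnInterval_re hac'
    have him := absolutelyContinuousOnInterval_im hac'
    have h1 := (integral_eq_sub_of_ae_hasDerivAt_real ((hre.fun_mul hre).fun_add
      (him.fun_mul him)) (g := fun t => 2 * (k t x).re) ?_).2
    · rw [intervalIntegral.integral_of_le ht₀.1] at h1
      rw [h1, hw0 x]
      simp [Complex.normSq_apply]
    · rw [uIcc_of_le ht₀.1]
      filter_upwards [hall] with t ht htm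
      obtain ⟨e1, e2, -⟩ := ht htm
      have d1 : HasDerivAt (fun s => (w s x).re) (G t x).re t :=
        Complex.reCLM.hasFDerivAt.comp_hasDerivAt t (e2 x)
      have d2 : HasDerivAt (fun s => (w s x).im) (G t x).im t :=
        Complex.imCLM.hasFDerivAt.comp_hasDerivAt t (e2 x)
      refine ((d1.fun_mul d1).fun_add (d2.fun_mul d2)).congr_deriv ?_
      simp only [hk, Complex.mul_re, Complex.conj_re, Complex.conj_im, ← e1]
      ring
  have hkre : Integrable (Function.uncurry fun t x => 2 * (k t x).re)
      ((volume.restrict (Ioc 0 t₀)).prod volume) := hki.re.const_mul 2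
  have hNi : Integrable fun x => Complex.normSq (w t₀ x) := by
    simp only [hpt]
    exact hkre.integral_prod_right
  -- After exchanging the integrals, the inner one is, for almost every time, twice the real part of
  -- the quadratic form, which is nonpositive.
  have hN : ∫ x, Complex.normSq (w t₀ x) ≤ 0 := by
    simp only [hpt]
    rw [← integral_integral_swap hkre]
    refine integral_nonpos_of_ae ?_
    have h1 : ∀ᵐ t ∂(volume.restrict (Ioc 0 t₀)), Integrable (k t) := hki.prod_right_ae
    filter_upwards [h1, ae_restrict_of_ae hall, ae_restrict_mem measurableSet_Ioc]
      with t hkt ht htm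
    have h2 : ∫ x, (k t x).re = (∫ x, k t x).re := integral_re hkt
    rw [integral_const_mul, h2]
    have h3 := hχ.re_integral_mul_conj_nonpos hd t (hU.smoothLTwo t) (hG.smoothLTwo t).memLp_self
      (ht (Ioc_subset_Icc_self htm)).2.2
    simp only [Pi.zero_apply]
    linarith
  have hzero : (fun x => Complex.normSq (w t₀ x)) =ᵐ[volume] 0 :=
    (integral_eq_zero_iff_of_nonneg (fun x => Complex.normSq_nonneg _) hNi).1
      (le_antisymm hN (integral_nonneg fun x => Complex.normSq_nonneg _))
  have hc : Continuous fun x => Complex.normSq (w t₀ x) :=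
    Complex.continuous_normSq.comp (hwc t₀ ht₀)
  have := (hc.ae_eq_iff_eq volume continuous_zero).1 hzero
  exact Complex.normSq_eq_zero.1 (congrFun this x)

end Energy

/-! ### Uniqueness and existence for the original Cauchy problem. -/

section Cauchy

variable {ψ χ f F : ℝ → EuclideanSpace ℝ (Fin d) → ℂ} {T p γ κ M : ℝ}

/-- In the difference the forcing cancels, so the energy method applies. The solutions and their
time derivatives are replaced by smooth fields agreeing with them at almost every time, because
their norm bounds are only given almost everywhere; continuity in `x` at every `t` yields the
pointwise conclusion. -/
lemma IsCauchySolution.eq (hd : 0 < d) (hp : 1 ≤ p) (hT : 0 < T) (hχ : SymbolHyp γ κ M χ)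
    (h : ∀ᵐ r, ∀ η, η ≠ 0 → χ r η = ψ r ((2 * Real.pi) • η)) {u v : ℝ → E → ℂ}
    (hu : IsCpOneInf T p u) (hu' : IsCauchySolution T ψ f u)
    (hv : IsCpOneInf T p v) (hv' : IsCauchySolution T ψ f v) :
    ∀ t ∈ Icc 0 T, ∀ x, u t x = v t x := by
  obtain ⟨gu, hgu, hgu'⟩ := hu.timeDeriv
  obtain ⟨gv, hgv, hgv'⟩ := hv.timeDeriv
  rw [← restrict_Ioo_eq_restrict_Icc] at hgu' hgv'
  obtain ⟨U₁, hU₁, hU₁', -⟩ := hu.isCpInf.exists_smoothField hT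
  obtain ⟨U₂, hU₂, hU₂', -⟩ := hv.isCpInf.exists_smoothField hT
  obtain ⟨G₁, hG₁, hG₁', -⟩ := hgu.exists_smoothField hT
  obtain ⟨G₂, hG₂, hG₂', -⟩ := hgv.exists_smoothField hT
  have hsubfield : ∀ {A B : ℝ → E → ℂ}, SmoothField p A → SmoothField p B →
      SmoothField p (fun t => A t - B t) := fun {A B} hA hB => by
    have h1 := hA.add hp (hB.const_mul (-1))
    have e : (fun t => A t - B t) = fun t x => A t x + -1 * B t x := by
      funext t x
      simp only [Pi.sub_apply]; ring
    rw [e]; exact h1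
  intro t ht x
  rw [← sub_eq_zero]
  refine hχ.eq_zero_of_energy hd (w := fun t => u t - v t) (hsubfield hU₁ hU₂)
    (hsubfield hG₁ hG₂) (fun x => (hu.absolutelyContinuous x).fun_sub (hv.absolutelyContinuous x))
    (fun x => ?_) (fun t ht => (hu.contDiff t ht).continuous.sub (hv.contDiff t ht).continuous)
    ?_ ?_ ?_ ht x
  · simp [hu'.2, hv'.2]
  · filter_upwards [hU₁', hU₂'] with t h1 h2
    rw [h1, h2]
  · filter_upwards [hG₁', hG₂', hgu', hgv'] with t h1 h2 h3 h4 x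
    simp only [h1, h2]
    exact (h3 x).fun_sub (h4 x)
  · filter_upwards [hU₁', hU₂', hG₁', hG₂', hgu', hgv', hu'.1, hv'.1, ae_restrict_of_ae h]
      with t e1 e2 e3 e4 d1 d2 d3 d4 hψ x
    have i1 := hU₁.smoothLTwo t
    have i2 := hU₂.smoothLTwo t
    have h1 := (d1 x).unique (d3 x)
    have h2 := (d2 x).unique (d4 x)
    rw [pseudoDiff_eq_fourierInv hd hψ, ← e1] at h1
    rw [pseudoDiff_eq_fourierInv hd hψ, ← e2] at h2
    rw [Pi.sub_apply, e3, e4, h1, h2, add_sub_add_right_eq_sub,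
      ← fourierInv_sub (hχ.integrable_mul_ltwoFourier hd i1 t).1
        (hχ.integrable_mul_ltwoFourier hd i2 t).1]
    refine fourierInv_congr_ae ?_ x
    filter_upwards [ltwoFourier_sub i1.memLp_self i2.memLp_self] with ξ hξ
    rw [hξ, Pi.sub_apply, mul_sub]

lemma isCauchySolution_duhamel (hd : 0 < d) (hp : 1 ≤ p) (hT : 0 < T) (hχ : SymbolHyp γ κ M χ)
    (h : ∀ᵐ r, ∀ η, η ≠ 0 → χ r η = ψ r ((2 * Real.pi) • η)) (hFs : SmoothField p F)
    (hF : ∀ᵐ t ∂(volume.restrict (Ioo 0 T)), F t = f t) :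
    IsCauchySolution T ψ f (duhamel T χ F) := by
  refine ⟨?_, fun x => ?_⟩
  · filter_upwards [hχ.ae_hasDerivAt_duhamel hd hp hFs T, hF, ae_restrict_of_ae h]
      with t h1 h2 h3 x
    rw [pseudoDiff_eq_fourierInv hd h3, ← h2]
    exact h1 x
  · rw [hχ.duhamel_eq_integral hd hp hFs (left_mem_Icc.2 hT.le), intervalIntegral.integral_same]

end Cauchy

end PseudoDiffCauchy

theorem theorem21p01p08p11 (d : ℕ) (hd : 0 < d) (T : ℝ) (hT : 0 < T) (p : ℝ) (hp : 1 < p)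
    (γ κ M : ℝ) (ψ : ℝ → EuclideanSpace ℝ (Fin d) → ℂ)
    (hψ : LocallyIntegrable (Function.uncurry ψ) volume)
    (hell : PseudoDiffCauchy.IsElliptic ψ γ κ)
    (hreg : PseudoDiffCauchy.HasRegularUpperBound (d / 2 + 1) ψ γ M)
    (f : ℝ → EuclideanSpace ℝ (Fin d) → ℂ) (hf : PseudoDiffCauchy.IsCpInf T p f) :
    (∃ u : ℝ → EuclideanSpace ℝ (Fin d) → ℂ,
      PseudoDiffCauchy.IsCpOneInf T p u ∧ PseudoDiffCauchy.IsCauchySolution T ψ f u) ∧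
    (∀ u v : ℝ → EuclideanSpace ℝ (Fin d) → ℂ,
      PseudoDiffCauchy.IsCpOneInf T p u → PseudoDiffCauchy.IsCauchySolution T ψ f u →
      PseudoDiffCauchy.IsCpOneInf T p v → PseudoDiffCauchy.IsCauchySolution T ψ f v →
      ∀ t ∈ Icc 0 T, ∀ x, u t x = v t x) ∧
    (∀ s t : ℝ, s < t → Integrable
      (fun ξ : EuclideanSpace ℝ (Fin d) => Complex.exp (∫ r in s..t, ψ r ξ)) volume) ∧
    (∀ t ∈ Icc 0 T, ∀ x, Integrable
      (Function.uncurry (PseudoDiffCauchy.kernelIntegrand T ψ f t x))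
      ((volume.restrict (Iio t)).prod volume)) ∧
    (∀ u : ℝ → EuclideanSpace ℝ (Fin d) → ℂ,
      PseudoDiffCauchy.IsCpOneInf T p u → PseudoDiffCauchy.IsCauchySolution T ψ f u →
      ∀ t ∈ Icc 0 T, ∀ x, u t x = PseudoDiffCauchy.kernelOp T ψ f t x) := by
  obtain ⟨κ', M', χ, hχ, h⟩ := PseudoDiffCauchy.exists_symbolHyp hd hψ hell hreg
  obtain ⟨F, hFs, hF, hF0⟩ := hf.exists_smoothField hT
  have h1 := hχ.isCpOneInf_duhamel hd hp.le hFs hT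
  have h2 := PseudoDiffCauchy.isCauchySolution_duhamel hd hp.le hT hχ h hFs hF
  refine ⟨⟨_, h1, h2⟩, fun u v hu hu' hv hv' => hu'.eq hd hp.le hT hχ h hu hv hv',
    fun s t hst => PseudoDiffCauchy.integrable_exp_integral hd hχ h hst,
    fun t _ x => PseudoDiffCauchy.integrable_kernelIntegrand hd hp.le hχ h hFs hF hF0 t x,
    fun u hu hu' t ht x => ?_⟩
  -- The kernel formula is Duhamel's integral, itself a solution in the class, so uniqueness
  -- identifies it with any given solution.
  rw [PseudoDiffCauchy.kernelOp_eq_duhamel hd h hF hF0]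
  exact hu'.eq hd hp.le hT hχ h hu h1 h2 t ht x

end
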